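/- **Conventions.** Functions are complex valued and derivatives are in the sense of distributions. All norms below take values in $[0,\infty]$: the $L^2$ norm of a distribution that is not a square integrable function is $\infty$. *Three dimensions.* Let $\breve\Omega\subset\mathbb R^3$ be open and invariant under all rotations around the $z$-axis (it may or may not contain points of the axis). Let $(r,z,\theta)$ be cylindrical coordinates, $x=r\cos\theta$, $y=r\sin\theta$, and let $\Omega=\{(r,z): r>0,\ (r,0,z)\in\breve\Omega\}$ be the meridian domain of $\breve\Omega$. Let $L^2_1(\Omega)$ be the $L^2$ space on $\Omega$ for the measure $2\pi r\,dr\,dz$, and for $n\in\mathbb N=\{0,1,2,\dots\}$ set $$\|v\|^2_{H^n_1(\Omega)}=\sum_{|\alpha|\le n}\|\partial^\alpha_{(r,z)}v\|^2_{L^2_1(\Omega)},\qquad \|u\|^2_{H^n(\breve\Omega)}=\sum_{|\alpha|\le n}\|\partial^\alpha_{(x,y,z)}u\|^2_{L^2(\breve\Omega)}.$$ For $m\in\mathbb N$, $k\in\mathbb Z$ and $w\in L^2_1(\Omega)$ put $\|w\|_{H^m_{(k)}(\Omega)}=\|\breve w_k\|_{H^m(\breve\Omega)}$, where $\breve w_k=w(r,z)\,e^{ik\theta}$,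 and $$\|w\|^2_{C^m_{(k)}(\Omega)}=\sum_{\ell=0}^{\min\{|k|,m\}}\Big\|\Big(\frac{|k|}{r}\Big)^{\ell}w\Big\|^2_{H^{m-\ell}_1(\Omega)}+\sum_{1\le\ell\le(m-|k|)/2}\Big\|\Big(\frac1r\partial_r\Big)^{\ell}\Big(\frac1r\Big)^{|k|}w\Big\|^2_{H^{m-|k|-2\ell}_1(\Omega)},$$ with $(|k|/r)^0=1$ for all $k$; the second sum is empty if $|k|>m-2$. *Two dimensions.* Let $\breve\Omega\subset\mathbb R^2$ be open and invariant under all rotations around the origin, with polar coordinates $(r,\theta)$, and let $\Omega=\{r>0:(r,0)\in\breve\Omega\}$ (for example an open interval, when $\breve\Omega$ is a disc or an annulus). The same definitions are used, without the variable $z$, with $L^2_1(\Omega)$ taken for the measure $2\pi r\,dr$ and $\|v\|^2_{H^n_1(\Omega)}=\sum_{j\le n}\|\partial_r^jv\|^2_{L^2_1(\Omega)}$. **Theorem.** (i) For every $m\in\mathbb N$ there are positive constants $c_m,C_m$ such that for every $k\in\mathbb Z$, every $\breve\Omega\subset\mathbb R^3$ as above with meridian domain $\Omega$, and every $w\in L^2_1(\Omega)$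 (in particular for the $k$-th Fourier coefficient $w=u^k$ of any $u\in L^2(\breve\Omega)$), $$c_m\,\|w\|^2_{H^m_{(k)}(\Omega)}\le\|w\|^2_{C^m_{(k)}(\Omega)}\le C_m\,\|w\|^2_{H^m_{(k)}(\Omega)} .$$ In particular $\breve w_k\in H^m(\breve\Omega)$ if and only if $\|w\|_{C^m_{(k)}(\Omega)}<\infty$. (ii) The same holds in two dimensions: for every $m\in\mathbb N$ there are positive constants $c_m,C_m$ such that the same inequalities hold for every $k\in\mathbb Z$, every $\breve\Omega\subset\mathbb R^2$ as above with its $\Omega$, and every $w\in L^2_1(\Omega)$. -/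

import Mathlib

open MeasureTheory
open scoped ENNReal NNReal ContDiff

noncomputable section

namespace AxiSobolev

section Weak

variable {E : Type*} [NormedAddCommGroup E] [NormedSpace ℝ E]

/-- Test functions on the open set `Ω`: smooth, complex-valued, with compact support in `Ω`. -/
structure IsTestFunction (Ω : Set E) (φ : E → ℂ) : Prop where
  contDiff : ContDiff ℝ ∞ φ
  hasCompactSupport : HasCompactSupport φ
  tsupport_subset : tsupport φ ⊆ Ω

/-- A functional on test functions. The functionals used below are all obtained from locally
integrable functions by differentiation and by multiplication with functions that are smooth on
the domain, so they are distributions; they are only ever evaluated on test functions. -/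
abbrev Functional (E : Type*) : Type _ := (E → ℂ) → ℂ

/-- The distribution on `Ω` defined by a function: `φ ↦ ∫_Ω f φ`. -/
def ofFun [MeasureSpace E] (Ω : Set E) (f : E → ℂ) : Functional E :=
  fun φ => ∫ x in Ω, f x * φ x

/-- The distributional derivative in the direction `e`: `⟨∂_e T, φ⟩ = -⟨T, ∂_e φ⟩`. -/
def pderiv (e : E) (T : Functional E) : Functional E :=
  fun φ => -T (fun x => fderiv ℝ φ x e)

/-- The product of a distribution with a function `a`: `⟨a T, φ⟩ = ⟨T, a φ⟩`. -/
def mulBy (a : E → ℝ) (T : Functional E) : Functional E :=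
  fun φ => T (fun x => (a x : ℂ) * φ x)

/-- For a frame `e` and a multi-index `α`, the derivative
`∂^α T = ∂_{e 0}^{α 0} ∂_{e 1}^{α 1} ⋯ T`. -/
def multiDeriv {d : ℕ} (e : Fin d → E) (α : Fin d → ℕ) (T : Functional E) : Functional E :=
  (List.finRange d).foldr (fun i S => (pderiv (e i))^[α i] S) T

/-- On `Ω`, the functional `T` is the locally integrable function `g`. -/
def Represents [MeasureSpace E] (Ω : Set E) (T : Functional E) (g : E → ℂ) : Prop :=
  LocallyIntegrableOn g Ω ∧ ∀ φ : E → ℂ, IsTestFunction Ω φ → T φ = ∫ x in Ω, g x * φ x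

/-- The squared norm `‖T‖²` in `L²(μ)` of a distribution `T` on `Ω`, where `μ` is a measure
carried by `Ω` and absolutely continuous there: it is `∫ |g|² dμ` if `T` is a locally integrable
function `g` on `Ω` (which is then unique almost everywhere), and `∞` otherwise. -/
def normSqL2 [MeasureSpace E] (μ : Measure E) (Ω : Set E) (T : Functional E) : ℝ≥0∞ :=
  ⨅ (g : E → ℂ) (_ : Represents Ω T g), eLpNorm g 2 μ ^ 2

/-- The squared Sobolev norm `∑_{|α| ≤ m} ‖∂^α T‖²` with respect to the measure `μ`, with
derivatives along the frame `e`. -/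
def normSqSobolev [MeasureSpace E] {d : ℕ} (μ : Measure E) (Ω : Set E) (e : Fin d → E) (m : ℕ)
    (T : Functional E) : ℝ≥0∞ :=
  ∑ j ∈ Finset.range (m + 1), ∑ α ∈ Finset.piAntidiag (Finset.univ : Finset (Fin d)) j,
    normSqL2 μ Ω (multiDeriv e α T)

/-- The sum of squared weighted norms
`∑_{ℓ=0}^{min(|k|,m)} ‖(|k|/r)^ℓ w‖²_{H^{m-ℓ}}
  + ∑_{1 ≤ ℓ ≤ (m-|k|)/2} ‖((1/r) ∂_r)^ℓ (1/r)^{|k|} w‖²_{H^{m-|k|-2ℓ}}`,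
where `r` is the radial coordinate on `E`, `er` the radial direction, and the Sobolev norms are
taken with respect to `μ` and the frame `e`. -/
def normSqC [MeasureSpace E] {d : ℕ} (μ : Measure E) (Ω : Set E) (e : Fin d → E) (r : E → ℝ)
    (er : E) (m : ℕ) (k : ℤ) (w : E → ℂ) : ℝ≥0∞ :=
  ∑ ℓ ∈ Finset.range (min k.natAbs m + 1),
      normSqSobolev μ Ω e (m - ℓ)
        (mulBy (fun p => ((k.natAbs : ℝ) / r p) ^ ℓ) (ofFun Ω w))
    + ∑ ℓ ∈ Finset.Icc 1 ((m - k.natAbs) / 2),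
      normSqSobolev μ Ω e (m - k.natAbs - 2 * ℓ)
        ((fun S => mulBy (fun p => 1 / r p) (pderiv er S))^[ℓ]
          (mulBy (fun p => (1 / r p) ^ k.natAbs) (ofFun Ω w)))

end Weak

/-! ### Rotation around the origin of the plane, and angular modes -/

/-- Rotation of the plane by the angle `θ`. -/
def rot (θ : ℝ) (x : ℝ × ℝ) : ℝ × ℝ :=
  (Real.cos θ * x.1 - Real.sin θ * x.2, Real.sin θ * x.1 + Real.cos θ * x.2)

/-- The radius `r = √(x² + y²)`. -/
def radius (x : ℝ × ℝ) : ℝ := Real.sqrt (x.1 ^ 2 + x.2 ^ 2)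

/-- The angular mode `e^{ikθ}`, where `θ` is the polar angle of the point `(x, y)`. -/
def mode (k : ℤ) (x : ℝ × ℝ) : ℂ :=
  Complex.exp (Complex.I * (k : ℂ) * (Complex.arg ⟨x.1, x.2⟩ : ℂ))

/-! ### Three dimensions: points are `((x, y), z)`, the axis of rotation is the `z`-axis -/

/-- Invariance under all rotations around the `z`-axis. -/
def IsAxisymmetric3 (U : Set ((ℝ × ℝ) × ℝ)) : Prop :=
  ∀ θ : ℝ, ∀ x ∈ U, (rot θ x.1, x.2) ∈ U

/-- The meridian domain: the points `(r, z)` with `r > 0` and `(r, 0, z) ∈ U`. -/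
def meridian3 (U : Set ((ℝ × ℝ) × ℝ)) : Set (ℝ × ℝ) :=
  {p | 0 < p.1 ∧ ((p.1, 0), p.2) ∈ U}

/-- The measure `2π r dr dz` on `Ω`, so that `L²` of it is `L²_1(Ω)`. -/
def meridianMeasure3 (Ω : Set (ℝ × ℝ)) : Measure (ℝ × ℝ) :=
  (volume.restrict Ω).withDensity (fun p => ENNReal.ofReal (2 * Real.pi * p.1))

/-- The function `w(r, z) e^{ikθ}` of three variables. -/
def lift3 (k : ℤ) (w : ℝ × ℝ → ℂ) : (ℝ × ℝ) × ℝ → ℂ :=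
  fun x => mode k x.1 * w (radius x.1, x.2)

/-- The squared norm of `w` in `H^m_{(k)}(Ω)`, `Ω` the meridian domain of `U`: the squared
`H^m(U)` norm of `w(r, z) e^{ikθ}`, in Cartesian coordinates. -/
def normSqHk3 (m : ℕ) (k : ℤ) (U : Set ((ℝ × ℝ) × ℝ)) (w : ℝ × ℝ → ℂ) : ℝ≥0∞ :=
  normSqSobolev (volume.restrict U) U
    ![((1, 0), 0), ((0, 1), 0), ((0, 0), 1)] m (ofFun U (lift3 k w))

/-- The squared weighted norm on the meridian domain `Ω` in the variables `(r, z)`. -/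
def normSqC3 (m : ℕ) (k : ℤ) (Ω : Set (ℝ × ℝ)) (w : ℝ × ℝ → ℂ) : ℝ≥0∞ :=
  normSqC (meridianMeasure3 Ω) Ω ![(1, 0), (0, 1)] Prod.fst (1, 0) m k w

/-! ### Two dimensions: points are `(x, y)`, rotation around the origin -/

/-- Invariance under all rotations around the origin. -/
def IsAxisymmetric2 (U : Set (ℝ × ℝ)) : Prop :=
  ∀ θ : ℝ, ∀ x ∈ U, rot θ x ∈ U

/-- The meridian domain: the `r > 0` with `(r, 0) ∈ U`. -/
def meridian2 (U : Set (ℝ × ℝ)) : Set ℝ :=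
  {r | 0 < r ∧ (r, 0) ∈ U}

/-- The measure `2π r dr` on `Ω`. -/
def meridianMeasure2 (Ω : Set ℝ) : Measure ℝ :=
  (volume.restrict Ω).withDensity (fun r => ENNReal.ofReal (2 * Real.pi * r))

/-- The function `w(r) e^{ikθ}` of two variables. -/
def lift2 (k : ℤ) (w : ℝ → ℂ) : ℝ × ℝ → ℂ :=
  fun x => mode k x * w (radius x)

/-- The squared norm of `w` in `H^m_{(k)}(Ω)`, `Ω` the meridian domain of `U`: the squared
`H^m(U)` norm of `w(r) e^{ikθ}`, in Cartesian coordinates. -/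
def normSqHk2 (m : ℕ) (k : ℤ) (U : Set (ℝ × ℝ)) (w : ℝ → ℂ) : ℝ≥0∞ :=
  normSqSobolev (volume.restrict U) U ![(1, 0), (0, 1)] m (ofFun U (lift2 k w))

/-- The squared weighted norm on the meridian domain `Ω` in the variable `r`. -/
def normSqC2 (m : ℕ) (k : ℤ) (Ω : Set ℝ) (w : ℝ → ℂ) : ℝ≥0∞ :=
  normSqC (meridianMeasure2 Ω) Ω ![1] (fun r => r) 1 m k w

end AxiSobolev

end

/-! ### Quadratic gauges -/

namespace AxiSobolev

/-! In cylindrical coordinates `∂_x ± i∂_y` sends `w e^{ikθ}` to `((∂_r ∓ k/r) w) e^{i(k±1)θ}`, and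
`∂_r r^{-n} p(r∂_r) = r^{-n-1} ((X - n) p)(r∂_r)`. Hence every planar Cartesian derivative of order
`n`, and every weighted term of total order `n` in `∂_r` and `1/r`, has the form `r^{-n} p(r∂_r) w`
with an explicit product `p` of linear factors: `cartPoly`, `radPoly`, `axisPoly`. Attaching
`e^{ikθ}` is an isometry of `L²` norms (`distNormSq_lift`). What remains is to compare two finite
families of polynomials under an arbitrary gauge on `ℂ[X]`, with constants independent of `k`.

Weighted by Cartesian (`exists_wt_le_cartSum`): half the sum and half the difference of two
neighbouring Cartesian symbols of order `j + 1` are `X - j` times, respectively `k + a - b` times, a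
symbol of order `j`. The sum accounts for radial derivatives. The difference accounts for division
by `r`, and is needed only where `k + a - b` cannot vanish, by size (`|k| > j`) or by parity.

Cartesian by weighted (`exists_cart_le_wtSum`): for `|k| ≥ j` an induction on the order works,
because the coefficient `k + a - b` is at most `2|k|` and a factor `|k|` is paid for by one more
power of `|k|/r` (`exists_rad_mul_le`). Only finitely many modes are left, so uniformity is free.
For them, `r^{|k|+2t} e^{ikθ}` is a polynomial of degree `|k| + 2t` in `x, y`, which derivatives of
higher order kill. So the Cartesian symbols of order `j` vanish at the `|k| + 2t < j`, and
polynomials of degree at most `j` with these zeros are combinations of weighted symbols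
(`exists_le_wtSum_of_eval_eq_zero`).

Polar coordinates only see the domain off the axis. The axis has codimension two, and a first
derivative of an `L²` function that is `L²` off it has no singular part on it
(`distNormSq_distDeriv_le`): cutoffs at scale `1/n` have gradients of size `n` on sets of measure
`O(n^{-2})`. This is applied one derivative at a time. Axial derivatives commute with all radial
operators. Both dimensions are instances of plane times `F`, with `F` the line or a point. -/

/-- A function that behaves like the square of a (possibly infinite) seminorm, up to the factor
`2` in the triangle inequality. -/
structure IsQuadGauge {V : Type*} [AddCommGroup V] [Module ℂ V] (N : V → ℝ≥0∞) : Prop where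
  add_le : ∀ x y, N (x + y) ≤ 2 * (N x + N y)
  smul_le : ∀ (c : ℂ) x, N (c • x) ≤ ‖c‖ₑ ^ 2 * N x

namespace IsQuadGauge

variable {V W : Type*} [AddCommGroup V] [Module ℂ V] [AddCommGroup W] [Module ℂ W]
  {N : V → ℝ≥0∞}

theorem comp (hN : IsQuadGauge N) (f : W →ₗ[ℂ] V) : IsQuadGauge (fun x => N (f x)) where
  add_le x y := by rw [map_add]; exact hN.add_le _ _
  smul_le c x := by rw [map_smul]; exact hN.smul_le _ _

theorem smul_le_of_le (hN : IsQuadGauge N) {c : ℂ} {K : ℝ≥0} (hc : ‖c‖₊ ≤ K) (x : V) :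
    N (c • x) ≤ (K : ℝ≥0∞) ^ 2 * N x := by
  refine (hN.smul_le c x).trans ?_
  gcongr
  exact_mod_cast hc

end IsQuadGauge

/-! ### The symbols of the radial operators -/

open Polynomial

/-- Symbol of `(∂_x + i∂_y)^a (∂_x - i∂_y)^b` on functions of angular mode `k`. -/
noncomputable def cartPoly (k : ℤ) (a b : ℕ) : ℂ[X] :=
  (∏ i ∈ Finset.range a, (X - C ((k : ℂ) + 2 * i))) *
    ∏ i ∈ Finset.range b, (X - C (2 * (i : ℂ) - k))

/-- Symbol of `∂_r^{j-ℓ} (κ/r)^ℓ`. -/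
noncomputable def radPoly (κ ℓ j : ℕ) : ℂ[X] :=
  C ((κ : ℂ) ^ ℓ) * ∏ i ∈ Finset.Ico ℓ j, (X - C (i : ℂ))

/-- Symbol of `∂_r^{j-κ-2ℓ} ((1/r)∂_r)^ℓ (1/r)^κ`. -/
noncomputable def axisPoly (κ ℓ j : ℕ) : ℂ[X] :=
  (∏ i ∈ Finset.range ℓ, (X - C ((κ : ℂ) + 2 * i))) *
    ∏ i ∈ Finset.Ico (κ + 2 * ℓ) j, (X - C (i : ℂ))

/-- Multiplication by a fixed polynomial, as a linear map. -/
noncomputable def mulPoly (q : ℂ[X]) : ℂ[X] →ₗ[ℂ] ℂ[X] := LinearMap.mulLeft ℂ q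

@[simp] theorem mulPoly_apply (q p : ℂ[X]) : mulPoly q p = q * p := rfl

theorem cartPoly_succ_left (k : ℤ) (a b : ℕ) :
    cartPoly k (a + 1) b = (X - C ((k : ℂ) + 2 * a)) * cartPoly k a b := by
  simp only [cartPoly, Finset.prod_range_succ]; ring

theorem cartPoly_succ_right (k : ℤ) (a b : ℕ) :
    cartPoly k a (b + 1) = (X - C (2 * (b : ℂ) - k)) * cartPoly k a b := by
  simp only [cartPoly, Finset.prod_range_succ]; ring

/-- A factor `X - j` on a symbol of order `j` is one more radial derivative, because `∂_r r^{-j} =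
r^{-j-1} (r∂_r - j)`. -/
theorem radPoly_succ {κ ℓ j : ℕ} (h : ℓ ≤ j) :
    radPoly κ ℓ (j + 1) = (X - C (j : ℂ)) * radPoly κ ℓ j := by
  simp only [radPoly, Finset.prod_Ico_succ_top h]; ring

theorem radPoly_self (κ j : ℕ) : radPoly κ j j = C ((κ : ℂ) ^ j) := by
  simp [radPoly]

theorem axisPoly_succ {κ ℓ j : ℕ} (h : κ + 2 * ℓ ≤ j) :
    axisPoly κ ℓ (j + 1) = (X - C (j : ℂ)) * axisPoly κ ℓ j := by
  simp only [axisPoly, Finset.prod_Ico_succ_top h]; ring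

theorem axisPoly_self (κ ℓ : ℕ) : axisPoly κ ℓ (κ + 2 * ℓ) =
    ∏ i ∈ Finset.range ℓ, (X - C ((κ : ℂ) + 2 * i)) := by
  simp [axisPoly]

/-- Division by `r` raises the order and leaves the polynomial unchanged, so `(1/r)∂_r` and `∂_r`
contribute the same factor `X - (κ + 2ℓ)`. -/
theorem axisPoly_new (κ ℓ : ℕ) :
    axisPoly κ (ℓ + 1) (κ + 2 * (ℓ + 1)) = axisPoly κ ℓ (κ + 2 * ℓ + 1) := by
  rw [axisPoly_self, axisPoly_succ le_rfl, axisPoly_self, Finset.prod_range_succ]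
  push_cast
  ring

/-- The total gauge of the Cartesian derivatives of order `j`. -/
noncomputable def cartSum (k : ℤ) (j : ℕ) (N : ℂ[X] → ℝ≥0∞) : ℝ≥0∞ :=
  ∑ a ∈ Finset.range (j + 1), N (cartPoly k a (j - a))

/-- The total gauge of the terms of order `j` in the weighted norm. -/
noncomputable def wtSum (κ j : ℕ) (N : ℂ[X] → ℝ≥0∞) : ℝ≥0∞ :=
  ∑ ℓ ∈ Finset.range (min κ j + 1), N (radPoly κ ℓ j) +
    ∑ ℓ ∈ Finset.Icc 1 ((j - κ) / 2), N (axisPoly κ ℓ j)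

theorem le_cartSum (k : ℤ) {a b j : ℕ} (h : a + b = j) (N : ℂ[X] → ℝ≥0∞) :
    N (cartPoly k a b) ≤ cartSum k j N := by
  obtain rfl : b = j - a := by omega
  exact Finset.single_le_sum (f := fun a => N (cartPoly k a (j - a))) (fun _ _ => zero_le)
    (Finset.mem_range.2 (by omega))

theorem rad_le_wtSum {κ ℓ j : ℕ} (h : ℓ ≤ κ) (h' : ℓ ≤ j) (N : ℂ[X] → ℝ≥0∞) :
    N (radPoly κ ℓ j) ≤ wtSum κ j N :=
  (Finset.single_le_sum (f := fun ℓ => N (radPoly κ ℓ j)) (fun _ _ => zero_le)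
    (Finset.mem_range.2 (by omega))).trans le_self_add

theorem axis_le_wtSum {κ ℓ j : ℕ} (h : 1 ≤ ℓ) (h' : κ + 2 * ℓ ≤ j) (N : ℂ[X] → ℝ≥0∞) :
    N (axisPoly κ ℓ j) ≤ wtSum κ j N :=
  (Finset.single_le_sum (f := fun ℓ => N (axisPoly κ ℓ j)) (fun _ _ => zero_le)
    (Finset.mem_Icc.2 (by omega))).trans le_add_self

theorem cartSum_le {k : ℤ} {j : ℕ} {N : ℂ[X] → ℝ≥0∞} {K : ℝ≥0∞}
    (h : ∀ a b, a + b = j → N (cartPoly k a b) ≤ K) : cartSum k j N ≤ (j + 1) * K := by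
  calc cartSum k j N ≤ ∑ _a ∈ Finset.range (j + 1), K :=
        Finset.sum_le_sum fun a ha => h _ _ (by rw [Finset.mem_range] at ha; omega)
    _ = _ := by simp

theorem wtSum_le {κ j : ℕ} {N : ℂ[X] → ℝ≥0∞} {K : ℝ≥0∞}
    (h : ∀ ℓ ≤ κ, ℓ ≤ j → N (radPoly κ ℓ j) ≤ K)
    (h' : ∀ ℓ, 1 ≤ ℓ → κ + 2 * ℓ ≤ j → N (axisPoly κ ℓ j) ≤ K) :
    wtSum κ j N ≤ (2 * j + 1) * K := by
  have h1 : ∑ ℓ ∈ Finset.range (min κ j + 1), N (radPoly κ ℓ j) ≤ (j + 1) * K := by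
    calc _ ≤ ∑ _ℓ ∈ Finset.range (min κ j + 1), K :=
          Finset.sum_le_sum fun ℓ hℓ => by
            rw [Finset.mem_range] at hℓ; exact h _ (by omega) (by omega)
      _ = ((min κ j + 1 : ℕ) : ℝ≥0∞) * K := by simp
      _ ≤ ((j + 1 : ℕ) : ℝ≥0∞) * K := by gcongr; omega
      _ = _ := by push_cast; rfl
  have h2 : ∑ ℓ ∈ Finset.Icc 1 ((j - κ) / 2), N (axisPoly κ ℓ j) ≤ j * K := by
    calc _ ≤ ∑ _ℓ ∈ Finset.Icc 1 ((j - κ) / 2), K :=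
          Finset.sum_le_sum fun ℓ hℓ => by
            rw [Finset.mem_Icc] at hℓ; exact h' _ (by omega) (by omega)
      _ = (((j - κ) / 2 : ℕ) : ℝ≥0∞) * K := by simp
      _ ≤ (j : ℝ≥0∞) * K := by gcongr; omega
  calc wtSum κ j N ≤ (j + 1) * K + j * K := add_le_add h1 h2
    _ = _ := by ring

/-- Raising the order by a radial derivative. -/
theorem wtSum_shift_le {κ j : ℕ} (N : ℂ[X] → ℝ≥0∞) :
    wtSum κ j (fun p => N (mulPoly (X - C (j : ℂ)) p)) ≤ (2 * j + 1) * wtSum κ (j + 1) N := by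
  refine wtSum_le (fun ℓ h h' => ?_) (fun ℓ h h' => ?_)
  · rw [mulPoly_apply, ← radPoly_succ h']
    exact rad_le_wtSum h (by omega) N
  · rw [mulPoly_apply, ← axisPoly_succ h']
    exact axis_le_wtSum h (by omega) N

/-! ### Weighted symbols bounded by Cartesian symbols -/

theorem cartPoly_left_eq (k : ℤ) {a b j : ℕ} (h : a + b = j) :
    cartPoly k (a + 1) b = mulPoly (X - C (j : ℂ)) (cartPoly k a b) +
      (-((k : ℂ) + a - b)) • cartPoly k a b := by
  subst h
  rw [cartPoly_succ_left, mulPoly_apply, smul_eq_C_mul]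
  simp only [map_add, map_sub, map_neg, map_mul, Nat.cast_add]
  simp only [map_natCast, map_ofNat]
  ring

/-- With `j = a + b`, the two factors that can be appended are `X - j ∓ (k + a - b)`. Their sum is
free of `k`; their difference is a scalar. -/
theorem cartPoly_right_eq (k : ℤ) {a b j : ℕ} (h : a + b = j) :
    cartPoly k a (b + 1) = mulPoly (X - C (j : ℂ)) (cartPoly k a b) +
      ((k : ℂ) + a - b) • cartPoly k a b := by
  subst h
  rw [cartPoly_succ_right, mulPoly_apply, smul_eq_C_mul]
  simp only [map_add, map_sub, map_mul, Nat.cast_add]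
  simp only [map_natCast, map_ofNat]
  ring

variable {N : ℂ[X] → ℝ≥0∞}

/-- Half the sum of the two neighbours of order `j + 1` is the shifted symbol; the constants `(1/2)²
· 2 · 2` cancel. -/
theorem cartSum_shift_le (hN : IsQuadGauge N) (k : ℤ) (j : ℕ) :
    cartSum k j (fun p => N (mulPoly (X - C (j : ℂ)) p)) ≤ (j + 1) * cartSum k (j + 1) N := by
  refine cartSum_le fun a b h => ?_
  have e : mulPoly (X - C (j : ℂ)) (cartPoly k a b) =
      (1 / 2 : ℂ) • (cartPoly k (a + 1) b + cartPoly k a (b + 1)) := by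
    rw [cartPoly_left_eq k h, cartPoly_right_eq k h]
    module
  calc N (mulPoly (X - C (j : ℂ)) (cartPoly k a b))
      ≤ ((1 / 2 : ℝ≥0) : ℝ≥0∞) ^ 2 * N (cartPoly k (a + 1) b + cartPoly k a (b + 1)) := by
        rw [e]; exact hN.smul_le_of_le (by simp) _
    _ ≤ ((1 / 2 : ℝ≥0) : ℝ≥0∞) ^ 2 * (2 * (cartSum k (j + 1) N + cartSum k (j + 1) N)) := by
        gcongr
        refine (hN.add_le _ _).trans ?_
        gcongr
        · exact le_cartSum k (by omega) N
        · exact le_cartSum k (by omega) N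
    _ = (((1 / 2 : ℝ≥0) ^ 2 * 2 * 2 : ℝ≥0) : ℝ≥0∞) * cartSum k (j + 1) N := by
        push_cast; ring
    _ = _ := by norm_num

/-- The difference of the two neighbours of order `j + 1` is `2(k + a - b)` times the symbol, which
recovers division by `r`. Only the ratio of `c` to `k + a - b` enters the bound, so taking `c = |k|`
keeps it uniform in `k`. -/
theorem cartSum_mode_le (hN : IsQuadGauge N) (k : ℤ) {a b j : ℕ} (h : a + b = j) (c : ℂ) (K : ℝ≥0)
    (hc : ‖c‖ ≤ K * ‖(k : ℂ) + a - b‖) (hk : k + a - b ≠ 0) :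
    N (c • cartPoly k a b) ≤ K ^ 2 * cartSum k (j + 1) N := by
  have hk' : (k : ℂ) + a - b ≠ 0 := by exact_mod_cast hk
  have e : c • cartPoly k a b =
      (c / (2 * ((k : ℂ) + a - b))) • (cartPoly k a (b + 1) + (-1 : ℂ) • cartPoly k (a + 1) b) := by
    have : cartPoly k a (b + 1) + (-1 : ℂ) • cartPoly k (a + 1) b =
        (2 * ((k : ℂ) + a - b)) • cartPoly k a b := by
      rw [cartPoly_left_eq k h, cartPoly_right_eq k h]
      module
    rw [this, smul_smul, div_mul_cancel₀ _ (mul_ne_zero two_ne_zero hk')]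
  have hK : ‖c / (2 * ((k : ℂ) + a - b))‖₊ ≤ K / 2 := by
    rw [← NNReal.coe_le_coe]
    simp only [coe_nnnorm, norm_div, norm_mul, NNReal.coe_div, NNReal.coe_ofNat,
      Complex.norm_ofNat]
    rw [div_le_div_iff₀ (by positivity) (by norm_num)]
    linarith
  calc N (c • cartPoly k a b)
      ≤ ((K / 2 : ℝ≥0) : ℝ≥0∞) ^ 2 * N (cartPoly k a (b + 1) + (-1 : ℂ) • cartPoly k (a + 1) b) := by
        rw [e]; exact hN.smul_le_of_le hK _
    _ ≤ ((K / 2 : ℝ≥0) : ℝ≥0∞) ^ 2 * (2 * (cartSum k (j + 1) N + cartSum k (j + 1) N)) := by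
        gcongr
        refine (hN.add_le _ _).trans ?_
        gcongr
        · exact le_cartSum k (by omega) N
        · refine (hN.smul_le _ _).trans ?_
          simpa using le_cartSum k (by omega) N
    _ = (((K / 2 : ℝ≥0) ^ 2 * 2 * 2 : ℝ≥0) : ℝ≥0∞) * cartSum k (j + 1) N := by
        push_cast; ring
    _ = _ := by
        congr 1
        rw [← ENNReal.coe_pow]
        congr 1
        ring

theorem cartSum_mono_of_ne (hN : IsQuadGauge N) (k : ℤ) {j : ℕ}
    (hk : ∀ a b, a + b = j → k + a - b ≠ 0) (c : ℂ) (K : ℝ≥0)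
    (hc : ∀ a b, a + b = j → ‖c‖ ≤ K * ‖(k : ℂ) + a - b‖) :
    cartSum k j (fun p => N (c • p)) ≤ (j + 1) * (K ^ 2 * cartSum k (j + 1) N) :=
  cartSum_le fun a b h => cartSum_mode_le hN k h c K (hc a b h) (hk a b h)

theorem one_le_norm_intCast {n : ℤ} (h : n ≠ 0) : (1 : ℝ) ≤ ‖(n : ℂ)‖ := by
  rw [Complex.norm_intCast]
  exact_mod_cast Int.one_le_abs h

/-- Since `|k| ≤ |k + a - b| + j` and a nonzero integer has modulus at least one, the additive `j`
is absorbed into the factor `j + 1`. -/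
theorem natAbs_le_of_ne {k : ℤ} {a b j : ℕ} (h : a + b = j) (hk : k + a - b ≠ 0) :
    ‖(k.natAbs : ℂ)‖ ≤ ((j + 1 : ℕ) : ℝ≥0) * ‖(k : ℂ) + a - b‖ := by
  have e : (k : ℂ) + a - b = ((k + a - b : ℤ) : ℂ) := by push_cast; rfl
  rw [e, Complex.norm_intCast, Complex.norm_natCast]
  have h1 : ((k.natAbs : ℤ) : ℝ) ≤ (((j + 1 : ℕ) : ℤ) * |k + a - b| : ℤ) := by
    have : (1 : ℤ) ≤ |k + a - b| := Int.one_le_abs hk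
    have h2 : (k.natAbs : ℤ) ≤ |k + a - b| + j := by
      rcases abs_cases (k + a - b) with h | h <;> omega
    have h3 : |k + a - b| + (j : ℤ) ≤ ((j + 1 : ℕ) : ℤ) * |k + a - b| := by
      push_cast; nlinarith
    exact_mod_cast h2.trans h3
  rw [Nat.cast_natAbs]
  push_cast at h1 ⊢
  exact h1

/-- The weighted terms are controlled by the Cartesian derivatives, uniformly in the mode. -/
theorem exists_wt_le_cartSum (j : ℕ) : ∃ K : ℝ≥0, ∀ (k : ℤ) (N : ℂ[X] → ℝ≥0∞), IsQuadGauge N →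
    (∀ ℓ ≤ k.natAbs, ℓ ≤ j → N (radPoly k.natAbs ℓ j) ≤ K * cartSum k j N) ∧
    (∀ ℓ, k.natAbs + 2 * ℓ ≤ j → N (axisPoly k.natAbs ℓ j) ≤ K * cartSum k j N) := by
  -- The axis bound includes `ℓ = 0`, which `wtSum` omits, because the term `ℓ + 1` is reduced to
  -- the term `ℓ`.
  induction j with
  | zero =>
    refine ⟨1, fun k N hN => ⟨fun ℓ _ h' => ?_, fun ℓ h => ?_⟩⟩
    · obtain rfl : ℓ = 0 := by omega
      simp [cartSum, cartPoly, radPoly]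
    · obtain rfl : ℓ = 0 := by omega
      simp [cartSum, cartPoly, axisPoly]
  | succ j ih =>
    obtain ⟨K, hK⟩ := ih
    have hj1 : (1 : ℝ≥0∞) ≤ ((j + 1 : ℕ) : ℝ≥0∞) := by exact_mod_cast (by omega)
    -- The factor `j + 1` counts Cartesian symbols of order `j`; the square comes from
    -- `natAbs_le_of_ne` and is needed only for the top radial term.
    refine ⟨K * ((j + 1 : ℕ) * (j + 1 : ℕ) ^ 2), fun k N hN => ?_⟩
    have big : ∀ x : ℝ≥0∞, K * ((j + 1) * x) ≤
        ((K * ((j + 1 : ℕ) * (j + 1 : ℕ) ^ 2) : ℝ≥0) : ℝ≥0∞) * x := fun x => by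
      calc (K : ℝ≥0∞) * ((j + 1) * x) = K * (((j + 1 : ℕ) * 1) * x) := by push_cast; ring
        _ ≤ K * (((j + 1 : ℕ) * (j + 1 : ℕ) ^ 2) * x) := by gcongr; exact one_le_pow₀ hj1
        _ = _ := by push_cast; ring
    -- The induction hypothesis for the gauge `p ↦ N ((X - j) p)` treats every term that still
    -- carries a radial derivative.
    have shift := hK k _ (hN.comp (mulPoly (X - C (j : ℂ))))
    have hsh := cartSum_shift_le hN k j
    have bnd : ∀ p : ℂ[X], N (mulPoly (X - C (j : ℂ)) p) ≤
        K * cartSum k j (fun p => N (mulPoly (X - C (j : ℂ)) p)) →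
        N (mulPoly (X - C (j : ℂ)) p) ≤
          ((K * ((j + 1 : ℕ) * (j + 1 : ℕ) ^ 2) : ℝ≥0) : ℝ≥0∞) * cartSum k (j + 1) N := by
      intro p hp
      refine hp.trans (le_trans ?_ (big _))
      gcongr
    have hrad : ∀ ℓ ≤ k.natAbs, ℓ ≤ j + 1 → N (radPoly k.natAbs ℓ (j + 1)) ≤
        ((K * ((j + 1 : ℕ) * (j + 1 : ℕ) ^ 2) : ℝ≥0) : ℝ≥0∞) * cartSum k (j + 1) N := by
      intro ℓ h1 h2
      rcases Nat.lt_or_ge j ℓ with h | h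
      -- No radial derivative is left, so a factor `|k|/r` is peeled off instead. Here `|k| ≥ j + 1
      -- > |a - b|`, so `k + a - b` never vanishes.
      · obtain rfl : ℓ = j + 1 := by omega
        have hne : ∀ a b, a + b = j → k + a - b ≠ 0 := fun a b hab => by omega
        have e : radPoly k.natAbs (j + 1) (j + 1) = (k.natAbs : ℂ) • radPoly k.natAbs j j := by
          rw [radPoly_self, radPoly_self, smul_eq_C_mul, ← C_mul, pow_succ, mul_comm]
        have h3 := (hK k _ (hN.comp ((k.natAbs : ℂ) • LinearMap.id))).1 j (by omega) le_rfl
        simp only [LinearMap.smul_apply, LinearMap.id_apply] at h3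
        rw [e]
        refine h3.trans ?_
        have h4 := cartSum_mono_of_ne hN k hne (k.natAbs : ℂ) ((j + 1 : ℕ) : ℝ≥0)
          fun a b hab => natAbs_le_of_ne hab (hne a b hab)
        calc (K : ℝ≥0∞) * _ ≤ K * ((j + 1) * ((((j + 1 : ℕ) : ℝ≥0) : ℝ≥0∞) ^ 2 *
              cartSum k (j + 1) N)) := by gcongr
          _ = _ := by push_cast; ring
      · rw [radPoly_succ h]
        exact bnd _ (shift.1 ℓ h1 h)
    refine ⟨hrad, fun ℓ hℓ => ?_⟩
    rcases Nat.lt_or_ge j (k.natAbs + 2 * ℓ) with h | h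
    · obtain h5 : k.natAbs + 2 * ℓ = j + 1 := by omega
      rcases Nat.eq_zero_or_pos ℓ with rfl | hpos
      -- This is the radial symbol without its coefficient `|k|^{|k|}`, which is at least one.
      · have e : axisPoly k.natAbs 0 (j + 1) =
            ((k.natAbs : ℂ) ^ k.natAbs)⁻¹ • radPoly k.natAbs k.natAbs (j + 1) := by
          have h0 : ((k.natAbs : ℂ) ^ k.natAbs) ≠ 0 := by
            rw [ne_eq, pow_eq_zero_iff']; push Not
            intro h; simpa using h
          simp only [axisPoly, radPoly]
          rw [smul_eq_C_mul, ← mul_assoc, ← C_mul, inv_mul_cancel₀ h0]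
          simp
        rw [e]
        refine (hN.smul_le_of_le (K := 1) ?_ _).trans ?_
        · rw [nnnorm_inv, nnnorm_pow]
          refine inv_le_one_of_one_le₀ ?_
          rcases Nat.eq_zero_or_pos k.natAbs with h0 | h0
          · simp [h0]
          · refine one_le_pow₀ ?_
            rw [← NNReal.coe_le_coe]
            simp only [coe_nnnorm, Complex.norm_natCast, NNReal.coe_one]
            exact_mod_cast h0
        · simpa using hrad k.natAbs le_rfl (by omega)
      · obtain ⟨ℓ, rfl⟩ : ∃ n, ℓ = n + 1 := ⟨ℓ - 1, by omega⟩
        -- Parity: `k + a - b` has the parity of `k + j`, and `j = |k| + 2ℓ + 1`, so it is odd.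
        have hne : ∀ a b, a + b = j → k + a - b ≠ 0 := fun a b hab => by omega
        have hj : j = k.natAbs + 2 * ℓ + 1 := by omega
        have e : axisPoly k.natAbs (ℓ + 1) (j + 1) = axisPoly k.natAbs ℓ j := by
          rw [hj, ← axisPoly_new]; rfl
        rw [e]
        refine ((hK k N hN).2 ℓ (by omega)).trans ?_
        have h4 := cartSum_mono_of_ne hN k hne 1 1 fun a b hab => by
          have := one_le_norm_intCast (hne a b hab)
          push_cast at this
          simpa using this
        simp only [one_smul] at h4
        refine le_trans ?_ (big _)
        gcongr
        simpa using h4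
    · rw [axisPoly_succ h]
      exact bnd _ (shift.2 ℓ h)

end AxiSobolev

namespace AxiSobolev

open Polynomial

/-! ### Cartesian symbols bounded by weighted symbols -/

theorem natDegree_cartPoly_le (k : ℤ) (a b : ℕ) : (cartPoly k a b).natDegree ≤ a + b := by
  refine natDegree_mul_le.trans (add_le_add ?_ ?_) <;>
  · refine (natDegree_prod_le _ _).trans ?_
    simp only [natDegree_X_sub_C]
    simp

/-- The function `r^{|k|+2t} e^{ikθ}` is a polynomial of degree `|k| + 2t` in `x, y`, killed by
derivatives of higher order. For `k ≥ 0` the root comes from the factor `i = t` of the first product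
if `t < a`, and otherwise from `i = |k| + t` of the second; for `k < 0` the products exchange roles.
-/
theorem eval_cartPoly (k : ℤ) {a b t : ℕ} (h : k.natAbs + 2 * t < a + b) :
    (cartPoly k a b).eval ((k.natAbs : ℂ) + 2 * t) = 0 := by
  simp only [cartPoly, eval_mul, eval_prod, eval_sub, eval_X, eval_C]
  have left : ∀ i < a, (k.natAbs : ℂ) + 2 * t - (k + 2 * i) = 0 →
      ∏ i ∈ Finset.range a, ((k.natAbs : ℂ) + 2 * t - (k + 2 * i)) = 0 := fun i hi h =>
    Finset.prod_eq_zero (Finset.mem_range.2 hi) h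
  have right : ∀ i < b, (k.natAbs : ℂ) + 2 * t - (2 * i - k) = 0 →
      ∏ i ∈ Finset.range b, ((k.natAbs : ℂ) + 2 * t - (2 * i - k)) = 0 := fun i hi h =>
    Finset.prod_eq_zero (Finset.mem_range.2 hi) h
  rcases Int.natAbs_eq k with hk | hk
  · have hk' : (k : ℂ) = k.natAbs := by exact congrArg (Int.cast (R := ℂ)) hk
    by_cases ht : t < a
    · rw [left t ht (by rw [hk']; ring), zero_mul]
    · rw [right (k.natAbs + t) (by omega) (by rw [hk']; push_cast; ring), mul_zero]
  · have hk' : (k : ℂ) = -k.natAbs := by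
      have := congrArg (Int.cast (R := ℂ)) hk
      rwa [Int.cast_neg, Int.cast_natCast] at this
    by_cases ht : t < b
    · rw [right t ht (by rw [hk']; ring), mul_zero]
    · rw [left (k.natAbs + t) (by omega) (by rw [hk']; push_cast; ring), zero_mul]

/-- A polynomial of degree at most `j` vanishing at the `κ + 2t < j` is controlled by the weighted
terms of order `j`. -/
theorem exists_le_wtSum_of_eval_eq_zero (κ : ℕ) (j : ℕ) : ∀ p : ℂ[X], p.natDegree ≤ j →
    (∀ t : ℕ, κ + 2 * t < j → p.eval ((κ : ℂ) + 2 * t) = 0) →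
    ∃ K : ℝ≥0, ∀ N : ℂ[X] → ℝ≥0∞, IsQuadGauge N → N p ≤ K * wtSum κ j N := by
  induction j with
  | zero =>
    intro p hp _
    obtain ⟨c, rfl⟩ := natDegree_eq_zero.1 (Nat.le_zero.1 hp)
    refine ⟨‖c‖₊ ^ 2, fun N hN => ?_⟩
    have e : C c = c • radPoly κ 0 0 := by simp [radPoly, smul_eq_C_mul]
    rw [e]
    refine (hN.smul_le_of_le le_rfl _).trans ?_
    push_cast
    gcongr
    exact rad_le_wtSum (by omega) le_rfl N
  | succ j ih =>
    -- If `p` also vanishes at `j`, the quotient by `X - j` falls under the induction hypothesis,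
    -- and multiplying back is a radial derivative of the weighted terms.
    have root : ∀ p : ℂ[X], p.natDegree ≤ j + 1 →
        (∀ t : ℕ, κ + 2 * t < j → p.eval ((κ : ℂ) + 2 * t) = 0) → p.eval (j : ℂ) = 0 →
        ∃ K : ℝ≥0, ∀ N : ℂ[X] → ℝ≥0∞, IsQuadGauge N → N p ≤ K * wtSum κ (j + 1) N := by
      intro p hp hv hj
      have e : (X - C (j : ℂ)) * (p /ₘ (X - C (j : ℂ))) = p :=
        mul_divByMonic_eq_iff_isRoot.2 hj
      obtain ⟨K, hK⟩ := ih (p /ₘ (X - C (j : ℂ)))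
        (by rw [natDegree_divByMonic p (monic_X_sub_C _), natDegree_X_sub_C]; omega)
        (fun t ht => by
          have h1 := hv t ht
          rw [← e, eval_mul, eval_sub, eval_X, eval_C] at h1
          refine (mul_eq_zero.1 h1).resolve_left ?_
          rw [← ne_eq, sub_ne_zero]
          exact_mod_cast ht.ne)
      refine ⟨K * (2 * j + 1), fun N hN => ?_⟩
      have h2 := hK _ (hN.comp (mulPoly (X - C (j : ℂ))))
      rw [mulPoly_apply, e] at h2
      refine h2.trans ?_
      push_cast
      rw [mul_assoc]
      gcongr
      exact wtSum_shift_le N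
    intro p hp hv
    -- Either `j` is one of the prescribed zeros, or a multiple of a weighted symbol `q` with `q(j)
    -- ≠ 0` is subtracted to create a zero there.
    by_cases hex : ∃ t, κ + 2 * t = j
    · obtain ⟨t, ht⟩ := hex
      refine root p hp (fun s hs => hv s (by omega)) ?_
      rw [← ht]
      push_cast
      exact hv t (by omega)
    · obtain ⟨q, hqd, hqv, hqj, hqN⟩ : ∃ q : ℂ[X], q.natDegree ≤ j + 1 ∧
          (∀ t : ℕ, κ + 2 * t < j → q.eval ((κ : ℂ) + 2 * t) = 0) ∧ q.eval (j : ℂ) ≠ 0 ∧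
          ∀ N : ℂ[X] → ℝ≥0∞, N q ≤ wtSum κ (j + 1) N := by
        -- For large `κ` the constant top radial symbol serves as `q`. Otherwise `j - κ` is odd, so
        -- `j + 1 = κ + 2ℓ`, and the axis symbol with no further derivative has the roots `κ + 2i`,
        -- none equal to `j`.
        by_cases hκ : j + 1 ≤ κ
        · refine ⟨radPoly κ (j + 1) (j + 1), ?_, fun t ht => by omega, ?_,
            fun N => rad_le_wtSum hκ le_rfl N⟩
          · rw [radPoly_self, natDegree_C]; omega
          · rw [radPoly_self, eval_C]
            refine pow_ne_zero _ ?_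
            have : κ ≠ 0 := by omega
            exact_mod_cast this
        · obtain ⟨ℓ, hℓ⟩ : ∃ ℓ, j + 1 = κ + 2 * ℓ := by
            by_contra! hcon
            refine hex ⟨(j - κ) / 2, ?_⟩
            have := hcon ((j + 1 - κ) / 2)
            omega
          refine ⟨axisPoly κ ℓ (j + 1), ?_, fun t ht => ?_, ?_,
            fun N => axis_le_wtSum (by omega) (by omega) N⟩
          · rw [hℓ, axisPoly_self]
            refine (natDegree_prod_le _ _).trans ?_
            simp only [natDegree_X_sub_C]
            simp; omega
          · rw [hℓ, axisPoly_self, eval_prod]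
            exact Finset.prod_eq_zero (i := t) (Finset.mem_range.2 (by omega)) (by simp)
          · rw [hℓ, axisPoly_self, eval_prod, Finset.prod_ne_zero_iff]
            intro i _
            rw [eval_sub, eval_X, eval_C, sub_ne_zero]
            intro h
            exact hex ⟨i, by exact_mod_cast h.symm⟩
      obtain ⟨K, hK⟩ := root (p + (-(p.eval (j : ℂ) / q.eval (j : ℂ))) • q)
        ((natDegree_add_le _ _).trans (max_le hp ((natDegree_smul_le _ _).trans hqd)))
        (fun t ht => by
          rw [eval_add, eval_smul, hqv t ht, hv t (by omega)]; simp)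
        (by rw [eval_add, eval_smul, smul_eq_mul]; field_simp; ring)
      set c := p.eval (j : ℂ) / q.eval (j : ℂ)
      refine ⟨2 * (K + ‖c‖₊ ^ 2), fun N hN => ?_⟩
      have e : p = (p + (-c) • q) + c • q := by module
      calc N p ≤ 2 * (N (p + (-c) • q) + N (c • q)) := by
            conv_lhs => rw [e]
            exact hN.add_le _ _
        _ ≤ 2 * (K * wtSum κ (j + 1) N + (‖c‖₊ : ℝ≥0∞) ^ 2 * wtSum κ (j + 1) N) := by
            gcongr
            · exact hK N hN
            · refine (hN.smul_le_of_le le_rfl _).trans ?_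
              gcongr
              exact hqN N
        _ = _ := by push_cast; ring

/-- Lowering the order of a weighted term costs one factor `κ` when the mode is high. -/
theorem exists_rad_mul_le (j : ℕ) : ∃ K : ℝ≥0, ∀ κ : ℕ, j + 1 ≤ κ → ∀ N : ℂ[X] → ℝ≥0∞,
    IsQuadGauge N → ∀ ℓ ≤ j, N ((κ : ℂ) • radPoly κ ℓ j) ≤ K * wtSum κ (j + 1) N := by
  have main : ∀ n ≤ j, ∃ K : ℝ≥0, ∀ κ : ℕ, j + 1 ≤ κ → ∀ N : ℂ[X] → ℝ≥0∞,
      IsQuadGauge N → N ((κ : ℂ) • radPoly κ (j - n) j) ≤ K * wtSum κ (j + 1) N := by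
    -- Downward induction on `ℓ = j - n`, starting from the term with no radial derivative.
    intro n
    induction n with
    | zero =>
      refine fun _ => ⟨1, fun κ hκ N hN => ?_⟩
      have e : (κ : ℂ) • radPoly κ (j - 0) j = radPoly κ (j + 1) (j + 1) := by
        rw [Nat.sub_zero, radPoly_self, radPoly_self, smul_eq_C_mul, ← C_mul, pow_succ, mul_comm]
      rw [e]
      simpa using rad_le_wtSum hκ le_rfl N
    | succ n ih =>
      intro hn
      obtain ⟨K, hK⟩ := ih (by omega)
      refine ⟨2 * (1 + K), fun κ hκ N hN => ?_⟩
      obtain ⟨ℓ, hℓ, hℓj, hℓn⟩ : ∃ ℓ, ℓ = j - (n + 1) ∧ ℓ + 1 ≤ j ∧ j - n = ℓ + 1 :=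
        ⟨_, rfl, by omega, by omega⟩
      have hκ0 : (κ : ℂ) ≠ 0 := by
        have : κ ≠ 0 := by omega
        exact_mod_cast this
      -- This is `X - ℓ = (X - j) + (j - ℓ)`, the commutator of `1/r` with the radial derivatives.
      -- As `j - ℓ ≤ κ`, the remainder has a coefficient of modulus at most one.
      have e : (κ : ℂ) • radPoly κ ℓ j = radPoly κ (ℓ + 1) (j + 1) +
          (((j : ℂ) - ℓ) / κ) • ((κ : ℂ) • radPoly κ (ℓ + 1) j) := by
        rw [smul_smul, div_mul_cancel₀ _ hκ0, radPoly_succ hℓj]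
        simp only [radPoly]
        rw [Finset.prod_eq_prod_Ico_succ_bot (by omega : ℓ < j)]
        simp only [smul_eq_C_mul, pow_succ, map_sub, map_mul]
        ring
      rw [← hℓ, e]
      have hc : ‖((j : ℂ) - ℓ) / κ‖₊ ≤ 1 := by
        rw [← NNReal.coe_le_coe, coe_nnnorm, norm_div, ← Nat.cast_sub (by omega),
          Complex.norm_natCast, Complex.norm_natCast, NNReal.coe_one]
        refine div_le_one_of_le₀ ?_ (by positivity)
        exact_mod_cast (by omega : j - ℓ ≤ κ)
      calc N (_ + _) ≤ 2 * (N (radPoly κ (ℓ + 1) (j + 1)) +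
              N ((((j : ℂ) - ℓ) / κ) • ((κ : ℂ) • radPoly κ (ℓ + 1) j))) := hN.add_le _ _
        _ ≤ 2 * (wtSum κ (j + 1) N + K * wtSum κ (j + 1) N) := by
            gcongr
            · exact rad_le_wtSum (by omega) (by omega) N
            · refine (hN.smul_le_of_le hc _).trans ?_
              rw [← hℓn]
              simpa using hK κ hκ N hN
        _ = _ := by push_cast; ring
  choose! K hK using main
  refine ⟨∑ n ∈ Finset.range (j + 1), K n, fun κ hκ N hN ℓ hℓ => ?_⟩
  have h := hK (j - ℓ) (by omega) κ hκ N hN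
  rw [show j - (j - ℓ) = ℓ by omega] at h
  refine h.trans ?_
  gcongr
  exact Finset.single_le_sum (f := K) (fun _ _ => zero_le) (Finset.mem_range.2 (by omega))

/-- Cartesian derivatives are controlled by the weighted terms when the mode is high. -/
theorem exists_cart_le_wtSum_of_le (j : ℕ) : ∃ K : ℝ≥0, ∀ k : ℤ, j ≤ k.natAbs →
    ∀ N : ℂ[X] → ℝ≥0∞, IsQuadGauge N → ∀ a b, a + b = j →
      N (cartPoly k a b) ≤ K * wtSum k.natAbs j N := by
  induction j with
  | zero =>
    refine ⟨1, fun k _ N hN a b h => ?_⟩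
    obtain ⟨rfl, rfl⟩ : a = 0 ∧ b = 0 := by omega
    have e : cartPoly k 0 0 = radPoly k.natAbs 0 0 := by simp [cartPoly, radPoly]
    rw [e]
    simpa using rad_le_wtSum (zero_le) le_rfl N
  | succ j ih =>
    obtain ⟨K, hK⟩ := ih
    obtain ⟨K', hK'⟩ := exists_rad_mul_le j
    refine ⟨2 * (K * (2 * j + 1) + 2 ^ 2 * (K * ((2 * j + 1) * K'))), fun k hk N hN => ?_⟩
    -- Both ways of raising the order give `X - j` plus a scalar of modulus `|k + a - b| ≤ 2|k|`.
    -- The scalar part is rewritten as a bounded multiple of `|k|` times the symbol, to which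
    -- `exists_rad_mul_le` applies after the induction hypothesis.
    have key : ∀ a b, a + b = j → ∀ c : ℂ, ‖c‖ ≤ ‖(k : ℂ) + a - b‖ →
        N (mulPoly (X - C (j : ℂ)) (cartPoly k a b) + c • cartPoly k a b) ≤
        2 * (K * (2 * j + 1) + 2 ^ 2 * (K * ((2 * j + 1) * K'))) *
          wtSum k.natAbs (j + 1) N := by
      intro a b hab c hc
      have hk0 : (k.natAbs : ℂ) ≠ 0 := by
        have : k.natAbs ≠ 0 := by omega
        exact_mod_cast this
      have e : c • cartPoly k a b = (c / k.natAbs) • ((k.natAbs : ℂ) • cartPoly k a b) := by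
        rw [smul_smul, div_mul_cancel₀ _ hk0]
      have hc2 : ‖c / k.natAbs‖₊ ≤ 2 := by
        rw [← NNReal.coe_le_coe, coe_nnnorm, norm_div]
        refine div_le_of_le_mul₀ (by positivity) (by positivity) (hc.trans ?_)
        have e' : (k : ℂ) + a - b = ((k + a - b : ℤ) : ℂ) := by push_cast; rfl
        rw [e', Complex.norm_intCast, Complex.norm_natCast]
        have : |k + a - b| ≤ 2 * (k.natAbs : ℤ) := by
          rcases abs_cases (k + a - b) with h | h <;> omega
        have h5 : ((|k + a - b| : ℤ) : ℝ) ≤ ((2 * (k.natAbs : ℤ) : ℤ) : ℝ) := Int.cast_le.2 this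
        push_cast [Nat.cast_natAbs] at h5 ⊢
        exact h5
      have h1 := hK k (by omega) _ (hN.comp (mulPoly (X - C (j : ℂ)))) a b hab
      have h2 := hK k (by omega) _ (hN.comp ((k.natAbs : ℂ) • LinearMap.id)) a b hab
      simp only [LinearMap.smul_apply, LinearMap.id_apply] at h2
      -- There are no axis terms of order `j`, since `|k| > j`.
      have h3 : wtSum k.natAbs j (fun p => N ((k.natAbs : ℂ) • p)) ≤
          (2 * j + 1) * (K' * wtSum k.natAbs (j + 1) N) :=
        wtSum_le (fun ℓ _ hℓ => hK' _ hk N hN ℓ hℓ) (fun ℓ h1 h2 => by omega)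
      calc N (_ + _) ≤ 2 * (N (mulPoly (X - C (j : ℂ)) (cartPoly k a b)) +
              N (c • cartPoly k a b)) := hN.add_le _ _
        _ ≤ 2 * (K * ((2 * j + 1) * wtSum k.natAbs (j + 1) N) +
              2 ^ 2 * (K * ((2 * j + 1) * (K' * wtSum k.natAbs (j + 1) N)))) := by
            gcongr
            · refine h1.trans ?_
              gcongr
              exact wtSum_shift_le N
            · rw [e]
              refine (hN.smul_le_of_le hc2 _).trans ?_
              push_cast
              gcongr
              refine h2.trans ?_
              gcongr
        _ = _ := by ring
    intro a b hab
    push_cast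
    rcases Nat.eq_zero_or_pos a with rfl | ha
    · obtain ⟨b, rfl⟩ : ∃ n, b = n + 1 := ⟨b - 1, by omega⟩
      rw [cartPoly_right_eq k (j := j) (by omega)]
      exact key 0 b (by omega) _ le_rfl
    · obtain ⟨a, rfl⟩ : ∃ n, a = n + 1 := ⟨a - 1, by omega⟩
      rw [cartPoly_left_eq k (j := j) (by omega)]
      exact key a b (by omega) _ (by rw [norm_neg])

/-- The Cartesian derivatives are controlled by the weighted terms, uniformly in the mode. -/
theorem exists_cart_le_wtSum (j : ℕ) : ∃ K : ℝ≥0, ∀ (k : ℤ) (N : ℂ[X] → ℝ≥0∞), IsQuadGauge N →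
    ∀ a b, a + b = j → N (cartPoly k a b) ≤ K * wtSum k.natAbs j N := by
  obtain ⟨K, hK⟩ := exists_cart_le_wtSum_of_le j
  -- Here the constant may depend on the mode; it is used only for the finitely many `k` with `|k| <
  -- j`.
  have h : ∀ (k : ℤ) (a : ℕ), ∃ K : ℝ≥0, ∀ b, a + b = j → ∀ N : ℂ[X] → ℝ≥0∞, IsQuadGauge N →
      N (cartPoly k a b) ≤ K * wtSum k.natAbs j N := fun k a => by
    by_cases ha : a ≤ j
    · obtain ⟨K, hK⟩ := exists_le_wtSum_of_eval_eq_zero k.natAbs j (cartPoly k a (j - a))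
        ((natDegree_cartPoly_le _ _ _).trans (by omega))
        (fun t ht => eval_cartPoly k (by omega))
      refine ⟨K, fun b hb N hN => ?_⟩
      obtain rfl : b = j - a := by omega
      exact hK N hN
    · exact ⟨0, fun b hb => by omega⟩
  choose K' hK' using h
  refine ⟨K + ∑ k ∈ Finset.Ioo (-(j : ℤ)) j, ∑ a ∈ Finset.range (j + 1), K' k a,
    fun k N hN a b hab => ?_⟩
  by_cases hk : j ≤ k.natAbs
  · refine (hK k hk N hN a b hab).trans ?_
    gcongr
    exact le_self_add
  · refine (hK' k a b hab N hN).trans ?_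
    gcongr
    refine le_trans ?_ le_add_self
    refine (Finset.single_le_sum (f := K' k) (fun _ _ => zero_le)
      (Finset.mem_range.2 (by omega : a < j + 1))).trans ?_
    exact Finset.single_le_sum (f := fun k => ∑ a ∈ Finset.range (j + 1), K' k a)
      (fun _ _ => zero_le) (Finset.mem_Ioo.2 (by omega))

end AxiSobolev

/-! ### Distributions as linear functionals -/

namespace AxiSobolev

set_option linter.unusedSectionVars false

section Dist

variable {E : Type*} [NormedAddCommGroup E] [NormedSpace ℝ E]

theorem IsTestFunction.continuous {Ω : Set E} {φ : E → ℂ} (h : IsTestFunction Ω φ) :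
    Continuous φ := h.contDiff.continuous

theorem IsTestFunction.eq_zero {Ω : Set E} {φ : E → ℂ} (h : IsTestFunction Ω φ) {x : E}
    (hx : x ∉ Ω) : φ x = 0 :=
  image_eq_zero_of_notMem_tsupport fun h' => hx (h.tsupport_subset h')

theorem IsTestFunction.mono {Ω Ω' : Set E} (hΩ : Ω ⊆ Ω') {φ : E → ℂ} (h : IsTestFunction Ω φ) :
    IsTestFunction Ω' φ := ⟨h.1, h.2, h.3.trans hΩ⟩

theorem isTestFunction_zero (Ω : Set E) : IsTestFunction Ω (0 : E → ℂ) :=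
  ⟨contDiff_const, HasCompactSupport.zero, by simp⟩

theorem IsTestFunction.add {Ω : Set E} {φ ψ : E → ℂ} (h : IsTestFunction Ω φ)
    (h' : IsTestFunction Ω ψ) : IsTestFunction Ω (φ + ψ) :=
  ⟨h.1.add h'.1, h.2.add h'.2, (tsupport_add φ ψ).trans (Set.union_subset h.3 h'.3)⟩

theorem IsTestFunction.smul {Ω : Set E} {φ : E → ℂ} (c : ℂ) (h : IsTestFunction Ω φ) :
    IsTestFunction Ω (c • φ) :=
  ⟨contDiff_const.smul h.1, h.2.smul_left (f := fun _ => c),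
    (tsupport_smul_subset_right (fun _ => c) φ).trans h.3⟩

theorem IsTestFunction.fderiv {Ω : Set E} {φ : E → ℂ} (h : IsTestFunction Ω φ) (e : E) :
    IsTestFunction Ω (fun x => fderiv ℝ φ x e) where
  contDiff := (h.1.fderiv_right (m := ∞) (by simp)).clm_apply contDiff_const
  hasCompactSupport := h.2.fderiv_apply ℝ e
  tsupport_subset := (tsupport_fderiv_apply_subset ℝ e).trans h.3

/-- Smoothness of `a` is only assumed on `Ω`. Off the support of `φ` the product vanishes locally,
so it is smooth everywhere. -/
theorem IsTestFunction.mul {Ω : Set E} (hΩ : IsOpen Ω) {φ a : E → ℂ} (ha : ContDiffOn ℝ ∞ a Ω)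
    (h : IsTestFunction Ω φ) : IsTestFunction Ω (fun x => a x * φ x) where
  contDiff := by
    refine contDiff_iff_contDiffAt.2 fun x => ?_
    by_cases hx : x ∈ tsupport φ
    · exact (ha.contDiffAt (hΩ.mem_nhds (h.3 hx))).mul h.1.contDiffAt
    · have : (fun x => a x * φ x) =ᶠ[nhds x] fun _ => 0 := by
        filter_upwards [notMem_tsupport_iff_eventuallyEq.1 hx] with y hy
        simp [hy]
      exact contDiffAt_const.congr_of_eventuallyEq this
  hasCompactSupport := h.2.mul_left
  tsupport_subset := (tsupport_mul_subset_right).trans h.3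

/-- The space of test functions on `Ω`. -/
def testSpace (Ω : Set E) : Submodule ℂ (E → ℂ) where
  carrier := {φ | IsTestFunction Ω φ}
  add_mem' := IsTestFunction.add
  zero_mem' := isTestFunction_zero Ω
  smul_mem' c _ h := h.smul c

/-- Linear functionals on test functions. -/
abbrev Dist (Ω : Set E) : Type _ := Module.Dual ℂ (testSpace Ω)

/-- The directional derivative of test functions. -/
noncomputable def testDeriv (Ω : Set E) (e : E) : testSpace Ω →ₗ[ℂ] testSpace Ω where
  toFun φ := ⟨fun x => fderiv ℝ φ.1 x e, φ.2.fderiv e⟩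
  map_add' φ ψ := by
    ext x
    have h1 := (φ.2.contDiff.differentiable (by simp)) x
    have h2 := (ψ.2.contDiff.differentiable (by simp)) x
    simp [fderiv_add h1 h2]
  map_smul' c φ := by
    ext x
    have h1 := (φ.2.contDiff.differentiable (by simp)) x
    simp [fderiv_const_smul h1 c]

/-- Multiplication of test functions by a function that is smooth on `Ω`. -/
noncomputable def testMul {Ω : Set E} (hΩ : IsOpen Ω) {a : E → ℂ} (ha : ContDiffOn ℝ ∞ a Ω) :
    testSpace Ω →ₗ[ℂ] testSpace Ω where
  toFun φ := ⟨fun x => a x * φ.1 x, φ.2.mul hΩ ha⟩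
  map_add' φ ψ := by ext x; simp [mul_add]
  map_smul' c φ := by ext x; simp; ring

/-- The directional derivative of distributions. -/
noncomputable def distDeriv (Ω : Set E) (e : E) : Module.End ℂ (Dist Ω) := -(testDeriv Ω e).dualMap

/-- Multiplication of distributions by a function that is smooth on `Ω`. -/
noncomputable def distMul {Ω : Set E} (hΩ : IsOpen Ω) {a : E → ℂ} (ha : ContDiffOn ℝ ∞ a Ω) :
    Module.End ℂ (Dist Ω) := (testMul hΩ ha).dualMap

@[simp] theorem testDeriv_apply (Ω : Set E) (e : E) (φ : testSpace Ω) (x : E) :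
    (testDeriv Ω e φ).1 x = fderiv ℝ φ.1 x e := rfl

@[simp] theorem testMul_apply {Ω : Set E} (hΩ : IsOpen Ω) {a : E → ℂ} (ha : ContDiffOn ℝ ∞ a Ω)
    (φ : testSpace Ω) (x : E) : (testMul hΩ ha φ).1 x = a x * φ.1 x := rfl

@[simp] theorem distDeriv_apply (Ω : Set E) (e : E) (τ : Dist Ω) (φ : testSpace Ω) :
    distDeriv Ω e τ φ = -τ (testDeriv Ω e φ) := rfl

@[simp] theorem distMul_apply {Ω : Set E} (hΩ : IsOpen Ω) {a : E → ℂ} (ha : ContDiffOn ℝ ∞ a Ω)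
    (τ : Dist Ω) (φ : testSpace Ω) : distMul hΩ ha τ φ = τ (testMul hΩ ha φ) := rfl

theorem testDeriv_comm (Ω : Set E) (e e' : E) (φ : testSpace Ω) :
    testDeriv Ω e (testDeriv Ω e' φ) = testDeriv Ω e' (testDeriv Ω e φ) := by
  ext x
  have hφ : ContDiff ℝ ∞ φ.1 := φ.2.contDiff
  have hd : DifferentiableAt ℝ (fderiv ℝ φ.1) x :=
    (hφ.fderiv_right (m := ∞) (by simp)).differentiable (by simp) x
  have hs : IsSymmSndFDerivAt ℝ φ.1 x := 
    (contDiff_infty.1 hφ 2).contDiffAt.isSymmSndFDerivAt (by simp)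
  have key : ∀ e e' : E, fderiv ℝ (fun y => fderiv ℝ φ.1 y e') x e =
      fderiv ℝ (fderiv ℝ φ.1) x e e' := fun e e' => by
    have := fderiv_clm_apply hd (differentiableAt_const e' (𝕜 := ℝ))
    rw [this]
    simp
  calc _ = fderiv ℝ (fun y => fderiv ℝ φ.1 y e') x e := rfl
    _ = fderiv ℝ (fun y => fderiv ℝ φ.1 y e) x e' := by rw [key, key, hs.eq]
    _ = _ := rfl

theorem distDeriv_comm (Ω : Set E) (e e' : E) : Commute (distDeriv Ω e) (distDeriv Ω e') := by
  ext τ φ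
  simp [testDeriv_comm Ω e e']

theorem testDeriv_mul {Ω : Set E} (hΩ : IsOpen Ω) {a : E → ℂ} (ha : ContDiffOn ℝ ∞ a Ω) (e : E)
    (φ : testSpace Ω) {x : E} (hx : x ∈ Ω) :
    (testDeriv Ω e (testMul hΩ ha φ)).1 x =
      fderiv ℝ a x e * φ.1 x + a x * fderiv ℝ φ.1 x e := by
  have h1 : DifferentiableAt ℝ a x :=
    (ha.contDiffAt (hΩ.mem_nhds hx)).differentiableAt (by simp)
  have h2 := (φ.2.contDiff.differentiable (by simp)) x
  change fderiv ℝ (fun x => a x * φ.1 x) x e = _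
  rw [fderiv_fun_mul h1 h2]
  simp
  ring

theorem testSpace_ext {Ω : Set E} {φ ψ : testSpace Ω} (h : ∀ x ∈ Ω, φ.1 x = ψ.1 x) : φ = ψ := by
  ext x
  by_cases hx : x ∈ Ω
  · exact h x hx
  · rw [φ.2.eq_zero hx, ψ.2.eq_zero hx]

/-! ### Functionals and distributions -/

/-- The functional `T` agrees with `τ` on test functions on `Ω`. -/
def Agrees {Ω : Set E} (T : Functional E) (τ : Dist Ω) : Prop :=
  ∀ φ : testSpace Ω, T φ.1 = τ φ

theorem Agrees.pderiv {Ω : Set E} {T : Functional E} {τ : Dist Ω} (h : Agrees T τ) (e : E) :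
    Agrees (pderiv e T) (distDeriv Ω e τ) := fun φ => by
  rw [distDeriv_apply, ← h]; rfl

theorem Agrees.iterate_pderiv {Ω : Set E} {T : Functional E} {τ : Dist Ω} (h : Agrees T τ) (e : E)
    (n : ℕ) : Agrees ((AxiSobolev.pderiv e)^[n] T) ((distDeriv Ω e ^ n) τ) := by
  induction n with
  | zero => exact h
  | succ n ih =>
    rw [Function.iterate_succ_apply', pow_succ']
    exact ih.pderiv e

/-- Only the values of `a` on `Ω` matter, because test functions vanish elsewhere. The scalar `c` is
separated so that multiplication by `c/r` is expressed through the single operator `1/r`. -/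
theorem Agrees.mulBy {Ω : Set E} {T : Functional E} {τ : Dist Ω} (h : Agrees T τ) (hΩ : IsOpen Ω)
    {a : E → ℝ} {b : E → ℂ} (hb : ContDiffOn ℝ ∞ b Ω) (c : ℂ) (hab : ∀ x ∈ Ω, (a x : ℂ) = c * b x) :
    Agrees (mulBy a T) (c • distMul hΩ hb τ) := fun φ => by
  rw [LinearMap.smul_apply, distMul_apply, ← map_smul, ← h]
  simp only [AxiSobolev.mulBy]
  congr 1
  ext x
  by_cases hx : x ∈ Ω
  · simp [hab x hx]; ring
  · simp [φ.2.eq_zero hx]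

/-! ### Square norms of distributions -/

section Measure

variable [MeasureSpace E]

/-- The squared `L²(μ)` norm of a distribution. -/
noncomputable def distNormSq (μ : Measure E) {Ω : Set E} (τ : Dist Ω) : ℝ≥0∞ :=
  ⨅ (g : E → ℂ) (_ : LocallyIntegrableOn g Ω ∧ ∀ φ : testSpace Ω, τ φ = ∫ x in Ω, g x * φ.1 x),
    eLpNorm g 2 μ ^ 2

/-- On `Ω`, the distribution `τ` is the locally integrable function `g`. -/
def DistRep {Ω : Set E} (τ : Dist Ω) (g : E → ℂ) : Prop :=
  LocallyIntegrableOn g Ω ∧ ∀ φ : testSpace Ω, τ φ = ∫ x in Ω, g x * φ.1 x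

theorem Agrees.normSqL2_eq {Ω : Set E} {T : Functional E} {τ : Dist Ω} (h : Agrees T τ)
    (μ : Measure E) : normSqL2 μ Ω T = distNormSq μ τ := by
  have : ∀ g, Represents Ω T g ↔
      LocallyIntegrableOn g Ω ∧ ∀ φ : testSpace Ω, τ φ = ∫ x in Ω, g x * φ.1 x := fun g =>
    and_congr_right fun _ =>
      ⟨fun h' φ => by rw [← h φ]; exact h' _ φ.2, fun h' φ hφ => by rw [← h' ⟨φ, hφ⟩, ← h]⟩
  simp only [normSqL2, distNormSq, this]

theorem DistRep.distNormSq_le {Ω : Set E} {τ : Dist Ω} {g : E → ℂ} (h : DistRep τ g)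
    (μ : Measure E) : distNormSq μ τ ≤ eLpNorm g 2 μ ^ 2 := iInf₂_le g h

theorem exists_distRep_of_lt {Ω : Set E} {μ : Measure E} {τ : Dist Ω} {K : ℝ≥0∞}
    (h : distNormSq μ τ < K) : ∃ g, DistRep τ g ∧ eLpNorm g 2 μ ^ 2 < K := by
  simpa [distNormSq, iInf_lt_iff, DistRep] using h

theorem exists_distRep_of_ne_top {Ω : Set E} {μ : Measure E} {τ : Dist Ω}
    (h : distNormSq μ τ ≠ ⊤) : ∃ g, DistRep τ g ∧ eLpNorm g 2 μ ≠ ⊤ := by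
  obtain ⟨g, hg, hg'⟩ := exists_distRep_of_lt (lt_top_iff_ne_top.2 h)
  exact ⟨g, hg, fun h => by simp [h] at hg'⟩

theorem le_distNormSq {Ω : Set E} {μ : Measure E} {τ : Dist Ω} {K : ℝ≥0∞}
    (h : ∀ g, DistRep τ g → eLpNorm g 2 μ ≠ ⊤ → K ≤ eLpNorm g 2 μ ^ 2) : K ≤ distNormSq μ τ :=
  le_iInf₂ fun g hg => by
    by_cases ht : eLpNorm g 2 μ = ⊤
    · simp [ht]
    · exact h g hg ht

variable [OpensMeasurableSpace E] [SecondCountableTopology E]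

theorem integrableOn_mul_test {Ω : Set E} {g : E → ℂ} (hg : LocallyIntegrableOn g Ω)
    {φ : E → ℂ} (hφ : IsTestFunction Ω φ) : IntegrableOn (fun x => g x * φ x) Ω := by
  have hK : IsCompact (tsupport φ) := hφ.2
  have h1 : IntegrableOn (fun x => g x * φ x) (tsupport φ) := by
    obtain ⟨C, hC⟩ := hφ.2.exists_bound_of_continuous hφ.continuous
    refine Integrable.mul_bdd (c := C) (hg.integrableOn_compact_subset hφ.3 hK) ?_
      (Filter.Eventually.of_forall hC)
    exact hφ.continuous.aestronglyMeasurable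
  refine ((integrableOn_iff_integrable_of_support_subset ?_).1 h1).integrableOn
  exact (Function.support_mul_subset_right g φ).trans (subset_tsupport φ)

/-- Local integrability makes the products with test functions integrable, and this is what makes
`ofFun` additive on them. -/
theorem exists_agrees_ofFun {Ω : Set E} {g : E → ℂ} (hg : LocallyIntegrableOn g Ω) :
    ∃ τ : Dist Ω, Agrees (ofFun Ω g) τ ∧ DistRep τ g := by
  refine ⟨{ toFun := fun φ => ∫ x in Ω, g x * φ.1 x, map_add' := fun φ ψ => ?_,
            map_smul' := fun c φ => ?_ }, fun φ => rfl, hg, fun φ => rfl⟩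
  · rw [← integral_add (integrableOn_mul_test hg φ.2) (integrableOn_mul_test hg ψ.2)]
    simp [mul_add]
  · rw [RingHom.id_apply, smul_eq_mul, ← integral_const_mul]
    refine integral_congr_ae (Filter.Eventually.of_forall fun x => ?_)
    simp; ring

theorem DistRep.add {Ω : Set E} {τ τ' : Dist Ω} {g g' : E → ℂ} (h : DistRep τ g)
    (h' : DistRep τ' g') : DistRep (τ + τ') (g + g') := by
  refine ⟨h.1.add h'.1, fun φ => ?_⟩
  rw [LinearMap.add_apply, h.2, h'.2,
    ← integral_add (integrableOn_mul_test h.1 φ.2) (integrableOn_mul_test h'.1 φ.2)]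
  simp [add_mul]

theorem DistRep.smul {Ω : Set E} {τ : Dist Ω} {g : E → ℂ} (h : DistRep τ g) (c : ℂ) :
    DistRep (c • τ) (c • g) := by
  refine ⟨h.1.smul c, fun φ => ?_⟩
  rw [LinearMap.smul_apply, h.2, smul_eq_mul, ← integral_const_mul]
  simp [mul_assoc]

theorem add_sq_le_ennreal (a b : ℝ≥0∞) : (a + b) ^ 2 ≤ 2 * (a ^ 2 + b ^ 2) := by
  have := ENNReal.rpow_add_le_mul_rpow_add_rpow a b (p := 2) (by norm_num)
  norm_num at this
  exact_mod_cast this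

/-- Near-optimal representatives are added, so their almost everywhere uniqueness is not needed.
Absolute continuity transfers their measurability to `μ`. -/
theorem isQuadGauge_distNormSq {Ω : Set E} {μ : Measure E}
    (hμ : μ ≪ volume.restrict Ω) :
    IsQuadGauge (fun τ : Dist Ω => distNormSq μ τ) where
  add_le τ τ' := by
    refine ENNReal.le_of_forall_pos_le_add fun ε hε hlt => ?_
    have h1 : distNormSq μ τ ≠ ⊤ := fun h => by simp [h] at hlt
    have h2 : distNormSq μ τ' ≠ ⊤ := fun h => by simp [h] at hlt
    have hε' : ((ε / 4 : ℝ≥0) : ℝ≥0∞) ≠ 0 := by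
      simp only [ne_eq, ENNReal.coe_eq_zero]; positivity
    obtain ⟨g, hg, hgl⟩ := exists_distRep_of_lt (ENNReal.lt_add_right h1 hε')
    obtain ⟨g', hg', hgl'⟩ := exists_distRep_of_lt (ENNReal.lt_add_right h2 hε')
    have m1 : AEStronglyMeasurable g μ := (hg.1.aestronglyMeasurable).mono_ac hμ
    have m2 : AEStronglyMeasurable g' μ := (hg'.1.aestronglyMeasurable).mono_ac hμ
    calc distNormSq μ (τ + τ') ≤ eLpNorm (g + g') 2 μ ^ 2 := (hg.add hg').distNormSq_le μ
      _ ≤ (eLpNorm g 2 μ + eLpNorm g' 2 μ) ^ 2 := by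
        gcongr
        exact eLpNorm_add_le m1 m2 (by norm_num)
      _ ≤ 2 * (eLpNorm g 2 μ ^ 2 + eLpNorm g' 2 μ ^ 2) := add_sq_le_ennreal _ _
      _ ≤ 2 * ((distNormSq μ τ + (ε / 4 : ℝ≥0)) + (distNormSq μ τ' + (ε / 4 : ℝ≥0))) := by
        gcongr
      _ = 2 * (distNormSq μ τ + distNormSq μ τ') + ((4 * (ε / 4) : ℝ≥0) : ℝ≥0∞) := by
        push_cast; ring
      _ = _ := by congr 2; field_simp
  smul_le c τ := by
    -- For `c = 0` the right-hand side is zero even when `τ` has infinite norm, so the zero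
    -- distribution is represented directly.
    by_cases hc : c = 0
    · subst hc
      have h0 : DistRep (0 : Dist Ω) 0 :=
        ⟨(integrable_zero E ℂ volume).locallyIntegrable.locallyIntegrableOn _, by simp⟩
      simpa using h0.distNormSq_le μ
    · have hc1 : ‖c‖ₑ ^ 2 ≠ 0 := by simpa using hc
      have hc2 : ‖c‖ₑ ^ 2 ≠ ⊤ := by simp
      rw [mul_comm, ← ENNReal.div_le_iff_le_mul (Or.inl hc1) (Or.inl hc2)]
      refine le_distNormSq fun g hg _ => ?_
      rw [ENNReal.div_le_iff_le_mul (Or.inl hc1) (Or.inl hc2)]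
      refine ((hg.smul c).distNormSq_le μ).trans_eq ?_
      rw [eLpNorm_const_smul, mul_pow, mul_comm]

end Measure

end Dist

end AxiSobolev

/-! ### Smoothness of integrals depending on a parameter -/

namespace AxiSobolev

set_option linter.unusedSectionVars false

section Parametric

variable {X : Type} [NormedAddCommGroup X] [NormedSpace ℝ X] [FiniteDimensional ℝ X]

/-- The derivative in the parameter is continuous, hence bounded by a constant on a closed ball
times the interval; that constant is the dominating function. -/
theorem hasFDerivAt_intervalIntegral {W : Type} [NormedAddCommGroup W] [NormedSpace ℝ W]
    {H : X × ℝ → W} (hH : ContDiff ℝ ∞ H) (a b : ℝ) (x : X) :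
    HasFDerivAt (fun x => ∫ t in a..b, H (x, t))
      (∫ t in a..b, (fderiv ℝ H (x, t)).comp (ContinuousLinearMap.inl ℝ X ℝ)) x := by
  have hc : Continuous (fun p : X × ℝ => (fderiv ℝ H p).comp (ContinuousLinearMap.inl ℝ X ℝ)) :=
    (hH.continuous_fderiv (by simp)).clm_comp continuous_const
  have hK : IsCompact (Metric.closedBall x 1 ×ˢ Set.uIcc a b) :=
    (isCompact_closedBall x 1).prod isCompact_uIcc
  obtain ⟨C, hC⟩ := hK.exists_bound_of_continuousOn hc.continuousOn
  refine intervalIntegral.hasFDerivAt_integral_of_dominated_of_fderiv_le (bound := fun _ => C)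
    (F := fun x t => H (x, t))
    (F' := fun x t => (fderiv ℝ H (x, t)).comp (ContinuousLinearMap.inl ℝ X ℝ))
    (Metric.closedBall_mem_nhds x one_pos) (Filter.Eventually.of_forall fun y => ?_) ?_ ?_
    (Filter.Eventually.of_forall fun t ht y hy => ?_) intervalIntegrable_const
    (Filter.Eventually.of_forall fun t _ y _ => ?_)
  · exact (hH.continuous.comp (by fun_prop : Continuous fun t : ℝ => (y, t))).aestronglyMeasurable
  · exact (hH.continuous.comp (by fun_prop : Continuous fun t : ℝ => (x, t))).intervalIntegrable _ _
  · exact (hc.comp (by fun_prop : Continuous fun t : ℝ => (x, t))).aestronglyMeasurable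
  · exact hC (y, t) ⟨hy, Set.uIoc_subset_uIcc ht⟩
  · exact HasFDerivAt.comp y (hH.differentiable (by simp) (y, t)).hasFDerivAt
      (hasFDerivAt_prodMk_left y t)

/-- The derivative is an integral of the same kind with values in linear maps, so the induction runs
over all target spaces at once. -/
theorem contDiff_intervalIntegral {W : Type} [NormedAddCommGroup W] [NormedSpace ℝ W]
    {H : X × ℝ → W} (hH : ContDiff ℝ ∞ H) (a b : ℝ) :
    ContDiff ℝ ∞ (fun x => ∫ t in a..b, H (x, t)) := by
  rw [contDiff_infty]
  intro n
  induction n generalizing W with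
  | zero =>
    rw [Nat.cast_zero, contDiff_zero, continuous_iff_continuousAt]
    exact fun x => (hasFDerivAt_intervalIntegral hH a b x).continuousAt
  | succ n ih =>
    rw [Nat.cast_succ, contDiff_succ_iff_fderiv]
    refine ⟨fun x => (hasFDerivAt_intervalIntegral hH a b x).differentiableAt, by simp, ?_⟩
    rw [funext fun x => (hasFDerivAt_intervalIntegral hH a b x).fderiv]
    exact ih (H := fun p => (fderiv ℝ H p).comp (ContinuousLinearMap.inl ℝ X ℝ))
      ((hH.fderiv_right (m := ∞) (by simp)).clm_comp contDiff_const)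

end Parametric

/-! ### Cylindrical coordinates -/

section Polar

variable {F : Type} [NormedAddCommGroup F] [NormedSpace ℝ F]

/-- Cylindrical coordinates with the angle `θ` fixed: a linear map. -/
noncomputable def polarLin (F : Type) [NormedAddCommGroup F] [NormedSpace ℝ F] (θ : ℝ) :
    ℝ × F →L[ℝ] (ℝ × ℝ) × F :=
  ((Real.cos θ • ContinuousLinearMap.fst ℝ ℝ F).prod
    (Real.sin θ • ContinuousLinearMap.fst ℝ ℝ F)).prod (ContinuousLinearMap.snd ℝ ℝ F)

theorem polarLin_apply (θ : ℝ) (p : ℝ × F) :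
    polarLin F θ p = ((Real.cos θ * p.1, Real.sin θ * p.1), p.2) := rfl

/-- The point with cylindrical coordinates `((r, z), θ)`. -/
noncomputable def polarMap (q : (ℝ × F) × ℝ) : (ℝ × ℝ) × F := polarLin F q.2 q.1

theorem contDiff_polarMap : ContDiff ℝ ∞ (polarMap (F := F)) := by
  have : polarMap (F := F) = fun q => ((Real.cos q.2 * q.1.1, Real.sin q.2 * q.1.1), q.1.2) := rfl
  rw [this]
  fun_prop

/-- The pair `(r, z)` of a point in cylindrical coordinates. -/
noncomputable def meridianProj (x : (ℝ × ℝ) × F) : ℝ × F := (radius x.1, x.2)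

theorem continuous_radius : Continuous radius := by unfold radius; fun_prop

theorem continuous_meridianProj : Continuous (meridianProj (F := F)) :=
  (continuous_radius.comp continuous_fst).prodMk continuous_snd

theorem radius_eq_norm (x : ℝ × ℝ) : radius x = ‖(⟨x.1, x.2⟩ : ℂ)‖ := by
  rw [Complex.norm_def, Complex.normSq_mk, radius]; congr 1; ring

theorem radius_pos {x : ℝ × ℝ} (hx : x ≠ 0) : 0 < radius x := by
  rw [radius_eq_norm, norm_pos_iff]
  contrapose! hx
  exact Prod.ext (congrArg Complex.re hx) (congrArg Complex.im hx)

/-- The polar angle. -/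
noncomputable def angle (x : ℝ × ℝ) : ℝ := Complex.arg ⟨x.1, x.2⟩

theorem cos_angle_mul (x : ℝ × ℝ) : Real.cos (angle x) * radius x = x.1 := by
  rw [radius_eq_norm, mul_comm]; exact Complex.norm_mul_cos_arg _

theorem sin_angle_mul (x : ℝ × ℝ) : Real.sin (angle x) * radius x = x.2 := by
  rw [radius_eq_norm, mul_comm]; exact Complex.norm_mul_sin_arg _

theorem polarMap_meridianProj (x : (ℝ × ℝ) × F) : polarMap (meridianProj x, angle x.1) = x := by
  simp only [polarMap, polarLin_apply, meridianProj, cos_angle_mul, sin_angle_mul]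

theorem radius_polar {r : ℝ} (hr : 0 ≤ r) (θ : ℝ) :
    radius (Real.cos θ * r, Real.sin θ * r) = r := by
  have : (Real.cos θ * r) ^ 2 + (Real.sin θ * r) ^ 2 = r ^ 2 := by
    linear_combination r ^ 2 * Real.cos_sq_add_sin_sq θ
  rw [radius, this, Real.sqrt_sq hr]

theorem meridianProj_polarMap {p : ℝ × F} (hp : 0 < p.1) (θ : ℝ) :
    meridianProj (polarMap (p, θ)) = p := by
  simp only [polarMap, polarLin_apply, meridianProj, radius_polar hp.le]

theorem polarMap_fst_ne_zero {p : ℝ × F} (hp : 0 < p.1) (θ : ℝ) : (polarMap (p, θ)).1 ≠ 0 := by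
  intro h
  have h1 := congrArg Prod.fst (meridianProj_polarMap hp θ)
  simp [meridianProj, h, radius] at h1
  exact hp.ne h1

/-- Written as a power of `(x + iy)/r`, the mode shows no branch cut; its smoothness off the axis
follows from this form. -/
theorem mode_eq_zpow (k : ℤ) {x : ℝ × ℝ} (hx : x ≠ 0) :
    mode k x = ((⟨x.1, x.2⟩ : ℂ) / (radius x : ℂ)) ^ k := by
  have hr : (radius x : ℂ) ≠ 0 := by exact_mod_cast (radius_pos hx).ne'
  have h1 : (⟨x.1, x.2⟩ : ℂ) / (radius x : ℂ) =
      Complex.exp (Complex.I * (Complex.arg ⟨x.1, x.2⟩ : ℂ)) := by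
    rw [div_eq_iff hr, radius_eq_norm, mul_comm Complex.I, mul_comm]
    exact (Complex.norm_mul_exp_arg_mul_I _).symm
  rw [h1, ← Complex.exp_int_mul, mode]
  congr 1
  ring

theorem mode_polarMap (k : ℤ) {p : ℝ × F} (hp : 0 < p.1) (θ : ℝ) :
    mode k (polarMap (p, θ)).1 = Complex.exp (Complex.I * k * θ) := by
  rw [mode_eq_zpow k (polarMap_fst_ne_zero hp θ)]
  simp only [polarMap, polarLin_apply, radius_polar hp.le]
  have hr : (p.1 : ℂ) ≠ 0 := by exact_mod_cast hp.ne'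
  have : (⟨Real.cos θ * p.1, Real.sin θ * p.1⟩ : ℂ) = Complex.exp (Complex.I * θ) * p.1 := by
    rw [mul_comm Complex.I, Complex.exp_mul_I]
    apply Complex.ext <;> simp [Complex.cos_ofReal_re, Complex.sin_ofReal_re]
  rw [this, mul_div_cancel_right₀ _ hr, ← Complex.exp_int_mul]
  congr 1
  ring

theorem norm_mode (k : ℤ) (x : ℝ × ℝ) : ‖mode k x‖ = 1 := by
  have : Complex.I * (k : ℂ) * (Complex.arg ⟨x.1, x.2⟩ : ℂ) =
      ((k * Complex.arg ⟨x.1, x.2⟩ : ℝ) : ℂ) * Complex.I := by push_cast; ring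
  rw [mode, this, Complex.norm_exp_ofReal_mul_I]

theorem measurable_mode (k : ℤ) : Measurable (mode k) := by
  have h : Measurable fun x : ℝ × ℝ => (⟨x.1, x.2⟩ : ℂ) :=
    Complex.measurableEquivRealProd.symm.measurable
  have h2 : Measurable fun x : ℝ × ℝ => (Complex.arg ⟨x.1, x.2⟩ : ℂ) :=
    Complex.measurable_ofReal.comp (Complex.measurable_arg.comp h)
  exact Complex.measurable_exp.comp (measurable_const.mul h2)

theorem contDiffAt_radius {x : ℝ × ℝ} (hx : x ≠ 0) : ContDiffAt ℝ ∞ radius x := by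
  have h : x.1 ^ 2 + x.2 ^ 2 ≠ 0 := by
    have := radius_pos hx
    rw [radius, Real.sqrt_pos] at this
    exact this.ne'
  unfold radius
  exact ContDiffAt.sqrt (by fun_prop) h

theorem contDiffAt_mode (k : ℤ) {x : ℝ × ℝ} (hx : x ≠ 0) : ContDiffAt ℝ ∞ (mode k) x := by
  have hr : (radius x : ℂ) ≠ 0 := by exact_mod_cast (radius_pos hx).ne'
  have hz : (⟨x.1, x.2⟩ : ℂ) ≠ 0 := by
    intro h; exact hx (Prod.ext (congrArg Complex.re h) (congrArg Complex.im h))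
  have h1 : ContDiffAt ℝ ∞ (fun x : ℝ × ℝ => (⟨x.1, x.2⟩ : ℂ) / (radius x : ℂ)) x := by
    have h3 : ContDiffAt ℝ ∞ (fun x : ℝ × ℝ => (radius x : ℂ)) x :=
      ContDiffAt.comp x Complex.ofRealCLM.contDiff.contDiffAt (contDiffAt_radius hx)
    simp only [div_eq_mul_inv]
    exact Complex.equivRealProdCLM.symm.contDiff.contDiffAt.mul (h3.inv hr)
  have h2 : ContDiffAt ℝ ∞ (fun z : ℂ => z ^ k) ((⟨x.1, x.2⟩ : ℂ) / (radius x : ℂ)) := by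
    have hne := div_ne_zero hz hr
    rcases k with n | n
    · simpa using (contDiff_id.pow n).contDiffAt
    · simp only [zpow_negSucc]
      exact ((contDiff_id.pow (n + 1)).contDiffAt).inv (pow_ne_zero _ hne)
  refine (h2.comp x h1).congr_of_eventuallyEq ?_
  filter_upwards [isOpen_ne.mem_nhds hx] with y hy
  exact mode_eq_zpow k hy

/-! ### Axisymmetric domains -/

/-- Invariance under all rotations around the axis `(x, y) = 0`. -/
def IsAxisymmetric (U : Set ((ℝ × ℝ) × F)) : Prop :=
  ∀ θ : ℝ, ∀ x ∈ U, (rot θ x.1, x.2) ∈ U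

/-- The meridian domain. -/
def meridian (U : Set ((ℝ × ℝ) × F)) : Set (ℝ × F) := {p | 0 < p.1 ∧ ((p.1, 0), p.2) ∈ U}

/-- The part of a domain off the axis. -/
def offAxis (U : Set ((ℝ × ℝ) × F)) : Set ((ℝ × ℝ) × F) := {x | x ∈ U ∧ x.1 ≠ 0}

variable {U : Set ((ℝ × ℝ) × F)}

theorem isOpen_meridian (hU : IsOpen U) : IsOpen (meridian U) :=
  (isOpen_lt continuous_const continuous_fst).inter (hU.preimage (by fun_prop))

theorem isOpen_offAxis (hU : IsOpen U) : IsOpen (offAxis U) :=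
  hU.inter (isOpen_ne.preimage continuous_fst)

theorem polarMap_mem_iff (hr : IsAxisymmetric U) {p : ℝ × F} (hp : 0 < p.1) (θ : ℝ) :
    polarMap (p, θ) ∈ offAxis U ↔ p ∈ meridian U := by
  have h1 : (rot θ (p.1, 0), p.2) = polarMap (p, θ) := by
    simp [rot, polarMap, polarLin_apply]
  have h2 : (rot (-θ) (polarMap (p, θ)).1, (polarMap (p, θ)).2) = ((p.1, 0), p.2) := by
    simp only [rot, polarMap, polarLin_apply, Real.cos_neg, Real.sin_neg]
    refine Prod.ext (Prod.ext ?_ ?_) rfl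
    · simp only
      linear_combination p.1 * Real.cos_sq_add_sin_sq θ
    · simp only
      ring
  constructor
  · intro h
    refine ⟨hp, ?_⟩
    rw [← h2]
    exact hr _ _ h.1
  · intro h
    refine ⟨?_, polarMap_fst_ne_zero hp θ⟩
    rw [← h1]
    exact hr _ _ h.2

theorem meridianProj_mem (hr : IsAxisymmetric U) {x : (ℝ × ℝ) × F} (hx : x ∈ offAxis U) :
    meridianProj x ∈ meridian U := by
  rw [← polarMap_mem_iff hr (radius_pos hx.2) (angle x.1), polarMap_meridianProj]
  exact hx

/-! ### Angular averages of test functions -/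

open Complex in
/-- The angular Fourier integral of a function in cylindrical coordinates. -/
noncomputable def angInt (n : ℤ) (Φ : (ℝ × ℝ) × F → ℂ) (p : ℝ × F) : ℂ :=
  ∫ θ in (-Real.pi)..Real.pi, exp (I * n * θ) * Φ (polarMap (p, θ))

/-- The angular average dual to the lift of functions of the angular mode `n`. -/
noncomputable def angAvg (n : ℤ) (Φ : (ℝ × ℝ) × F → ℂ) (p : ℝ × F) : ℂ :=
  if 0 < p.1 then p.1 * angInt n Φ p else 0

/-- A right inverse of the angular average. -/
noncomputable def angExt (n : ℤ) (φ : ℝ × F → ℂ) (x : (ℝ × ℝ) × F) : ℂ :=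
  mode (-n) x.1 * (((2 * Real.pi * radius x.1 : ℝ) : ℂ)⁻¹ * φ (meridianProj x))

theorem contDiff_expI (n : ℤ) : ContDiff ℝ ∞ (fun θ : ℝ => Complex.exp (Complex.I * n * θ)) :=
  Complex.contDiff_exp.comp (contDiff_const.mul Complex.ofRealCLM.contDiff)

theorem contDiff_angIntegrand (n : ℤ) {Φ : (ℝ × ℝ) × F → ℂ} (hΦ : ContDiff ℝ ∞ Φ) :
    ContDiff ℝ ∞ (fun q : (ℝ × F) × ℝ => Complex.exp (Complex.I * n * q.2) * Φ (polarMap q)) :=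
  ((contDiff_expI n).comp contDiff_snd).mul (hΦ.comp contDiff_polarMap)

theorem contDiff_angInt [FiniteDimensional ℝ F] (n : ℤ) {Φ : (ℝ × ℝ) × F → ℂ}
    (hΦ : ContDiff ℝ ∞ Φ) : ContDiff ℝ ∞ (angInt n Φ) :=
  contDiff_intervalIntegral (contDiff_angIntegrand n hΦ) _ _

theorem fderiv_angInt [FiniteDimensional ℝ F] (n : ℤ) {Φ : (ℝ × ℝ) × F → ℂ}
    (hΦ : ContDiff ℝ ∞ Φ) (p v : ℝ × F) :
    fderiv ℝ (angInt n Φ) p v = ∫ θ in (-Real.pi)..Real.pi,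
      Complex.exp (Complex.I * n * θ) * fderiv ℝ Φ (polarMap (p, θ)) (polarLin F θ v) := by
  have hH := contDiff_angIntegrand n hΦ
  have h := hasFDerivAt_intervalIntegral hH (-Real.pi) Real.pi p
  have hc : Continuous fun θ : ℝ => (fderiv ℝ (fun q : (ℝ × F) × ℝ =>
      Complex.exp (Complex.I * n * q.2) * Φ (polarMap q)) (p, θ)).comp
      (ContinuousLinearMap.inl ℝ (ℝ × F) ℝ) :=
    ((hH.continuous_fderiv (by simp)).comp (by fun_prop : Continuous fun θ : ℝ => (p, θ))).clm_comp
      continuous_const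
  rw [show fderiv ℝ (angInt n Φ) p = _ from h.fderiv,
    ContinuousLinearMap.intervalIntegral_apply (hc.intervalIntegrable _ _)]
  refine intervalIntegral.integral_congr fun θ _ => ?_
  have h1 : HasFDerivAt (fun y : ℝ × F => Complex.exp (Complex.I * n * θ) * Φ (polarMap (y, θ)))
      ((fderiv ℝ (fun q : (ℝ × F) × ℝ =>
      Complex.exp (Complex.I * n * q.2) * Φ (polarMap q)) (p, θ)).comp
      (ContinuousLinearMap.inl ℝ (ℝ × F) ℝ)) p :=
    HasFDerivAt.comp (f := fun y : ℝ × F => (y, θ)) p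
      (hH.differentiable (by simp) (p, θ)).hasFDerivAt (hasFDerivAt_prodMk_left p θ)
  have h2 : HasFDerivAt (fun y : ℝ × F => Complex.exp (Complex.I * n * θ) * Φ (polarMap (y, θ)))
      (Complex.exp (Complex.I * n * θ) • (fderiv ℝ Φ (polarMap (p, θ))).comp (polarLin F θ)) p := by
    have h3 : HasFDerivAt (fun y : ℝ × F => Φ (polarLin F θ y))
        ((fderiv ℝ Φ (polarMap (p, θ))).comp (polarLin F θ)) p :=
      HasFDerivAt.comp p (hΦ.differentiable (by simp) _).hasFDerivAt (polarLin F θ).hasFDerivAt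
    exact h3.const_mul _
  rw [h1.unique h2]
  rfl

/-- Integration by parts in `θ`: the integrand is `2π`-periodic, so there is no boundary term. -/
theorem angInt_deriv_angle (n : ℤ) {Φ : (ℝ × ℝ) × F → ℂ} (hΦ : ContDiff ℝ ∞ Φ) (p : ℝ × F) :
    Complex.I * n * angInt n Φ p + ∫ θ in (-Real.pi)..Real.pi, Complex.exp (Complex.I * n * θ) *
      fderiv ℝ Φ (polarMap (p, θ)) ((-Real.sin θ * p.1, Real.cos θ * p.1), 0) = 0 := by
  have hp : ∀ θ : ℝ, HasDerivAt (fun θ : ℝ => polarMap (p, θ))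
      ((-Real.sin θ * p.1, Real.cos θ * p.1), 0) θ := fun θ => by
    have h1 := ((Real.hasDerivAt_cos θ).mul_const p.1).prodMk
      ((Real.hasDerivAt_sin θ).mul_const p.1)
    exact h1.prodMk (hasDerivAt_const θ p.2)
  have he : ∀ θ : ℝ, HasDerivAt (fun θ : ℝ => Complex.exp (Complex.I * n * θ))
      (Complex.exp (Complex.I * n * θ) * (Complex.I * n)) θ := fun θ => by
    have h1 : HasDerivAt (fun θ : ℝ => Complex.I * n * (θ : ℂ)) (Complex.I * n * 1) θ :=
      (Complex.ofRealCLM.hasDerivAt (x := θ)).const_mul _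
    simpa using h1.cexp
  have hd : ∀ θ : ℝ, HasDerivAt
      (fun θ : ℝ => Complex.exp (Complex.I * n * θ) * Φ (polarMap (p, θ)))
      (Complex.I * n * (Complex.exp (Complex.I * n * θ) * Φ (polarMap (p, θ))) +
        Complex.exp (Complex.I * n * θ) *
        fderiv ℝ Φ (polarMap (p, θ)) ((-Real.sin θ * p.1, Real.cos θ * p.1), 0)) θ := fun θ => by
    have h1 : HasDerivAt (fun θ : ℝ => Φ (polarMap (p, θ))) _ θ :=
      (hΦ.differentiable (by simp) (polarMap (p, θ))).hasFDerivAt.comp_hasDerivAt θ (hp θ)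
    exact ((he θ).fun_mul h1).congr_deriv (by ring)
  have c0 : Continuous fun θ : ℝ => polarMap (p, θ) :=
    contDiff_polarMap.continuous.comp (by fun_prop)
  have c1 : Continuous fun θ : ℝ => Complex.exp (Complex.I * n * θ) * Φ (polarMap (p, θ)) :=
    (contDiff_expI n).continuous.mul (hΦ.continuous.comp c0)
  have c1' : Continuous fun θ : ℝ =>
      Complex.I * n * (Complex.exp (Complex.I * n * θ) * Φ (polarMap (p, θ))) :=
    continuous_const.mul c1
  have c2 : Continuous fun θ : ℝ => Complex.exp (Complex.I * n * θ) *
      fderiv ℝ Φ (polarMap (p, θ)) ((-Real.sin θ * p.1, Real.cos θ * p.1), 0) := by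
    refine (contDiff_expI n).continuous.mul
      (((hΦ.continuous_fderiv (by simp)).comp c0).clm_apply ?_)
    fun_prop
  have key := intervalIntegral.integral_eq_sub_of_hasDerivAt (a := -Real.pi) (b := Real.pi)
    (fun θ _ => hd θ) ((c1'.add c2).intervalIntegrable _ _)
  have hper : Complex.exp (Complex.I * n * (Real.pi : ℝ)) =
      Complex.exp (Complex.I * n * ((-Real.pi : ℝ) : ℂ)) := by
    rw [Complex.exp_eq_exp_iff_exists_int]
    exact ⟨n, by push_cast; ring⟩
  have hper' : polarMap (p, Real.pi) = polarMap (p, -Real.pi) := by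
    simp [polarMap, polarLin_apply]
  rw [intervalIntegral.integral_add (c1'.intervalIntegrable _ _)
    (c2.intervalIntegrable _ _), intervalIntegral.integral_const_mul, hper, hper', sub_self] at key
  exact key

end Polar

end AxiSobolev

namespace AxiSobolev

set_option linter.unusedSectionVars false

/-! ### Lifting distributions from the meridian domain -/

section Lift

variable {F : Type} [NormedAddCommGroup F] [NormedSpace ℝ F] {U : Set ((ℝ × ℝ) × F)}

theorem angInt_eq_zero {Φ : (ℝ × ℝ) × F → ℂ} (n : ℤ) {p : ℝ × F} (hp : 0 < p.1)
    (h : p ∉ meridianProj '' tsupport Φ) : angInt n Φ p = 0 := by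
  have : ∀ θ : ℝ, Φ (polarMap (p, θ)) = 0 := fun θ => by
    refine image_eq_zero_of_notMem_tsupport fun h' => h ⟨_, h', ?_⟩
    exact meridianProj_polarMap hp θ
  simp [angInt, this]

theorem angAvg_eq_zero {Φ : (ℝ × ℝ) × F → ℂ} (n : ℤ) {p : ℝ × F}
    (h : p ∉ meridianProj '' tsupport Φ) : angAvg n Φ p = 0 := by
  unfold angAvg
  split_ifs with hp
  · rw [angInt_eq_zero n hp h, mul_zero]
  · rfl

theorem angAvg_eventuallyEq (Φ : (ℝ × ℝ) × F → ℂ) (n : ℤ) {p : ℝ × F} (hp : 0 < p.1) :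
    angAvg n Φ =ᶠ[nhds p] fun p => p.1 * angInt n Φ p := by
  filter_upwards [(isOpen_lt continuous_const continuous_fst).mem_nhds hp] with q hq
  exact if_pos hq

/-- The support lies in the projection of a compact set off the axis, hence in a compact subset of
`r > 0`, so cutting off at `r ≤ 0` creates no jump. The cut is necessary: for negative `r` the map
`polarMap` covers the plane a second time. -/
theorem IsTestFunction.angAvg [FiniteDimensional ℝ F] (hr : IsAxisymmetric U)
    {Φ : (ℝ × ℝ) × F → ℂ} (hΦ : IsTestFunction (offAxis U) Φ) (n : ℤ) :
    IsTestFunction (meridian U) (angAvg n Φ) := by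
  have hK : IsCompact (meridianProj '' tsupport Φ) := hΦ.2.isCompact.image continuous_meridianProj
  have hsupp : tsupport (AxiSobolev.angAvg n Φ) ⊆ meridianProj '' tsupport Φ := by
    refine closure_minimal (fun p hp => ?_) hK.isClosed
    by_contra h
    exact hp (angAvg_eq_zero n h)
  have hsub : meridianProj '' tsupport Φ ⊆ meridian U := by
    rintro _ ⟨x, hx, rfl⟩
    exact meridianProj_mem hr (hΦ.3 hx)
  refine ⟨contDiff_iff_contDiffAt.2 fun p => ?_, hK.of_isClosed_subset (isClosed_tsupport _) hsupp,
    hsupp.trans hsub⟩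
  by_cases hp : 0 < p.1
  · refine ContDiffAt.congr_of_eventuallyEq ?_ (angAvg_eventuallyEq Φ n hp)
    exact ((Complex.ofRealCLM.contDiff.comp contDiff_fst).mul
      (contDiff_angInt n hΦ.contDiff)).contDiffAt
  · have hp' : p ∈ (meridianProj '' tsupport Φ)ᶜ := fun h => hp (hsub h).1
    refine (contDiffAt_const (c := (0 : ℂ))).congr_of_eventuallyEq ?_
    filter_upwards [hK.isClosed.isOpen_compl.mem_nhds hp'] with q hq
    exact angAvg_eq_zero n hq

theorem continuous_angIntegrand (n : ℤ) {Φ : (ℝ × ℝ) × F → ℂ} (hΦ : Continuous Φ) (p : ℝ × F) :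
    Continuous fun θ : ℝ => Complex.exp (Complex.I * n * θ) * Φ (polarMap (p, θ)) :=
  (contDiff_expI n).continuous.mul (hΦ.comp (contDiff_polarMap.continuous.comp (by fun_prop)))

theorem angInt_add (n : ℤ) {Φ Ψ : (ℝ × ℝ) × F → ℂ} (hΦ : Continuous Φ) (hΨ : Continuous Ψ)
    (p : ℝ × F) : angInt n (Φ + Ψ) p = angInt n Φ p + angInt n Ψ p := by
  simp only [angInt]
  rw [← intervalIntegral.integral_add
    ((continuous_angIntegrand n hΦ p).intervalIntegrable _ _)
    ((continuous_angIntegrand n hΨ p).intervalIntegrable _ _)]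
  simp [mul_add]

theorem angInt_smul (n : ℤ) (c : ℂ) (Φ : (ℝ × ℝ) × F → ℂ) (p : ℝ × F) :
    angInt n (c • Φ) p = c * angInt n Φ p := by
  simp only [angInt]
  rw [← intervalIntegral.integral_const_mul]
  congr 1
  ext θ
  simp; ring

variable [FiniteDimensional ℝ F]

/-- The angular average of test functions. -/
noncomputable def angAvgLin (hr : IsAxisymmetric U) (n : ℤ) :
    testSpace (offAxis U) →ₗ[ℂ] testSpace (meridian U) where
  toFun Φ := ⟨angAvg n Φ.1, IsTestFunction.angAvg hr Φ.2 n⟩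
  map_add' Φ Ψ := by
    ext p
    simp only [Submodule.coe_add, Pi.add_apply, angAvg, angInt_add n Φ.2.continuous Ψ.2.continuous]
    split_ifs <;> simp [mul_add]
  map_smul' c Φ := by
    ext p
    simp only [Submodule.coe_smul, Pi.smul_apply, angAvg, angInt_smul, RingHom.id_apply]
    split_ifs <;> simp
    ring

theorem angAvgLin_apply (hr : IsAxisymmetric U) (n : ℤ) (Φ : testSpace (offAxis U)) {p : ℝ × F}
    (hp : 0 < p.1) : (angAvgLin hr n Φ).1 p = p.1 * angInt n Φ.1 p := if_pos hp

theorem fderiv_angAvgLin (hr : IsAxisymmetric U) (n : ℤ) (Φ : testSpace (offAxis U)) {p : ℝ × F}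
    (hp : 0 < p.1) (v : ℝ × F) : fderiv ℝ (angAvgLin hr n Φ).1 p v =
      v.1 * angInt n Φ.1 p + p.1 * fderiv ℝ (angInt n Φ.1) p v := by
  have h1 : (angAvgLin hr n Φ).1 =ᶠ[nhds p] fun p => p.1 * angInt n Φ.1 p :=
    angAvg_eventuallyEq Φ.1 n hp
  have h2 : HasFDerivAt (fun p : ℝ × F => (p.1 : ℂ))
      (Complex.ofRealCLM.comp (ContinuousLinearMap.fst ℝ ℝ F)) p :=
    (Complex.ofRealCLM.comp (ContinuousLinearMap.fst ℝ ℝ F)).hasFDerivAt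
  have h3 := ((contDiff_angInt n Φ.2.contDiff).differentiable (by simp) p).hasFDerivAt
  rw [h1.fderiv_eq, (h2.fun_mul h3).fderiv]
  simp
  ring

/-- Lift of a distribution on the meridian domain to the angular mode `n`. -/
noncomputable def lift (hr : IsAxisymmetric U) (n : ℤ) :
    Dist (meridian U) →ₗ[ℂ] Dist (offAxis U) := (angAvgLin hr n).dualMap

theorem lift_apply (hr : IsAxisymmetric U) (n : ℤ) (τ : Dist (meridian U))
    (Φ : testSpace (offAxis U)) : lift hr n τ Φ = τ (angAvgLin hr n Φ) := rfl

/-- The lift commutes with derivatives along the axis. -/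
theorem distDeriv_axial_lift (hr : IsAxisymmetric U) (n : ℤ) (v : F) (τ : Dist (meridian U)) :
    distDeriv (offAxis U) ((0, 0), v) (lift hr n τ) =
      lift hr n (distDeriv (meridian U) (0, v) τ) := by
  ext Φ
  rw [distDeriv_apply, lift_apply, lift_apply, distDeriv_apply]
  congr 2
  refine testSpace_ext fun p hp => ?_
  rw [testDeriv_apply, angAvgLin_apply hr n _ hp.1, fderiv_angAvgLin hr n Φ hp.1,
    fderiv_angInt n Φ.2.contDiff]
  simp only [angInt, testDeriv_apply, polarLin_apply]
  simp

theorem contDiffOn_inv_fst : ContDiffOn ℝ ∞ (fun p : ℝ × F => ((p.1⁻¹ : ℝ) : ℂ)) (meridian U) :=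
  fun p hp => by
    have : ContDiffAt ℝ ∞ (fun p : ℝ × F => p.1⁻¹) p := contDiffAt_fst.inv hp.1.ne'
    exact (ContDiffAt.comp p Complex.ofRealCLM.contDiff.contDiffAt this).contDiffWithinAt

theorem contDiffOn_fst : ContDiffOn ℝ ∞ (fun p : ℝ × F => (p.1 : ℂ)) (meridian U) :=
  (Complex.ofRealCLM.contDiff.comp contDiff_fst).contDiffOn

/-- Multiplication by `1/r` on the meridian domain. -/
noncomputable def distInvR (hU : IsOpen U) : Module.End ℂ (Dist (meridian U)) :=
  distMul (isOpen_meridian hU) contDiffOn_inv_fst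

/-- Multiplication by `r` on the meridian domain. -/
noncomputable def distR (hU : IsOpen U) : Module.End ℂ (Dist (meridian U)) :=
  distMul (isOpen_meridian hU) contDiffOn_fst

/-- For `s = ±1`, `∂_x + is∂_y = e^{isθ} (∂_r + (is/r) ∂_θ)`. The exponential shifts the mode to `n
+ s`, and integration by parts turns `∂_θ` into multiplication by `-i(n + s)`. -/
theorem angInt_rotated (n s : ℤ) (hs : s * s = 1) {Φ : (ℝ × ℝ) × F → ℂ} (hΦ : ContDiff ℝ ∞ Φ)
    (p : ℝ × F) :
    p.1 * (angInt n (fun x => fderiv ℝ Φ x ((1, 0), 0)) p +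
      s * Complex.I * angInt n (fun x => fderiv ℝ Φ x ((0, 1), 0)) p) =
    p.1 * fderiv ℝ (angInt (n + s) Φ) p (1, 0) + s * (n + s) * angInt (n + s) Φ p := by
  have hsC : (s : ℂ) * s = 1 := by exact_mod_cast hs
  have hc : ∀ e, Continuous fun x => fderiv ℝ Φ x e := fun e =>
    (hΦ.continuous_fderiv (by simp)).clm_apply continuous_const
  have c0 : ∀ e, Continuous fun θ : ℝ => fderiv ℝ Φ (polarMap (p, θ)) e := fun e =>
    (hc e).comp (contDiff_polarMap.continuous.comp (by fun_prop))
  have ce := fun m : ℤ => (contDiff_expI m).continuous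
  have ccos : Continuous fun θ : ℝ => (Real.cos θ : ℂ) := by fun_prop
  have csin : Continuous fun θ : ℝ => (Real.sin θ : ℂ) := by fun_prop
  have e1 : fderiv ℝ (angInt (n + s) Φ) p (1, 0) = ∫ θ in (-Real.pi)..Real.pi,
      Complex.exp (Complex.I * (n + s : ℤ) * θ) *
        (Real.cos θ * fderiv ℝ Φ (polarMap (p, θ)) ((1, 0), 0) +
          Real.sin θ * fderiv ℝ Φ (polarMap (p, θ)) ((0, 1), 0)) := by
    rw [fderiv_angInt (n + s) hΦ]
    refine intervalIntegral.integral_congr fun θ _ => ?_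
    have : polarLin F θ (1, 0) =
        Real.cos θ • (((1, 0), 0) : (ℝ × ℝ) × F) + Real.sin θ • ((0, 1), 0) := by
      simp [polarLin_apply]
    simp only [this, map_add, map_smul, Complex.real_smul]
  have e2 : ∫ θ in (-Real.pi)..Real.pi, Complex.exp (Complex.I * (n + s : ℤ) * θ) *
      fderiv ℝ Φ (polarMap (p, θ)) ((-Real.sin θ * p.1, Real.cos θ * p.1), 0) =
      p.1 * ∫ θ in (-Real.pi)..Real.pi, Complex.exp (Complex.I * (n + s : ℤ) * θ) *
        (Real.cos θ * fderiv ℝ Φ (polarMap (p, θ)) ((0, 1), 0) -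
          Real.sin θ * fderiv ℝ Φ (polarMap (p, θ)) ((1, 0), 0)) := by
    rw [← intervalIntegral.integral_const_mul]
    refine intervalIntegral.integral_congr fun θ _ => ?_
    have : ((-Real.sin θ * p.1, Real.cos θ * p.1), 0) =
        (-Real.sin θ * p.1) • (((1, 0), 0) : (ℝ × ℝ) × F) +
          (Real.cos θ * p.1) • ((0, 1), 0) := by
      simp
    simp only [this, map_add, map_smul, Complex.real_smul]
    push_cast
    ring
  have e3 : angInt n (fun x => fderiv ℝ Φ x ((1, 0), 0)) p +
      s * Complex.I * angInt n (fun x => fderiv ℝ Φ x ((0, 1), 0)) p =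
      (∫ θ in (-Real.pi)..Real.pi, Complex.exp (Complex.I * (n + s : ℤ) * θ) *
        (Real.cos θ * fderiv ℝ Φ (polarMap (p, θ)) ((1, 0), 0) +
          Real.sin θ * fderiv ℝ Φ (polarMap (p, θ)) ((0, 1), 0))) +
      s * Complex.I * ∫ θ in (-Real.pi)..Real.pi, Complex.exp (Complex.I * (n + s : ℤ) * θ) *
        (Real.cos θ * fderiv ℝ Φ (polarMap (p, θ)) ((0, 1), 0) -
          Real.sin θ * fderiv ℝ Φ (polarMap (p, θ)) ((1, 0), 0)) := by
    simp only [angInt]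
    rw [← intervalIntegral.integral_const_mul, ← intervalIntegral.integral_const_mul,
      ← intervalIntegral.integral_add, ← intervalIntegral.integral_add]
    · refine intervalIntegral.integral_congr fun θ _ => ?_
      have h1 : Complex.exp (Complex.I * (n + s : ℤ) * θ) =
          Complex.exp (Complex.I * n * θ) * (Real.cos θ + s * Real.sin θ * Complex.I) := by
        have h2 : Complex.I * ((n + s : ℤ) : ℂ) * θ =
            Complex.I * n * θ + ((s * θ : ℝ) : ℂ) * Complex.I := by push_cast; ring
        rw [h2, Complex.exp_add, Complex.exp_ofReal_mul_I]
        have : s = 1 ∨ s = -1 := by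
          have : IsUnit s := IsUnit.of_mul_eq_one _ hs
          exact Int.isUnit_iff.1 this
        rcases this with rfl | rfl <;> simp
      have h4 : (Real.cos θ : ℂ) ^ 2 + (Real.sin θ : ℂ) ^ 2 = 1 := by
        exact_mod_cast Real.cos_sq_add_sin_sq θ
      simp only [h1]
      generalize fderiv ℝ Φ (polarMap (p, θ)) ((1, 0), 0) = X
      generalize fderiv ℝ Φ (polarMap (p, θ)) ((0, 1), 0) = Y
      generalize Complex.exp (Complex.I * n * θ) = ee
      generalize (Real.cos θ : ℂ) = cc at *
      generalize (Real.sin θ : ℂ) = ss at *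
      have hI := Complex.I_mul_I
      linear_combination (-(ee * X + ee * s * Complex.I * Y)) * h4 +
        ee * ss * (X * ss - Y * cc) * (Complex.I ^ 2 * hsC + hI)
    all_goals refine Continuous.intervalIntegrable ?_ _ _
    · exact (ce _).mul ((ccos.mul (c0 _)).add (csin.mul (c0 _)))
    · exact continuous_const.mul ((ce _).mul ((ccos.mul (c0 _)).sub (csin.mul (c0 _))))
    · exact (ce _).mul (c0 _)
    · exact continuous_const.mul ((ce _).mul (c0 _))
  have e4 := angInt_deriv_angle (n + s) hΦ p
  rw [e2] at e4
  rw [e3, e1]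
  push_cast at e4 ⊢
  linear_combination (s * Complex.I) * e4 - s * (n + s) * angInt (n + s) Φ p * Complex.I_mul_I

/-- The operators `∂_x ± i∂_y` change the angular mode by one. -/
theorem cartDeriv_lift (hU : IsOpen U) (hr : IsAxisymmetric U) (n s : ℤ) (hs : s * s = 1)
    (τ : Dist (meridian U)) :
    distDeriv (offAxis U) ((1, 0), 0) (lift hr n τ) +
      ((s : ℂ) * Complex.I) • distDeriv (offAxis U) ((0, 1), 0) (lift hr n τ) =
    lift hr (n + s) (distDeriv (meridian U) (1, 0) τ - ((s * n : ℤ) : ℂ) • distInvR hU τ) := by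
  have hsC : (s : ℂ) * s = 1 := by exact_mod_cast hs
  ext Φ
  -- The transposed identity on test functions. Of the coefficient `s(n + s) = sn + 1`, the `1` is
  -- the derivative of the Jacobian factor `r`, and `sn` becomes the term in `1/r`.
  have key : angAvgLin hr n (testDeriv (offAxis U) ((1, 0), 0) Φ +
      ((s : ℂ) * Complex.I) • testDeriv (offAxis U) ((0, 1), 0) Φ) =
      testDeriv (meridian U) (1, 0) (angAvgLin hr (n + s) Φ) + ((s * n : ℤ) : ℂ) •
        testMul (isOpen_meridian hU) contDiffOn_inv_fst (angAvgLin hr (n + s) Φ) := by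
    rw [map_add, map_smul]
    refine testSpace_ext fun p hp => ?_
    have hp0 : (p.1 : ℂ) ≠ 0 := by exact_mod_cast hp.1.ne'
    have h := angInt_rotated n s hs Φ.2.contDiff p
    simp only [Submodule.coe_add, Submodule.coe_smul, Pi.add_apply, Pi.smul_apply, smul_eq_mul,
      testDeriv_apply, testMul_apply, fderiv_angAvgLin hr _ Φ hp.1, angAvgLin_apply hr _ _ hp.1]
    have h1 : ∀ e, angInt n (testDeriv (offAxis U) e Φ).1 p =
        angInt n (fun x => fderiv ℝ Φ.1 x e) p := fun e => rfl
    rw [h1, h1]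
    push_cast
    field_simp
    linear_combination h + angInt (n + s) Φ.1 p * hsC
  simp only [LinearMap.add_apply, LinearMap.smul_apply, distDeriv_apply, lift_apply,
    LinearMap.sub_apply, distInvR, distMul_apply, smul_eq_mul]
  have := congrArg τ key
  simp only [map_add, map_smul, smul_eq_mul] at this
  linear_combination -this

end Lift

end AxiSobolev

/-! ### Integration in cylindrical coordinates -/

namespace AxiSobolev

set_option linter.unusedSectionVars false

section PolarMeasure

variable {F : Type} [NormedAddCommGroup F] [NormedSpace ℝ F] [FiniteDimensional ℝ F]
  [MeasureSpace F] [BorelSpace F] [SecondCountableTopology F]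
  [SigmaFinite (volume : Measure F)] {U : Set ((ℝ × ℝ) × F)}

/-- The measure `r dr dz`. -/
noncomputable def radialMeasure (Ω : Set (ℝ × F)) : Measure (ℝ × F) :=
  (volume.restrict Ω).withDensity (fun p => ENNReal.ofReal p.1)

/-- The measure `2π r dr dz`. -/
noncomputable def meridianMeasure (Ω : Set (ℝ × F)) : Measure (ℝ × F) :=
  (volume.restrict Ω).withDensity (fun p => ENNReal.ofReal (2 * Real.pi * p.1))

/-- The measure `dθ`. -/
noncomputable def angleMeasure : Measure ℝ := volume.restrict (Set.Ioo (-Real.pi) Real.pi)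

theorem measurable_ofReal_fst : Measurable fun p : ℝ × F => ENNReal.ofReal p.1 :=
  ENNReal.measurable_ofReal.comp measurable_fst

instance (Ω : Set (ℝ × F)) : SFinite (radialMeasure Ω) := by
  unfold radialMeasure; infer_instance

instance : IsFiniteMeasure angleMeasure := by
  unfold angleMeasure; infer_instance

theorem angleMeasure_univ : angleMeasure Set.univ = ENNReal.ofReal (2 * Real.pi) := by
  rw [angleMeasure, Measure.restrict_apply_univ, Real.volume_Ioo]; congr 1; ring

theorem meridianMeasure_eq (Ω : Set (ℝ × F)) :
    meridianMeasure Ω = angleMeasure Set.univ • radialMeasure Ω := by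
  rw [angleMeasure_univ, radialMeasure, ← withDensity_smul _ measurable_ofReal_fst,
    meridianMeasure]
  congr 1
  ext p
  rw [Pi.smul_apply, smul_eq_mul, ENNReal.ofReal_mul (by positivity)]

theorem radialMeasure_absolutelyContinuous (Ω : Set (ℝ × F)) :
    radialMeasure Ω ≪ volume.restrict Ω := withDensity_absolutelyContinuous _ _

theorem meridianMeasure_absolutelyContinuous (Ω : Set (ℝ × F)) :
    meridianMeasure Ω ≪ volume.restrict Ω := withDensity_absolutelyContinuous _ _

theorem measurable_polarMap : Measurable (polarMap (F := F)) :=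
  contDiff_polarMap.continuous.measurable

/-- Planar polar coordinates with `F` carried along; Tonelli brings the integrals over the angle and
over `F` into the same order. -/
theorem measurePreserving_polarMap_univ :
    MeasurePreserving (polarMap (F := F)) ((radialMeasure {p | 0 < p.1}).prod angleMeasure)
      volume := by
  refine ⟨measurable_polarMap, Measure.ext_of_lintegral _ fun f hf => ?_⟩
  have hS : {p : ℝ × F | 0 < p.1} = Set.Ioi 0 ×ˢ Set.univ := by ext p; simp
  rw [lintegral_map hf measurable_polarMap]
  have hfp : Measurable fun q : (ℝ × F) × ℝ => f (polarMap q) := hf.comp measurable_polarMap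
  rw [lintegral_prod _ hfp.aemeasurable, radialMeasure,
    lintegral_withDensity_eq_lintegral_mul _ measurable_ofReal_fst hfp.lintegral_prod_right',
    hS, Measure.volume_eq_prod ℝ F, ← Measure.prod_restrict, Measure.restrict_univ,
    lintegral_prod _ (measurable_ofReal_fst.mul hfp.lintegral_prod_right').aemeasurable,
    Measure.volume_eq_prod (ℝ × ℝ) F, lintegral_prod _ hf.aemeasurable,
    ← lintegral_comp_polarCoord_symm]
  have hT : polarCoord.target = Set.Ioi (0 : ℝ) ×ˢ Set.Ioo (-Real.pi) Real.pi := rfl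
  have hm : Measurable fun p : ℝ × ℝ => ENNReal.ofReal p.1 •
      ∫⁻ y : F, f (polarCoord.symm p, y) := by
    refine (ENNReal.measurable_ofReal.comp measurable_fst).mul ?_
    exact Measurable.lintegral_prod_right' (f := fun q : (ℝ × ℝ) × F => f (polarCoord.symm q.1, q.2))
      (hf.comp ((continuous_polarCoord_symm.measurable.comp measurable_fst).prodMk measurable_snd))
  rw [hT, Measure.volume_eq_prod ℝ ℝ, ← Measure.prod_restrict, lintegral_prod _ hm.aemeasurable]
  refine lintegral_congr fun r => ?_
  have h1 : Measurable fun q : F × ℝ => f (polarMap ((r, q.1), q.2)) :=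
    hfp.comp (by fun_prop)
  simp only [Pi.mul_apply, smul_eq_mul]
  rw [lintegral_const_mul _ h1.lintegral_prod_right', lintegral_const_mul,
    lintegral_lintegral_swap h1.aemeasurable]
  · congr 1
    refine lintegral_congr fun θ => lintegral_congr fun z => ?_
    simp [polarMap, polarLin_apply, polarCoord_symm_apply, mul_comm]
  · refine Measurable.lintegral_prod_right' (f := fun q : ℝ × F => f (polarCoord.symm (r, q.1), q.2))
      (hf.comp ?_)
    exact (continuous_polarCoord_symm.measurable.comp (by fun_prop)).prodMk measurable_snd

theorem ae_fst_pos (Ω : Set (ℝ × F)) (hΩ : ∀ p ∈ Ω, 0 < p.1) (hm : MeasurableSet Ω) :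
    ∀ᵐ p ∂radialMeasure Ω, 0 < p.1 := by
  refine (radialMeasure_absolutelyContinuous Ω).ae_le ?_
  filter_upwards [ae_restrict_mem hm] with p hp
  exact hΩ p hp

theorem ae_prod_fst_pos (Ω : Set (ℝ × F)) (hΩ : ∀ p ∈ Ω, 0 < p.1) (hm : MeasurableSet Ω) :
    ∀ᵐ q ∂(radialMeasure Ω).prod angleMeasure, 0 < q.1.1 :=
  Measure.quasiMeasurePreserving_fst.ae (ae_fst_pos Ω hΩ hm)

/-- Integration in cylindrical coordinates. -/
theorem measurePreserving_polarMap (hU : IsOpen U) (hr : IsAxisymmetric U) :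
    MeasurePreserving (polarMap (F := F)) ((radialMeasure (meridian U)).prod angleMeasure)
      (volume.restrict (offAxis U)) := by
  have h := (measurePreserving_polarMap_univ (F := F)).restrict_preimage
    (isOpen_offAxis hU).measurableSet
  have hpos : MeasurableSet {p : ℝ × F | 0 < p.1} :=
    (isOpen_lt continuous_const continuous_fst).measurableSet
  have hm := (isOpen_meridian hU).measurableSet
  have e : ((radialMeasure {p : ℝ × F | 0 < p.1}).prod angleMeasure).restrict
      (polarMap ⁻¹' offAxis U) = (radialMeasure (meridian U)).prod angleMeasure := by
    have h1 : polarMap ⁻¹' offAxis U =ᵐ[(radialMeasure {p : ℝ × F | 0 < p.1}).prod angleMeasure]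
        (meridian U ×ˢ (Set.univ : Set ℝ) : Set ((ℝ × F) × ℝ)) := by
      filter_upwards [ae_prod_fst_pos {p : ℝ × F | 0 < p.1} (fun p hp => hp) hpos] with q hq
      refine propext ?_
      change polarMap (q.1, q.2) ∈ offAxis U ↔ q ∈ meridian U ×ˢ Set.univ
      rw [polarMap_mem_iff hr hq]
      simp
    rw [Measure.restrict_congr_set h1, ← Measure.prod_restrict, Measure.restrict_univ]
    congr 1
    rw [radialMeasure, restrict_withDensity hm, Measure.restrict_restrict hm, radialMeasure]
    congr 2
    exact Set.inter_eq_left.2 fun p hp => hp.1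
  rwa [e] at h

theorem ae_meridian_pos (hU : IsOpen U) :
    ∀ᵐ q ∂(radialMeasure (meridian U)).prod angleMeasure, 0 < q.1.1 :=
  ae_prod_fst_pos _ (fun _ hp => hp.1) (isOpen_meridian hU).measurableSet

/-- This gives measurability of lifts of functions that are themselves only almost everywhere
strongly measurable. -/
theorem quasiMeasurePreserving_meridianProj (hU : IsOpen U) (hr : IsAxisymmetric U) :
    Measure.QuasiMeasurePreserving (meridianProj (F := F)) (volume.restrict (offAxis U))
      (volume.restrict (meridian U)) := by
  have hmeas : Measurable (meridianProj (F := F)) := continuous_meridianProj.measurable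
  refine ⟨hmeas, Measure.AbsolutelyContinuous.mk fun s hs hs0 => ?_⟩
  rw [Measure.map_apply hmeas hs, ← (measurePreserving_polarMap hU hr).map_eq,
    Measure.map_apply measurable_polarMap (hmeas hs)]
  have h1 : radialMeasure (meridian U) s = 0 := radialMeasure_absolutelyContinuous _ hs0
  have h2 : ∀ᵐ q ∂(radialMeasure (meridian U)).prod angleMeasure, q.1 ∉ s :=
    Measure.quasiMeasurePreserving_fst.ae (measure_eq_zero_iff_ae_notMem.1 h1)
  rw [measure_eq_zero_iff_ae_notMem]
  filter_upwards [h2, ae_meridian_pos hU] with q hq hpos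
  change meridianProj (polarMap (q.1, q.2)) ∉ s
  rwa [meridianProj_polarMap hpos]

theorem integral_radialMeasure {Ω : Set (ℝ × F)} (hΩ : ∀ p ∈ Ω, 0 < p.1) (hm : MeasurableSet Ω)
    (f : ℝ × F → ℂ) : ∫ p, f p ∂radialMeasure Ω = ∫ p in Ω, p.1 * f p := by
  rw [radialMeasure, integral_withDensity_eq_integral_toReal_smul measurable_ofReal_fst
    (Filter.Eventually.of_forall fun _ => ENNReal.ofReal_lt_top)]
  refine setIntegral_congr_fun hm fun p hp => ?_
  rw [ENNReal.toReal_ofReal (hΩ p hp).le, Complex.real_smul]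

theorem integral_angleMeasure (f : ℝ → ℂ) :
    ∫ θ, f θ ∂angleMeasure = ∫ θ in (-Real.pi)..Real.pi, f θ := by
  rw [angleMeasure, intervalIntegral.integral_of_le (by linarith [Real.pi_pos]),
    integral_Ioc_eq_integral_Ioo]

theorem integral_offAxis (hU : IsOpen U) (hr : IsAxisymmetric U) {H : (ℝ × ℝ) × F → ℂ}
    (hH : IntegrableOn H (offAxis U)) :
    ∫ x in offAxis U, H x =
      ∫ p in meridian U, p.1 * ∫ θ in (-Real.pi)..Real.pi, H (polarMap (p, θ)) := by
  have hmp := measurePreserving_polarMap hU hr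
  have h1 : Integrable (fun q => H (polarMap q)) ((radialMeasure (meridian U)).prod angleMeasure) :=
    (hmp.integrable_comp hH.aestronglyMeasurable).2 hH
  have h2 : ∫ x in offAxis U, H x =
      ∫ q, H (polarMap q) ∂(radialMeasure (meridian U)).prod angleMeasure := by
    rw [← hmp.map_eq, integral_map measurable_polarMap.aemeasurable]
    rw [hmp.map_eq]
    exact hH.aestronglyMeasurable
  rw [h2, integral_prod _ h1,
    integral_radialMeasure (fun _ hp => hp.1) (isOpen_meridian hU).measurableSet]
  simp only [integral_angleMeasure]

/-- The lift of a function to the angular mode `n`. -/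
noncomputable def liftFun (n : ℤ) (g : ℝ × F → ℂ) (x : (ℝ × ℝ) × F) : ℂ :=
  mode n x.1 * g (meridianProj x)

theorem liftFun_polarMap (n : ℤ) (g : ℝ × F → ℂ) {p : ℝ × F} (hp : 0 < p.1) (θ : ℝ) :
    liftFun n g (polarMap (p, θ)) = Complex.exp (Complex.I * n * θ) * g p := by
  rw [liftFun, mode_polarMap n hp, meridianProj_polarMap hp]

theorem aestronglyMeasurable_liftFun (hU : IsOpen U) (hr : IsAxisymmetric U) (n : ℤ)
    {g : ℝ × F → ℂ} (hg : AEStronglyMeasurable g (volume.restrict (meridian U))) :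
    AEStronglyMeasurable (liftFun n g) (volume.restrict (offAxis U)) :=
  ((measurable_mode n).comp measurable_fst).aestronglyMeasurable.mul
    (hg.comp_quasiMeasurePreserving (quasiMeasurePreserving_meridianProj hU hr))

theorem integrable_radialMeasure_indicator {g : ℝ × F → ℂ}
    (hg : LocallyIntegrableOn g (meridian U)) {K : Set (ℝ × F)} (hK : IsCompact K)
    (hKU : K ⊆ meridian U) : Integrable (K.indicator g) (radialMeasure (meridian U)) := by
  rw [radialMeasure, integrable_withDensity_iff_integrable_smul' measurable_ofReal_fst
    (Filter.Eventually.of_forall fun _ => ENNReal.ofReal_lt_top)]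
  have h1 : IntegrableOn (fun p => (ENNReal.ofReal p.1).toReal • g p) K := by
    refine (hg.integrableOn_compact_subset hKU hK).continuousOn_smul ?_ hK
    refine continuousOn_fst.congr fun p hp => ENNReal.toReal_ofReal (hKU hp).1.le
  have h2 : (fun p => (ENNReal.ofReal p.1).toReal • K.indicator g p) =
      K.indicator fun p => (ENNReal.ofReal p.1).toReal • g p := by
    ext p
    by_cases hp : p ∈ K <;> simp [hp]
  rw [h2, integrable_indicator_iff hK.measurableSet]
  exact h1.mono_measure Measure.restrict_le_self

/-- A compact set off the axis projects to a compact set in the meridian domain. The lift truncated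
over that projection is, in polar coordinates, a product of a function of `(r, z)` and one of `θ`.
-/
theorem locallyIntegrableOn_liftFun (hU : IsOpen U) (hr : IsAxisymmetric U) (n : ℤ)
    {g : ℝ × F → ℂ} (hg : LocallyIntegrableOn g (meridian U)) :
    LocallyIntegrableOn (liftFun n g) (offAxis U) := by
  have : ProperSpace F := FiniteDimensional.proper ℝ F
  rw [locallyIntegrableOn_iff (isOpen_offAxis hU).isLocallyClosed]
  intro K₀ hK₀ hK₀c
  set K := meridianProj '' K₀ with hKdef
  have hK : IsCompact K := hK₀c.image continuous_meridianProj
  have hKU : K ⊆ meridian U := by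
    rintro _ ⟨x, hx, rfl⟩
    exact meridianProj_mem hr (hK₀ hx)
  have hmp := measurePreserving_polarMap hU hr
  have hKm : MeasurableSet (meridianProj ⁻¹' K : Set ((ℝ × ℝ) × F)) :=
    continuous_meridianProj.measurable hK.measurableSet
  have hmeas : AEStronglyMeasurable ((meridianProj ⁻¹' K).indicator (liftFun n g))
      (volume.restrict (offAxis U)) :=
    (aestronglyMeasurable_liftFun hU hr n hg.aestronglyMeasurable).indicator hKm
  have h1 : Integrable ((meridianProj ⁻¹' K).indicator (liftFun n g))
      (volume.restrict (offAxis U)) := by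
    rw [← hmp.integrable_comp hmeas]
    have h2 : Integrable (fun θ : ℝ => Complex.exp (Complex.I * n * θ)) angleMeasure := by
      refine Integrable.mono' (integrable_const 1)
        (contDiff_expI n).continuous.aestronglyMeasurable (Filter.Eventually.of_forall fun θ => ?_)
      have : Complex.I * (n : ℂ) * θ = ((n * θ : ℝ) : ℂ) * Complex.I := by push_cast; ring
      rw [this, Complex.norm_exp_ofReal_mul_I]
    refine ((integrable_radialMeasure_indicator hg hK hKU).mul_prod h2).congr ?_
    filter_upwards [ae_meridian_pos hU] with q hq
    have h3 : meridianProj (polarMap q) = q.1 := meridianProj_polarMap hq q.2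
    by_cases hqK : q.1 ∈ K
    · rw [Set.indicator_of_mem hqK, Function.comp_apply,
        Set.indicator_of_mem (by rwa [Set.mem_preimage, h3]), mul_comm]
      exact (liftFun_polarMap n g hq q.2).symm
    · rw [Set.indicator_of_notMem hqK, Function.comp_apply,
        Set.indicator_of_notMem (by rwa [Set.mem_preimage, h3]), zero_mul]
  have h4 : IntegrableOn ((meridianProj ⁻¹' K).indicator (liftFun n g)) K₀ :=
    h1.mono_measure (Measure.restrict_mono hK₀ le_rfl)
  refine h4.congr_fun (fun x hx => ?_) hK₀c.measurableSet
  have h5 : x ∈ meridianProj ⁻¹' K := Set.mem_image_of_mem _ hx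
  exact Set.indicator_of_mem h5 (liftFun n g)

/-- The lift of a function represents the lift of its distribution. -/
theorem DistRep.lift (hU : IsOpen U) (hr : IsAxisymmetric U) (n : ℤ) {τ : Dist (meridian U)}
    {g : ℝ × F → ℂ} (h : DistRep τ g) : DistRep (lift hr n τ) (liftFun n g) := by
  have hl := locallyIntegrableOn_liftFun hU hr n h.1
  refine ⟨hl, fun Φ => ?_⟩
  rw [lift_apply, h.2, integral_offAxis hU hr (integrableOn_mul_test hl Φ.2)]
  refine setIntegral_congr_fun (isOpen_meridian hU).measurableSet fun p hp => ?_
  rw [angAvgLin_apply hr n Φ hp.1, angInt, mul_left_comm, ← intervalIntegral.integral_const_mul]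
  congr 1
  refine intervalIntegral.integral_congr fun θ _ => ?_
  simp only [liftFun_polarMap n g hp.1]
  ring

/-- The mode has modulus one, and the integral over the angle supplies the `2π` in
`meridianMeasure`. -/
theorem eLpNorm_liftFun (hU : IsOpen U) (hr : IsAxisymmetric U) (n : ℤ) {g : ℝ × F → ℂ}
    (hg : AEStronglyMeasurable g (volume.restrict (meridian U))) :
    eLpNorm (liftFun n g) 2 (volume.restrict (offAxis U)) =
      eLpNorm g 2 (meridianMeasure (meridian U)) := by
  have hmp := measurePreserving_polarMap hU hr
  have hg' : AEStronglyMeasurable g (radialMeasure (meridian U)) :=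
    hg.mono_ac (radialMeasure_absolutelyContinuous _)
  rw [← eLpNorm_comp_measurePreserving (aestronglyMeasurable_liftFun hU hr n hg) hmp,
    meridianMeasure_eq, ← Measure.map_fst_prod, eLpNorm_map_measure _ measurable_fst.aemeasurable]
  · refine eLpNorm_congr_norm_ae ?_
    filter_upwards [ae_meridian_pos hU] with q hq
    have : polarMap q = polarMap (q.1, q.2) := rfl
    simp only [Function.comp_apply, this]
    rw [liftFun, norm_mul, norm_mode, one_mul, meridianProj_polarMap hq]
  · rw [Measure.map_fst_prod]
    exact hg'.smul_measure _

end PolarMeasure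

end AxiSobolev

namespace AxiSobolev

set_option linter.unusedSectionVars false

/-! ### The lift is an isometry -/

section Descent

variable {F : Type} [NormedAddCommGroup F] [NormedSpace ℝ F] [FiniteDimensional ℝ F]
  {U : Set ((ℝ × ℝ) × F)}

/-- The support lies in the image of a compact set of polar coordinates with `r > 0`, a compact set
off the axis, where mode and radius are smooth. -/
theorem IsTestFunction.angExt (hr : IsAxisymmetric U) {φ : ℝ × F → ℂ}
    (hφ : IsTestFunction (meridian U) φ) (n : ℤ) : IsTestFunction (offAxis U) (angExt n φ) := by
  set K : Set ((ℝ × ℝ) × F) := polarMap '' (tsupport φ ×ˢ Set.Icc (-Real.pi) Real.pi) with hKdef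
  have hK : IsCompact K :=
    (hφ.2.isCompact.prod isCompact_Icc).image contDiff_polarMap.continuous
  have hKU : K ⊆ offAxis U := by
    rintro _ ⟨⟨p, θ⟩, ⟨hp, _⟩, rfl⟩
    have := hφ.3 hp
    exact (polarMap_mem_iff hr this.1 θ).2 this
  have hzero : ∀ x, x ∉ K → AxiSobolev.angExt n φ x = 0 := fun x hx => by
    have : φ (meridianProj x) = 0 := by
      refine image_eq_zero_of_notMem_tsupport fun h => hx ?_
      exact ⟨(meridianProj x, angle x.1), ⟨h, (Complex.neg_pi_lt_arg _).le, Complex.arg_le_pi _⟩,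
        polarMap_meridianProj x⟩
    rw [AxiSobolev.angExt, this, mul_zero, mul_zero]
  have hsupp : tsupport (AxiSobolev.angExt n φ) ⊆ K :=
    closure_minimal (fun x hx => by_contra fun h => hx (hzero x h)) hK.isClosed
  refine ⟨contDiff_iff_contDiffAt.2 fun x => ?_, hK.of_isClosed_subset (isClosed_tsupport _) hsupp,
    hsupp.trans hKU⟩
  by_cases hx : x.1 = 0
  · have hx' : x ∈ Kᶜ := fun h => (hKU h).2 hx
    refine (contDiffAt_const (c := (0 : ℂ))).congr_of_eventuallyEq ?_
    filter_upwards [hK.isClosed.isOpen_compl.mem_nhds hx'] with y hy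
    exact hzero y hy
  · have h1 : ContDiffAt ℝ ∞ (fun x : (ℝ × ℝ) × F => radius x.1) x :=
      ContDiffAt.comp (g := radius) x (contDiffAt_radius hx) contDiffAt_fst
    have h2 : ContDiffAt ℝ ∞ (fun x : (ℝ × ℝ) × F => mode (-n) x.1) x :=
      ContDiffAt.comp (g := mode (-n)) x (contDiffAt_mode (-n) hx) contDiffAt_fst
    have h3 : ContDiffAt ℝ ∞ (fun x : (ℝ × ℝ) × F => ((2 * Real.pi * radius x.1 : ℝ) : ℂ)) x :=
      ContDiffAt.comp x Complex.ofRealCLM.contDiff.contDiffAt (contDiffAt_const.mul h1)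
    have h4 : ((2 * Real.pi * radius x.1 : ℝ) : ℂ) ≠ 0 := by
      have := radius_pos hx
      have h5 : 2 * Real.pi * radius x.1 ≠ 0 := by positivity
      exact_mod_cast h5
    exact h2.mul ((h3.inv h4).mul
      (ContDiffAt.comp x hφ.contDiff.contDiffAt (h1.prodMk contDiffAt_snd)))

theorem angExt_polarMap (n : ℤ) (φ : ℝ × F → ℂ) {p : ℝ × F} (hp : 0 < p.1) (θ : ℝ) :
    angExt n φ (polarMap (p, θ)) =
      Complex.exp (-(Complex.I * n * θ)) * (((2 * Real.pi * p.1 : ℝ) : ℂ)⁻¹ * φ p) := by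
  have h := meridianProj_polarMap hp θ
  have h' : radius (polarMap (p, θ)).1 = p.1 := congrArg Prod.fst h
  rw [angExt, mode_polarMap _ hp, h, h']
  congr 2
  push_cast
  ring

theorem angAvgLin_angExt (hr : IsAxisymmetric U) (n : ℤ) (φ : testSpace (meridian U)) :
    angAvgLin hr n ⟨angExt n φ.1, IsTestFunction.angExt hr φ.2 n⟩ = φ := by
  refine testSpace_ext fun p hp => ?_
  rw [angAvgLin_apply hr n _ hp.1, angInt]
  have hp0 : (p.1 : ℂ) ≠ 0 := by exact_mod_cast hp.1.ne'
  have hpi : (Real.pi : ℂ) ≠ 0 := by exact_mod_cast Real.pi_ne_zero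
  have : ∀ θ : ℝ, Complex.exp (Complex.I * n * θ) * angExt n φ.1 (polarMap (p, θ)) =
      ((2 * Real.pi * p.1 : ℝ) : ℂ)⁻¹ * φ.1 p := fun θ => by
    rw [angExt_polarMap n φ.1 hp.1, ← mul_assoc, ← Complex.exp_add, add_neg_cancel,
      Complex.exp_zero, one_mul]
  simp only [this, intervalIntegral.integral_const, Complex.real_smul]
  push_cast
  field_simp
  ring

variable [MeasureSpace F] [BorelSpace F] [SecondCountableTopology F]
  [SigmaFinite (volume : Measure F)] [IsLocallyFiniteMeasure (volume : Measure F)]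

/-- On a compact subset of `r > 0` the density `2πr` has a continuous inverse, so it can be divided
out. -/
theorem locallyIntegrableOn_of_memLp (hU : IsOpen U) {g : ℝ × F → ℂ}
    (hg : MemLp g 2 (meridianMeasure (meridian U))) : LocallyIntegrableOn g (meridian U) := by
  have : ProperSpace F := FiniteDimensional.proper ℝ F
  have hm := (isOpen_meridian hU).measurableSet
  have : IsLocallyFiniteMeasure (meridianMeasure (meridian U)) :=
    IsLocallyFiniteMeasure.withDensity_ofReal (f := fun p : ℝ × F => 2 * Real.pi * p.1)
      (by fun_prop)
  have hl := hg.locallyIntegrable (by norm_num)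
  rw [locallyIntegrableOn_iff (isOpen_meridian hU).isLocallyClosed]
  intro K hKU hK
  have h1 : IntegrableOn g K (meridianMeasure (meridian U)) := hl.integrableOn_isCompact hK
  have hd : Measurable fun p : ℝ × F => ENNReal.ofReal (2 * Real.pi * p.1) := by fun_prop
  rw [IntegrableOn, meridianMeasure, restrict_withDensity hK.measurableSet,
    Measure.restrict_restrict hK.measurableSet, Set.inter_eq_left.2 hKU,
    integrable_withDensity_iff_integrable_smul' hd
      (Filter.Eventually.of_forall fun _ => ENNReal.ofReal_lt_top)] at h1
  have h2 : IntegrableOn (fun p : ℝ × F => (2 * Real.pi * p.1)⁻¹ •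
      ((ENNReal.ofReal (2 * Real.pi * p.1)).toReal • g p)) K := by
    refine IntegrableOn.continuousOn_smul h1 ?_ hK
    refine ContinuousOn.inv₀ (by fun_prop) fun p hp => ?_
    have := (hKU hp).1
    positivity
  refine h2.congr_fun (fun p hp => ?_) hK.measurableSet
  have h3 : 0 < 2 * Real.pi * p.1 := by
    have := (hKU hp).1
    positivity
  simp only
  rw [ENNReal.toReal_ofReal h3.le, smul_smul, inv_mul_cancel₀ h3.ne', one_smul]

/-- Cauchy–Schwarz against the constant `1`. -/
theorem enorm_integral_sq_le {α : Type*} [MeasurableSpace α] {ν : Measure α} {f : α → ℂ}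
    (hf : AEStronglyMeasurable f ν) :
    ‖∫ a, f a ∂ν‖ₑ ^ 2 ≤ ν Set.univ * ∫⁻ a, ‖f a‖ₑ ^ 2 ∂ν := by
  have h1 := ENNReal.lintegral_mul_le_Lp_mul_Lq ν (p := 2) (q := 2)
    (by constructor <;> norm_num) hf.enorm (aemeasurable_const (b := (1 : ℝ≥0∞)))
  simp only [Pi.mul_apply, mul_one, ENNReal.one_rpow, lintegral_const, one_mul] at h1
  have h2 : ‖∫ a, f a ∂ν‖ₑ ≤ (∫⁻ a, ‖f a‖ₑ ^ (2 : ℝ) ∂ν) ^ (1 / (2 : ℝ)) *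
      ν Set.univ ^ (1 / (2 : ℝ)) := (enorm_integral_le_lintegral_enorm f).trans h1
  calc ‖∫ a, f a ∂ν‖ₑ ^ 2 ≤ ((∫⁻ a, ‖f a‖ₑ ^ (2 : ℝ) ∂ν) ^ (1 / (2 : ℝ)) *
        ν Set.univ ^ (1 / (2 : ℝ))) ^ 2 := by gcongr
    _ = _ := by
      rw [mul_pow, ← ENNReal.rpow_natCast, ← ENNReal.rpow_natCast, ← ENNReal.rpow_mul,
        ← ENNReal.rpow_mul]
      norm_num
      rw [mul_comm]

theorem eLpNorm_two_sq {α : Type*} [MeasurableSpace α] (ν : Measure α) (f : α → ℂ) :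
    eLpNorm f 2 ν ^ 2 = ∫⁻ a, ‖f a‖ₑ ^ 2 ∂ν := by
  have := eLpNorm_nnreal_pow_eq_lintegral (f := f) (μ := ν) (p := 2) (by norm_num)
  simpa using this

/-- If the lift of a distribution is a square integrable function, then so is the distribution. -/
theorem DistRep.of_lift (hU : IsOpen U) (hr : IsAxisymmetric U) (n : ℤ) {τ : Dist (meridian U)}
    {G : (ℝ × ℝ) × F → ℂ} (h : DistRep (AxiSobolev.lift hr n τ) G)
    (hG : eLpNorm G 2 (volume.restrict (offAxis U)) ≠ ⊤) :
    ∃ g, DistRep τ g ∧ eLpNorm g 2 (meridianMeasure (meridian U)) ^ 2 ≤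
      eLpNorm G 2 (volume.restrict (offAxis U)) ^ 2 := by
  have hmp := measurePreserving_polarMap hU hr
  have hGm : AEStronglyMeasurable G (volume.restrict (offAxis U)) := h.1.aestronglyMeasurable
  have hpi : (Real.pi : ℂ) ≠ 0 := by exact_mod_cast Real.pi_ne_zero
  set f : (ℝ × F) × ℝ → ℂ := fun q =>
    Complex.exp (-(Complex.I * n * q.2)) * G (polarMap q) with hf
  have hfm : AEStronglyMeasurable f ((radialMeasure (meridian U)).prod angleMeasure) := by
    refine AEStronglyMeasurable.mul ?_ (hGm.comp_measurePreserving hmp)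
    exact (by fun_prop : Continuous fun q : (ℝ × F) × ℝ =>
      Complex.exp (-(Complex.I * n * q.2))).aestronglyMeasurable
  have hfn : ∀ q, ‖f q‖ₑ = ‖G (polarMap q)‖ₑ := fun q => by
    have : -(Complex.I * (n : ℂ) * q.2) = ((-(n * q.2) : ℝ) : ℂ) * Complex.I := by
      push_cast; ring
    rw [hf, enorm_mul, this, ← ofReal_norm, Complex.norm_exp_ofReal_mul_I]
    simp
  -- The function `G` is not known to be a lift, so `g` is taken as its Fourier coefficient of index
  -- `n` in the angle; by Cauchy–Schwarz its norm is no larger.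
  set g : ℝ × F → ℂ := fun p => ((2 * Real.pi : ℝ) : ℂ)⁻¹ * ∫ θ, f (p, θ) ∂angleMeasure with hg
  have hgm : AEStronglyMeasurable g (radialMeasure (meridian U)) :=
    aestronglyMeasurable_const.mul hfm.integral_prod_right'
  have hgm' : AEStronglyMeasurable g (meridianMeasure (meridian U)) := by
    rw [meridianMeasure_eq]; exact hgm.smul_measure _
  have hbound : eLpNorm g 2 (meridianMeasure (meridian U)) ^ 2 ≤
      eLpNorm G 2 (volume.restrict (offAxis U)) ^ 2 := by
    rw [eLpNorm_two_sq, eLpNorm_two_sq, meridianMeasure_eq, lintegral_smul_measure,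
      ← hmp.map_eq, lintegral_map' ?_ measurable_polarMap.aemeasurable]
    swap
    · rw [hmp.map_eq]; exact hGm.enorm.pow_const 2
    have hG2 : AEMeasurable (fun q => ‖G (polarMap q)‖ₑ ^ 2)
        ((radialMeasure (meridian U)).prod angleMeasure) :=
      (hGm.comp_measurePreserving hmp).enorm.pow_const 2
    rw [lintegral_prod _ hG2]
    have hT : angleMeasure Set.univ ≠ ⊤ := measure_ne_top _ _
    rw [smul_eq_mul, ← lintegral_const_mul' _ _ hT]
    refine lintegral_mono_ae ?_
    filter_upwards [hfm.prodMk_left] with p hp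
    have h1 := enorm_integral_sq_le hp
    simp only [hfn] at h1
    have h2 : ‖((2 * Real.pi : ℝ) : ℂ)⁻¹‖ₑ = (angleMeasure Set.univ)⁻¹ := by
      rw [angleMeasure_univ, ← ofReal_norm, norm_inv, Complex.norm_real, Real.norm_eq_abs,
        abs_of_pos (by positivity), ENNReal.ofReal_inv_of_pos (by positivity)]
    have h0 : angleMeasure Set.univ ≠ 0 := by
      rw [angleMeasure_univ]
      simpa using Real.pi_pos
    calc angleMeasure Set.univ * ‖g p‖ₑ ^ 2
        = angleMeasure Set.univ * ((angleMeasure Set.univ)⁻¹ ^ 2 *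
            ‖∫ θ, f (p, θ) ∂angleMeasure‖ₑ ^ 2) := by rw [hg, enorm_mul, h2, mul_pow]
      _ ≤ angleMeasure Set.univ * ((angleMeasure Set.univ)⁻¹ ^ 2 *
            (angleMeasure Set.univ * ∫⁻ θ, ‖G (polarMap (p, θ))‖ₑ ^ 2 ∂angleMeasure)) := by
          gcongr
      _ = (angleMeasure Set.univ * (angleMeasure Set.univ)⁻¹) *
            (angleMeasure Set.univ * (angleMeasure Set.univ)⁻¹) *
            ∫⁻ θ, ‖G (polarMap (p, θ))‖ₑ ^ 2 ∂angleMeasure := by ring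
      _ = _ := by rw [ENNReal.mul_inv_cancel h0 hT, one_mul, one_mul]
  have hmem : MemLp g 2 (meridianMeasure (meridian U)) := by
    refine ⟨hgm', ?_⟩
    by_contra hcon
    rw [not_lt, top_le_iff] at hcon
    rw [hcon] at hbound
    simp [top_le_iff, hG] at hbound
  refine ⟨g, ⟨locallyIntegrableOn_of_memLp hU hmem, fun φ => ?_⟩, hbound⟩
  -- Testing against the extension of `φ` isolates this coefficient, since the average of the
  -- extension is `φ` again.
  have h1 := h.2 ⟨angExt n φ.1, IsTestFunction.angExt hr φ.2 n⟩
  rw [lift_apply, angAvgLin_angExt] at h1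
  rw [h1, integral_offAxis hU hr (integrableOn_mul_test h.1 (IsTestFunction.angExt hr φ.2 n))]
  refine setIntegral_congr_fun (isOpen_meridian hU).measurableSet fun p hp => ?_
  have hp0 : (p.1 : ℂ) ≠ 0 := by exact_mod_cast hp.1.ne'
  have h2 : ∀ θ : ℝ, G (polarMap (p, θ)) * angExt n φ.1 (polarMap (p, θ)) =
      (((2 * Real.pi * p.1 : ℝ) : ℂ)⁻¹ * φ.1 p) * f (p, θ) := fun θ => by
    rw [angExt_polarMap n φ.1 hp.1, hf]
    ring
  simp only [h2]
  rw [intervalIntegral.integral_const_mul, hg]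
  simp only [integral_angleMeasure]
  push_cast
  field_simp

/-- The lift is an isometry. -/
theorem distNormSq_lift (hU : IsOpen U) (hr : IsAxisymmetric U) (n : ℤ) (τ : Dist (meridian U)) :
    distNormSq (volume.restrict (offAxis U)) (lift hr n τ) =
      distNormSq (meridianMeasure (meridian U)) τ := by
  apply le_antisymm
  · refine le_distNormSq fun g hg _ => ?_
    rw [← eLpNorm_liftFun hU hr n hg.1.aestronglyMeasurable]
    exact (hg.lift hU hr n).distNormSq_le _
  · refine le_distNormSq fun G hG hG' => ?_
    obtain ⟨g, hg, hle⟩ := hG.of_lift hU hr n hG'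
    exact (hg.distNormSq_le _).trans hle

end Descent

end AxiSobolev

/-! ### The axis is removable -/

namespace AxiSobolev

set_option linter.unusedSectionVars false

section Removable

variable {F : Type} [NormedAddCommGroup F] [NormedSpace ℝ F] {U : Set ((ℝ × ℝ) × F)}

theorem testSpace_offAxis_le (U : Set ((ℝ × ℝ) × F)) : testSpace (offAxis U) ≤ testSpace U :=
  fun _ h => IsTestFunction.mono (fun _ hx => hx.1) h

/-- Restriction of distributions to the complement of the axis. -/
noncomputable def resOffAxis (U : Set ((ℝ × ℝ) × F)) : Dist U →ₗ[ℂ] Dist (offAxis U) :=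
  (Submodule.inclusion (testSpace_offAxis_le U)).dualMap

theorem resOffAxis_apply (τ : Dist U) (φ : testSpace (offAxis U)) :
    resOffAxis U τ φ = τ (Submodule.inclusion (testSpace_offAxis_le U) φ) := rfl

theorem resOffAxis_distDeriv (τ : Dist U) (e : (ℝ × ℝ) × F) :
    resOffAxis U (distDeriv U e τ) = distDeriv (offAxis U) e (resOffAxis U τ) := rfl

/-- A smooth function of two variables that is `1` near the origin. -/
noncomputable def planeBump : ContDiffBump (0 : ℝ × ℝ) := ⟨1, 2, by norm_num, by norm_num⟩

/-- Cutoff functions vanishing near the axis. -/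
noncomputable def axisCutoff (n : ℕ) (x : (ℝ × ℝ) × F) : ℂ :=
  ((1 - planeBump (((n : ℝ) + 1) • x.1) : ℝ) : ℂ)

theorem contDiff_axisCutoff (n : ℕ) : ContDiff ℝ ∞ (axisCutoff (F := F) n) := by
  refine Complex.ofRealCLM.contDiff.comp (contDiff_const.sub ?_)
  exact planeBump.contDiff.comp
    (by fun_prop : ContDiff ℝ ∞ fun x : (ℝ × ℝ) × F => ((n : ℝ) + 1) • x.1)

theorem norm_axisCutoff_le (n : ℕ) (x : (ℝ × ℝ) × F) : ‖axisCutoff n x‖ ≤ 1 := by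
  rw [axisCutoff, Complex.norm_real, Real.norm_eq_abs, abs_of_nonneg]
  · linarith [planeBump.nonneg (x := ((n : ℝ) + 1) • x.1)]
  · linarith [planeBump.le_one (x := ((n : ℝ) + 1) • x.1)]

theorem tendsto_axisCutoff {x : (ℝ × ℝ) × F} (hx : x.1 ≠ 0) :
    Filter.Tendsto (fun n : ℕ => axisCutoff n x) Filter.atTop (nhds 1) := by
  refine tendsto_const_nhds.congr' ?_
  obtain ⟨N, hN⟩ := exists_nat_gt (2 / ‖x.1‖)
  filter_upwards [Filter.eventually_ge_atTop N] with n hn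
  have hpos : 0 < ‖x.1‖ := norm_pos_iff.2 hx
  have h1 : 2 ≤ ‖((n : ℝ) + 1) • x.1‖ := by
    rw [norm_smul, Real.norm_eq_abs, abs_of_nonneg (by positivity)]
    rw [div_lt_iff₀ hpos] at hN
    have : (N : ℝ) ≤ n := by exact_mod_cast hn
    nlinarith
  have h2 : planeBump (((n : ℝ) + 1) • x.1) = 0 :=
    planeBump.zero_of_le_dist (by simpa [planeBump] using h1)
  simp [axisCutoff, h2]

theorem IsTestFunction.axisCutoff_mul {φ : (ℝ × ℝ) × F → ℂ} (hφ : IsTestFunction U φ) (n : ℕ) :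
    IsTestFunction (offAxis U) (fun x => axisCutoff n x * φ x) where
  contDiff := (contDiff_axisCutoff n).mul hφ.contDiff
  hasCompactSupport := hφ.2.mul_left
  tsupport_subset x hx := by
    refine ⟨hφ.3 (tsupport_mul_subset_right hx), fun h0 => ?_⟩
    have h1 : x ∈ tsupport (axisCutoff (F := F) n) := tsupport_mul_subset_left hx
    rw [← not_not (a := x ∈ _), notMem_tsupport_iff_eventuallyEq] at h1
    refine h1 ?_
    have hc : Continuous fun y : (ℝ × ℝ) × F => ((n : ℝ) + 1) • y.1 := by fun_prop
    have h2 : ∀ᶠ y in nhds x, ((n : ℝ) + 1) • y.1 ∈ Metric.closedBall (0 : ℝ × ℝ) 1 :=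
      hc.continuousAt.eventually_mem (by
        rw [h0, smul_zero]; exact Metric.closedBall_mem_nhds _ one_pos)
    filter_upwards [h2] with y hy
    have : planeBump (((n : ℝ) + 1) • y.1) = 1 := planeBump.one_of_mem_closedBall hy
    simp [axisCutoff, this]

/-- Scaling of one bump: the derivative gains a factor `n + 1`, and the outer radius `2` of
`planeBump` shrinks to `2/(n + 1)`. -/
theorem exists_fderiv_axisCutoff_le (e : (ℝ × ℝ) × F) : ∃ C : ℝ, 0 ≤ C ∧
    ∀ (n : ℕ) (x : (ℝ × ℝ) × F), ‖fderiv ℝ (axisCutoff n) x e‖ ≤ C * ((n : ℝ) + 1) ∧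
      (2 / ((n : ℝ) + 1) < ‖x.1‖ → fderiv ℝ (axisCutoff n) x e = 0) := by
  have hb : ContDiff ℝ ∞ (planeBump : ℝ × ℝ → ℝ) := planeBump.contDiff
  obtain ⟨C, hC⟩ := (planeBump.hasCompactSupport.fderiv ℝ).exists_bound_of_continuous
    (hb.continuous_fderiv (by simp))
  have hd : ∀ (n : ℕ) (x : (ℝ × ℝ) × F), fderiv ℝ (axisCutoff n) x e =
      ((-(((n : ℝ) + 1) * fderiv ℝ planeBump (((n : ℝ) + 1) • x.1) e.1) : ℝ) : ℂ) := fun n x => by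
    have h1 : HasFDerivAt (fun y : (ℝ × ℝ) × F => ((n : ℝ) + 1) • y.1)
        (((n : ℝ) + 1) • ContinuousLinearMap.fst ℝ (ℝ × ℝ) F) x :=
      (((n : ℝ) + 1) • ContinuousLinearMap.fst ℝ (ℝ × ℝ) F).hasFDerivAt
    have h2 : HasFDerivAt (planeBump : ℝ × ℝ → ℝ)
        (fderiv ℝ planeBump (((n : ℝ) + 1) • x.1)) (((n : ℝ) + 1) • x.1) :=
      (hb.differentiable (by simp) _).hasFDerivAt
    have h3 : HasFDerivAt (fun y : (ℝ × ℝ) × F => 1 - planeBump (((n : ℝ) + 1) • y.1)) _ x :=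
      (h2.comp x h1).const_sub 1
    have h4 : HasFDerivAt (axisCutoff (F := F) n) _ x := Complex.ofRealCLM.hasFDerivAt.comp x h3
    rw [h4.fderiv]
    simp
  have hC0 : 0 ≤ C := (norm_nonneg _).trans (hC 0)
  refine ⟨C * ‖e.1‖, by positivity, fun n x => ⟨?_, fun hx => ?_⟩⟩
  · rw [hd, Complex.norm_real, norm_neg, norm_mul, Real.norm_eq_abs,
      abs_of_nonneg (by positivity : (0 : ℝ) ≤ (n : ℝ) + 1), mul_comm]
    gcongr
    exact ((fderiv ℝ planeBump _).le_opNorm _).trans (by gcongr; exact hC _)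
  · have h1 : fderiv ℝ planeBump (((n : ℝ) + 1) • x.1) = 0 := by
      refine image_eq_zero_of_notMem_tsupport fun h => ?_
      have h2 := tsupport_fderiv_subset ℝ h
      rw [planeBump.tsupport_eq, Metric.mem_closedBall, dist_zero_right, norm_smul,
        Real.norm_eq_abs, abs_of_nonneg (by positivity : (0 : ℝ) ≤ (n : ℝ) + 1)] at h2
      rw [div_lt_iff₀ (by positivity)] at hx
      have h3 : ((n : ℝ) + 1) * ‖x.1‖ ≤ 2 := h2
      linarith
    rw [hd, h1]
    simp

variable [FiniteDimensional ℝ F] [MeasureSpace F] [BorelSpace F] [SecondCountableTopology F]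
  [SigmaFinite (volume : Measure F)] [IsLocallyFiniteMeasure (volume : Measure F)]

theorem ae_fst_ne_zero : ∀ᵐ x ∂(volume : Measure ((ℝ × ℝ) × F)), x.1 ≠ 0 := by
  have h : ∀ᵐ y ∂(volume : Measure (ℝ × ℝ)), y ≠ 0 := by
    rw [ae_iff]
    simp
  exact Measure.quasiMeasurePreserving_fst.ae h

/-- The axis is a null set, so norms do not see it; the two domains differ only in their test
functions. -/
theorem restrict_offAxis (U : Set ((ℝ × ℝ) × F)) :
    (volume : Measure ((ℝ × ℝ) × F)).restrict (offAxis U) = volume.restrict U := by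
  refine Measure.restrict_congr_set ?_
  filter_upwards [ae_fst_ne_zero] with x hx
  exact propext ⟨fun h => h.1, fun h => ⟨h, hx⟩⟩

theorem locallyIntegrableOn_of_offAxis (hU : IsOpen U) {G : (ℝ × ℝ) × F → ℂ}
    (hG : LocallyIntegrableOn G (offAxis U)) (hG2 : eLpNorm G 2 (volume.restrict U) ≠ ⊤) :
    LocallyIntegrableOn G U := by
  have : ProperSpace F := FiniteDimensional.proper ℝ F
  have hm : AEStronglyMeasurable G (volume.restrict U) := by
    rw [← restrict_offAxis]; exact hG.aestronglyMeasurable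
  have hmem : MemLp G 2 (volume.restrict U) := ⟨hm, lt_top_iff_ne_top.2 hG2⟩
  have hl := hmem.locallyIntegrable (by norm_num)
  rw [locallyIntegrableOn_iff hU.isLocallyClosed]
  intro K hK hKc
  have h1 := hl.integrableOn_isCompact hKc
  rwa [IntegrableOn, Measure.restrict_restrict hKc.measurableSet, Set.inter_eq_left.2 hK] at h1

theorem DistRep.resOffAxis {τ : Dist U} {G : (ℝ × ℝ) × F → ℂ} (h : DistRep τ G) :
    DistRep (resOffAxis U τ) G := by
  refine ⟨h.1.mono_set fun _ hx => hx.1, fun φ => ?_⟩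
  rw [resOffAxis_apply, h.2, restrict_offAxis]
  rfl

theorem distNormSq_resOffAxis_le (τ : Dist U) :
    distNormSq (volume.restrict (offAxis U)) (resOffAxis U τ) ≤
      distNormSq (volume.restrict U) τ := by
  refine le_distNormSq fun G hG _ => ?_
  rw [restrict_offAxis]
  exact hG.resOffAxis.distNormSq_le _

theorem tendsto_integral_cutoff {H : (ℝ × ℝ) × F → ℂ} (hH : IntegrableOn H U) :
    Filter.Tendsto (fun n : ℕ => ∫ x in U, axisCutoff n x * H x) Filter.atTop
      (nhds (∫ x in U, H x)) := by
  refine tendsto_integral_of_dominated_convergence (fun x => ‖H x‖) (fun n => ?_) hH.norm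
    (fun n => Filter.Eventually.of_forall fun x => ?_) ?_
  · exact (contDiff_axisCutoff n).continuous.aestronglyMeasurable.mul hH.aestronglyMeasurable
  · rw [norm_mul]
    exact mul_le_of_le_one_left (norm_nonneg _) (norm_axisCutoff_le n x)
  · filter_upwards [ae_restrict_of_ae ae_fst_ne_zero] with x hx
    simpa using (tendsto_axisCutoff hx).mul_const (H x)

/-- Codimension two enters here. By Cauchy–Schwarz the squared integral is at most a multiple of
`∫_B |G|²` over a tube `B` shrinking to the axis, and this tends to zero because `G` is square
integrable. -/
theorem tendsto_integral_fderiv_cutoff {G φ : (ℝ × ℝ) × F → ℂ}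
    (hG : LocallyIntegrableOn G U) (hG2 : eLpNorm G 2 (volume.restrict U) ≠ ⊤)
    (hφ : IsTestFunction U φ) (e : (ℝ × ℝ) × F) :
    Filter.Tendsto (fun n : ℕ => ∫ x in U, G x * (fderiv ℝ (axisCutoff n) x e * φ x))
      Filter.atTop (nhds 0) := by
  obtain ⟨C, hC0, hC⟩ := exists_fderiv_axisCutoff_le e
  obtain ⟨M, hM⟩ := hφ.2.exists_bound_of_continuous hφ.continuous
  have hM0 : 0 ≤ M := (norm_nonneg _).trans (hM 0)
  set KF : Set F := Prod.snd '' tsupport φ with hKF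
  have hKFc : IsCompact KF := hφ.2.isCompact.image continuous_snd
  set B : ℕ → Set ((ℝ × ℝ) × F) := fun n => Metric.closedBall (0 : ℝ × ℝ) (2 / ((n : ℝ) + 1)) ×ˢ KF
    with hB
  have hBm : ∀ n, MeasurableSet (B n) := fun n =>
    Metric.isClosed_closedBall.measurableSet.prod hKFc.measurableSet
  set V : ℝ≥0∞ := volume (Metric.ball (0 : ℝ × ℝ) 1) * volume KF with hV
  have hVt : V ≠ ⊤ :=
    ENNReal.mul_ne_top (measure_ball_lt_top).ne hKFc.measure_lt_top.ne
  have hBvol : ∀ n, volume (B n) = ENNReal.ofReal ((2 / ((n : ℝ) + 1)) ^ 2) * V := fun n => by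
    rw [hB, Measure.volume_eq_prod, Measure.prod_prod,
      Measure.addHaar_closedBall _ _ (by positivity), hV, mul_assoc]
    simp
  have hGm := hG.aestronglyMeasurable
  have hzero : ∀ n x, x ∉ B n → G x * (fderiv ℝ (axisCutoff n) x e * φ x) = 0 := by
    intro n x hx
    by_cases h1 : x ∈ tsupport φ
    · have h2 : 2 / ((n : ℝ) + 1) < ‖x.1‖ := by
        by_contra h
        exact hx ⟨by simpa using not_lt.1 h, Set.mem_image_of_mem _ h1⟩
      rw [(hC n x).2 h2]; simp
    · rw [image_eq_zero_of_notMem_tsupport h1]; simp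
  -- The factor `(n + 1)²` of the squared gradient cancels the `(n + 1)^{-2}` in the measure of the
  -- tube, so the constant does not depend on `n`.
  have key : ∀ n, ‖∫ x in U, G x * (fderiv ℝ (axisCutoff n) x e * φ x)‖ₑ ^ 2 ≤
      (ENNReal.ofReal ((2 * C * M) ^ 2) * V) * ∫⁻ x in B n, ‖G x‖ₑ ^ 2 ∂volume.restrict U := by
    intro n
    have h1 : ∫ x in U, G x * (fderiv ℝ (axisCutoff n) x e * φ x) =
        ∫ x in B n, G x * (fderiv ℝ (axisCutoff n) x e * φ x) ∂volume.restrict U := by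
      rw [setIntegral_eq_integral_of_forall_compl_eq_zero (fun x hx => hzero n x hx)]
    have hcont : Continuous fun x => fderiv ℝ (axisCutoff (F := F) n) x e * φ x :=
      (((contDiff_axisCutoff n).continuous_fderiv (by simp)).clm_apply continuous_const).mul
        hφ.continuous
    have hm : AEStronglyMeasurable (fun x => G x * (fderiv ℝ (axisCutoff n) x e * φ x))
        ((volume.restrict U).restrict (B n)) :=
      (hGm.mul hcont.aestronglyMeasurable).restrict
    rw [h1]
    refine (enorm_integral_sq_le hm).trans ?_
    have h2 : ∀ x, ‖G x * (fderiv ℝ (axisCutoff n) x e * φ x)‖ₑ ^ 2 ≤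
        ENNReal.ofReal ((C * ((n : ℝ) + 1) * M) ^ 2) * ‖G x‖ₑ ^ 2 := fun x => by
      rw [enorm_mul, mul_pow, mul_comm, ENNReal.ofReal_pow (by positivity)]
      gcongr
      rw [← ofReal_norm, norm_mul]
      exact ENNReal.ofReal_le_ofReal (mul_le_mul (hC n x).1 (hM x) (norm_nonneg _) (by positivity))
    have h3 : ((volume.restrict U).restrict (B n)) Set.univ ≤ volume (B n) := by
      rw [Measure.restrict_apply_univ]
      exact Measure.restrict_apply_le _ _
    calc ((volume.restrict U).restrict (B n)) Set.univ *
          ∫⁻ x in B n, ‖G x * (fderiv ℝ (axisCutoff n) x e * φ x)‖ₑ ^ 2 ∂volume.restrict U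
        ≤ volume (B n) * ∫⁻ x in B n, ENNReal.ofReal ((C * ((n : ℝ) + 1) * M) ^ 2) * ‖G x‖ₑ ^ 2
            ∂volume.restrict U := by
          gcongr with x
          exact h2 x
      _ = _ := by
          rw [lintegral_const_mul' _ _ ENNReal.ofReal_ne_top, hBvol, ← mul_assoc]
          congr 1
          rw [mul_right_comm, ← ENNReal.ofReal_mul (by positivity)]
          congr 2
          field_simp
  have hlim : Filter.Tendsto (fun n => ∫⁻ x in B n, ‖G x‖ₑ ^ 2 ∂volume.restrict U) Filter.atTop
      (nhds 0) := by
    refine tendsto_setLIntegral_zero ?_ ?_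
    · rw [← eLpNorm_two_sq]
      exact ENNReal.pow_ne_top hG2
    · have h1 : Filter.Tendsto (fun n => volume (B n)) Filter.atTop (nhds 0) := by
        simp only [hBvol]
        have h2 : Filter.Tendsto (fun n : ℕ => (2 / ((n : ℝ) + 1)) ^ 2) Filter.atTop (nhds 0) := by
          have h4 : Filter.Tendsto (fun n : ℕ => 2 / ((n : ℝ) + 1)) Filter.atTop (nhds 0) := by
            have := (tendsto_const_div_atTop_nhds_zero_nat (2 : ℝ)).comp
              (Filter.tendsto_add_atTop_nat 1)
            refine this.congr fun n => ?_
            simp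
          have h5 := h4.pow 2
          rwa [zero_pow two_ne_zero] at h5
        have h3 := ENNReal.Tendsto.mul_const (ENNReal.tendsto_ofReal h2) (Or.inr hVt)
        simpa using h3
      exact tendsto_of_tendsto_of_tendsto_of_le_of_le tendsto_const_nhds h1 (fun _ => zero_le)
        fun n => Measure.restrict_apply_le _ _
  have hlim2 : Filter.Tendsto (fun n : ℕ =>
      ‖∫ x in U, G x * (fderiv ℝ (axisCutoff n) x e * φ x)‖ₑ ^ 2) Filter.atTop (nhds 0) := by
    have h1 := ENNReal.Tendsto.const_mul (a := ENNReal.ofReal ((2 * C * M) ^ 2) * V) hlim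
      (Or.inr (ENNReal.mul_ne_top ENNReal.ofReal_ne_top hVt))
    rw [mul_zero] at h1
    exact tendsto_of_tendsto_of_tendsto_of_le_of_le tendsto_const_nhds h1 (fun _ => zero_le) key
  rw [tendsto_zero_iff_norm_tendsto_zero]
  have h3 := (ENNReal.tendsto_toReal (a := 0) (by simp)).comp hlim2
  simp only [ENNReal.toReal_zero, Function.comp_def, ENNReal.toReal_pow, toReal_enorm] at h3
  have h4 := (Real.continuous_sqrt.tendsto 0).comp h3
  simpa [Function.comp_def, Real.sqrt_sq (norm_nonneg _)] using h4

/-- A derivative of a square integrable function that is square integrable off the axis is square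
integrable. -/
theorem distNormSq_distDeriv_le (hU : IsOpen U) {τ : Dist U}
    (hτ : distNormSq (volume.restrict U) τ ≠ ⊤) (e : (ℝ × ℝ) × F) :
    distNormSq (volume.restrict U) (distDeriv U e τ) ≤
      distNormSq (volume.restrict (offAxis U)) (resOffAxis U (distDeriv U e τ)) := by
  obtain ⟨G, hG, hG2⟩ := exists_distRep_of_ne_top hτ
  refine le_distNormSq fun G' hG' hG'2 => ?_
  rw [restrict_offAxis] at hG'2 ⊢
  have hl := locallyIntegrableOn_of_offAxis hU hG'.1 hG'2
  refine DistRep.distNormSq_le (τ := distDeriv U e τ) (g := G') ⟨hl, fun φ => ?_⟩ _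
  have hG'U : IntegrableOn (fun x => G' x * φ.1 x) U := integrableOn_mul_test hl φ.2
  have hGd := integrableOn_mul_test hG.1 (φ.2.fderiv e)
  -- The off-axis identity tested on `χ φ`, with `χ` the cutoff; the product rule isolates the term
  -- in which the derivative falls on `χ`, which vanishes in the limit.
  have step : ∀ n : ℕ, -(∫ x in U, G x * (fderiv ℝ (axisCutoff n) x e * φ.1 x)) -
      (∫ x in U, axisCutoff n x * (G x * fderiv ℝ φ.1 x e)) =
      ∫ x in U, axisCutoff n x * (G' x * φ.1 x) := by
    intro n
    have h1 := hG'.2 ⟨_, φ.2.axisCutoff_mul n⟩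
    rw [resOffAxis_apply, distDeriv_apply, hG.2, restrict_offAxis] at h1
    have h2 : ∀ x, (testDeriv U e (Submodule.inclusion (testSpace_offAxis_le U)
        ⟨_, φ.2.axisCutoff_mul n⟩)).1 x =
        fderiv ℝ (axisCutoff n) x e * φ.1 x + axisCutoff n x * fderiv ℝ φ.1 x e := fun x => by
      change fderiv ℝ (fun x => axisCutoff n x * φ.1 x) x e = _
      rw [fderiv_fun_mul ((contDiff_axisCutoff n).differentiable (by simp) x)
        (φ.2.contDiff.differentiable (by simp) x)]
      simp
      ring
    have i1 : IntegrableOn (fun x => G x * (fderiv ℝ (axisCutoff n) x e * φ.1 x)) U :=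
      integrableOn_mul_test hG.1 (φ.2.mul hU
        (((contDiff_axisCutoff n).fderiv_right (m := ∞) (by simp)).clm_apply
          contDiff_const).contDiffOn)
    have i2 : IntegrableOn (fun x => G x * (axisCutoff n x * fderiv ℝ φ.1 x e)) U :=
      integrableOn_mul_test hG.1 ((φ.2.fderiv e).mul hU (contDiff_axisCutoff n).contDiffOn)
    simp only [h2, mul_add] at h1
    rw [integral_add i1 i2] at h1
    simp only [mul_left_comm (axisCutoff n _)]
    rw [← h1]
    ring
  have lim1 := ((tendsto_integral_fderiv_cutoff hG.1 hG2 φ.2 e).neg.sub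
    (tendsto_integral_cutoff hGd)).congr step
  have lim2 := tendsto_integral_cutoff hG'U
  rw [distDeriv_apply, hG.2, ← tendsto_nhds_unique lim1 lim2]
  simp

end Removable

end AxiSobolev

/-! ### The algebra of radial operators -/

namespace AxiSobolev

set_option linter.unusedSectionVars false

section RadialAlgebra

open Polynomial

variable {V : Type*} [AddCommGroup V] [Module ℂ V] {d M R : Module.End ℂ V}

/-- The operator `r^{-n} p(r ∂_r)`. -/
noncomputable def radOp (d M R : Module.End ℂ V) (n : ℕ) : ℂ[X] →ₗ[ℂ] Module.End ℂ V :=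
  (LinearMap.mulLeft ℂ (M ^ n)).comp (aeval (R * d)).toLinearMap

theorem radOp_apply (n : ℕ) (p : ℂ[X]) : radOp d M R n p = M ^ n * aeval (R * d) p := rfl

/-- The hypothesis is the commutation rule of `M = 1/r` and `d = ∂_r`; the induction extends it to
`r^{-n}`. -/
theorem deriv_mul_pow (h : M * d = d * M + M * M) (n : ℕ) :
    d * M ^ n = M ^ n * d - (n : ℂ) • M ^ (n + 1) := by
  induction n with
  | zero => simp
  | succ n ih =>
    have h' : d * M = M * d - M * M := by rw [h]; abel
    rw [pow_succ, ← mul_assoc, ih, sub_mul, mul_assoc, h', smul_mul_assoc, ← pow_succ, mul_sub,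
      ← mul_assoc, ← mul_assoc, ← pow_succ, ← pow_succ]
    push_cast
    module

theorem mul_radOp (n : ℕ) (p : ℂ[X]) : M * radOp d M R n p = radOp d M R (n + 1) p := by
  rw [radOp_apply, radOp_apply, pow_succ', mul_assoc]

/-- Since `M R = 1`, `r^{-n} ∂_r = r^{-n-1} (r∂_r)`; together with the commutator this gives `∂_r
r^{-n} = r^{-n-1} (r∂_r - n)`. -/
theorem deriv_mul_radOp (h : M * d = d * M + M * M) (hMR : M * R = 1) (n : ℕ) (p : ℂ[X]) :
    d * radOp d M R n p = radOp d M R (n + 1) ((X - C (n : ℂ)) * p) := by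
  have h1 : M ^ (n + 1) * (R * d) = M ^ n * d := by
    rw [pow_succ, mul_assoc, ← mul_assoc M, hMR, one_mul]
  rw [radOp_apply, radOp_apply, ← mul_assoc, deriv_mul_pow h, map_mul, ← mul_assoc, map_sub,
    aeval_X, aeval_C, mul_sub, h1, ← (Algebra.commutes (n : ℂ) (M ^ (n + 1))), ← Algebra.smul_def]

theorem radOp_radPoly (h : M * d = d * M + M * M) (hMR : M * R = 1) (κ ℓ : ℕ) (a : ℕ) :
    radOp d M R (ℓ + a) (radPoly κ ℓ (ℓ + a)) = d ^ a * ((κ : ℂ) ^ ℓ • M ^ ℓ) := by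
  induction a with
  | zero =>
    rw [add_zero, radPoly_self, radOp_apply, aeval_C, ← Algebra.commutes, ← Algebra.smul_def,
      pow_zero, one_mul]
  | succ a ih =>
    rw [← add_assoc, radPoly_succ (by omega), ← deriv_mul_radOp h hMR, ih, pow_succ', mul_assoc]

theorem radOp_axisPoly (h : M * d = d * M + M * M) (hMR : M * R = 1) (κ ℓ : ℕ) (a : ℕ) :
    radOp d M R (κ + 2 * ℓ + a) (axisPoly κ ℓ (κ + 2 * ℓ + a)) =
      d ^ a * ((M * d) ^ ℓ * M ^ κ) := by
  induction a with
  | zero =>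
    rw [add_zero, pow_zero, one_mul, axisPoly_self]
    induction ℓ with
    | zero => simp [radOp_apply]
    | succ ℓ ih =>
      have e : ∏ i ∈ Finset.range (ℓ + 1), (X - C ((κ : ℂ) + 2 * (i : ℂ))) =
          (X - C ((κ + 2 * ℓ : ℕ) : ℂ)) *
            ∏ i ∈ Finset.range ℓ, (X - C ((κ : ℂ) + 2 * (i : ℂ))) := by
        rw [Finset.prod_range_succ, mul_comm]
        push_cast
        rfl
      rw [e, show κ + 2 * (ℓ + 1) = κ + 2 * ℓ + 1 + 1 by ring, ← mul_radOp,
        ← deriv_mul_radOp h hMR, ih, pow_succ']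
      simp only [mul_assoc]
  | succ a ih =>
    rw [← add_assoc, axisPoly_succ (by omega), ← deriv_mul_radOp h hMR, ih, pow_succ', mul_assoc]

/-! ### Homogeneous differential operators of two commuting variables -/

variable {u v : Module.End ℂ V}

/-- A linear form maps each monomial of degree `n` to a combination of two neighbours of degree `n +
1`. -/
theorem homog_step {N : V → ℝ≥0∞} (hN : IsQuadGauge N) (huv : Commute u v) (α β : ℂ)
    (n : ℕ) (f : V) :
    ∑ a ∈ Finset.range (n + 1), N ((α • u + β • v) ((u ^ a * v ^ (n - a)) f)) ≤
      (((n + 1 : ℕ) * (2 * (‖α‖₊ ^ 2 + ‖β‖₊ ^ 2)) : ℝ≥0) : ℝ≥0∞) *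
        ∑ a ∈ Finset.range (n + 1 + 1), N ((u ^ a * v ^ (n + 1 - a)) f) := by
  set S := ∑ a ∈ Finset.range (n + 1 + 1), N ((u ^ a * v ^ (n + 1 - a)) f) with hS
  have hle : ∀ a ≤ n + 1, N ((u ^ a * v ^ (n + 1 - a)) f) ≤ S := fun a ha =>
    Finset.single_le_sum (f := fun a => N ((u ^ a * v ^ (n + 1 - a)) f)) (fun _ _ => zero_le)
      (Finset.mem_range.2 (by omega))
  calc _ ≤ ∑ a ∈ Finset.range (n + 1), ((2 * (‖α‖₊ ^ 2 + ‖β‖₊ ^ 2) : ℝ≥0) : ℝ≥0∞) * S := by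
        refine Finset.sum_le_sum fun a ha => ?_
        have ha' : a < n + 1 := Finset.mem_range.1 ha
        have e1 : (α • u + β • v) ((u ^ a * v ^ (n - a)) f) =
            α • ((u ^ (a + 1) * v ^ (n + 1 - (a + 1))) f) +
              β • ((u ^ a * v ^ (n + 1 - a)) f) := by
          have h1 : u * (u ^ a * v ^ (n - a)) = u ^ (a + 1) * v ^ (n + 1 - (a + 1)) := by
            rw [← mul_assoc, ← pow_succ', Nat.add_sub_add_right]
          have h2 : v * (u ^ a * v ^ (n - a)) = u ^ a * v ^ (n + 1 - a) := by
            rw [← mul_assoc, ← (huv.pow_left a).eq, mul_assoc, ← pow_succ',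
              show n + 1 - a = n - a + 1 by omega]
          rw [LinearMap.add_apply, LinearMap.smul_apply, LinearMap.smul_apply, ← h1, ← h2]
          rfl
        rw [e1]
        refine (hN.add_le _ _).trans ?_
        calc _ ≤ 2 * ((‖α‖₊ : ℝ≥0∞) ^ 2 * S + (‖β‖₊ : ℝ≥0∞) ^ 2 * S) := by
              gcongr
              · refine (hN.smul_le_of_le le_rfl _).trans ?_
                gcongr
                exact hle _ (by omega)
              · refine (hN.smul_le_of_le le_rfl _).trans ?_
                gcongr
                exact hle _ (by omega)
          _ = _ := by push_cast; ring
    _ = _ := by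
        rw [Finset.sum_const, Finset.card_range, nsmul_eq_mul]
        push_cast
        ring

/-- A homogeneous polynomial in linear forms of two commuting operators is controlled by the
monomials. -/
theorem exists_homog_le (α β γ δ : ℂ) (i l : ℕ) : ∃ K : ℝ≥0, ∀ {V : Type} [AddCommGroup V]
    [Module ℂ V] (u v : Module.End ℂ V) (N : V → ℝ≥0∞), Commute u v → IsQuadGauge N → ∀ f : V,
      N (((α • u + β • v) ^ i * (γ • u + δ • v) ^ l) f) ≤
        K * ∑ a ∈ Finset.range (i + l + 1), N ((u ^ a * v ^ (i + l - a)) f) := by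
  induction i with
  | zero =>
    induction l with
    | zero => exact ⟨1, fun u v N _ _ f => by simp⟩
    | succ l ih =>
      obtain ⟨K, hK⟩ := ih
      refine ⟨K * ((l + 1 : ℕ) * (2 * (‖γ‖₊ ^ 2 + ‖δ‖₊ ^ 2))), fun u v N huv hN f => ?_⟩
      -- The outermost factor is absorbed into the gauge, so the constant depends only on
      -- coefficients and exponents and serves all domains at once.
      have h1 := hK u v _ huv (hN.comp (γ • u + δ • v)) f
      simp only [zero_add, pow_zero, one_mul] at h1 ⊢
      rw [pow_succ']
      refine h1.trans ?_
      rw [ENNReal.coe_mul, mul_assoc]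
      gcongr
      exact homog_step hN huv γ δ l f
  | succ i ih =>
    obtain ⟨K, hK⟩ := ih
    refine ⟨K * ((i + l + 1 : ℕ) * (2 * (‖α‖₊ ^ 2 + ‖β‖₊ ^ 2))), fun u v N huv hN f => ?_⟩
    have h1 := hK u v _ huv (hN.comp (α • u + β • v)) f
    rw [pow_succ', mul_assoc, show i + 1 + l = i + l + 1 by omega]
    refine h1.trans ?_
    rw [ENNReal.coe_mul, mul_assoc]
    gcongr
    exact homog_step hN huv α β (i + l) f

end RadialAlgebra

/-! ### Radial operators on the meridian domain -/

section Meridian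

open Polynomial

variable {F : Type} [NormedAddCommGroup F] [NormedSpace ℝ F] [FiniteDimensional ℝ F]
  {U : Set ((ℝ × ℝ) × F)}

/-- The radial derivative on the meridian domain. -/
noncomputable abbrev distRad (U : Set ((ℝ × ℝ) × F)) : Module.End ℂ (Dist (meridian U)) :=
  distDeriv (meridian U) (1, 0)

/-- A derivative along the axis on the meridian domain. -/
noncomputable abbrev distAx (U : Set ((ℝ × ℝ) × F)) (v : F) : Module.End ℂ (Dist (meridian U)) :=
  distDeriv (meridian U) (0, v)

theorem distInvR_mul_distR (hU : IsOpen U) : distInvR hU * distR hU = 1 := by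
  ext τ φ
  change τ _ = τ φ
  congr 1
  refine testSpace_ext fun p hp => ?_
  have hp0 : (p.1 : ℂ) ≠ 0 := by exact_mod_cast hp.1.ne'
  simp only [testMul_apply]
  push_cast
  field_simp

theorem fderiv_inv_fst {p : ℝ × F} (hp : 0 < p.1) (e : ℝ × F) :
    fderiv ℝ (fun p : ℝ × F => ((p.1⁻¹ : ℝ) : ℂ)) p e = -(e.1 * ((p.1 : ℂ)⁻¹ * (p.1 : ℂ)⁻¹)) := by
  have h1 : HasFDerivAt (fun p : ℝ × F => p.1⁻¹)
      ((-(p.1 ^ 2)⁻¹) • ContinuousLinearMap.fst ℝ ℝ F) p :=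
    (hasDerivAt_inv hp.ne').comp_hasFDerivAt p hasFDerivAt_fst
  have h2 : HasFDerivAt (fun p : ℝ × F => ((p.1⁻¹ : ℝ) : ℂ)) _ p :=
    Complex.ofRealCLM.hasFDerivAt.comp p h1
  rw [h2.fderiv]
  simp
  ring

/-- The derivative of `1/r` in direction `e` is `-e.1/r²`. Radial `e` gives the commutation rule of
the algebra above; axial `e` gives commutation. -/
theorem distInvR_mul_distDeriv (hU : IsOpen U) (e : ℝ × F) :
    distInvR hU * distDeriv (meridian U) e =
      distDeriv (meridian U) e * distInvR hU + (e.1 : ℂ) • (distInvR hU * distInvR hU) := by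
  ext τ φ
  set Mt := testMul (isOpen_meridian hU) (contDiffOn_inv_fst (U := U))
  change -τ (testDeriv (meridian U) e (Mt φ)) =
    -τ (Mt (testDeriv (meridian U) e φ)) + (e.1 : ℂ) • τ (Mt (Mt φ))
  rw [← map_neg τ, ← map_neg τ, ← map_smul τ, ← map_add τ]
  congr 1
  refine testSpace_ext fun p hp => ?_
  have h1 := testDeriv_mul (isOpen_meridian hU) (contDiffOn_inv_fst (U := U)) e φ hp
  rw [fderiv_inv_fst hp.1] at h1
  simp only [Submodule.coe_neg, Submodule.coe_add, Submodule.coe_smul, Pi.neg_apply, Pi.add_apply,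
    Pi.smul_apply, smul_eq_mul, Mt, h1, testMul_apply, testDeriv_apply]
  push_cast
  ring

theorem distInvR_mul_distRad (hU : IsOpen U) :
    distInvR hU * distRad U = distRad U * distInvR hU + distInvR hU * distInvR hU := by
  simpa using distInvR_mul_distDeriv hU ((1, 0) : ℝ × F)

theorem commute_distAx_distInvR (hU : IsOpen U) (v : F) : Commute (distAx U v) (distInvR hU) := by
  have h := distInvR_mul_distDeriv hU ((0, v) : ℝ × F)
  simp only [Complex.ofReal_zero, zero_smul, add_zero] at h
  exact h.symm

/-- The operator `r^{-n} p(r ∂_r)` on the meridian domain. -/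
noncomputable abbrev merOp (hU : IsOpen U) (n : ℕ) : ℂ[X] →ₗ[ℂ] Module.End ℂ (Dist (meridian U)) :=
  radOp (distRad U) (distInvR hU) (distR hU) n

/-- The operator `∂_x + i s ∂_y` off the axis. -/
noncomputable def complexDeriv (U : Set ((ℝ × ℝ) × F)) (s : ℤ) :
    Module.End ℂ (Dist (offAxis U)) :=
  distDeriv (offAxis U) ((1, 0), 0) + ((s : ℂ) * Complex.I) • distDeriv (offAxis U) ((0, 1), 0)

/-- The radial derivative contributes the factor `X - j`, and `-sn/r` the scalar `-sn` at the same
order `j + 1`. -/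
theorem complexDeriv_lift_merOp (hU : IsOpen U) (hr : IsAxisymmetric U) (n s : ℤ) (hs : s * s = 1)
    (j : ℕ) (p : ℂ[X]) (f : Dist (meridian U)) :
    complexDeriv U s (lift hr n (merOp hU j p f)) =
      lift hr (n + s) (merOp hU (j + 1) ((X - C ((j : ℂ) + s * n)) * p) f) := by
  have h := cartDeriv_lift hU hr n s hs (merOp hU j p f)
  rw [complexDeriv, LinearMap.add_apply, LinearMap.smul_apply, h]
  congr 1
  have h1 : distRad U (merOp hU j p f) = merOp hU (j + 1) ((X - C (j : ℂ)) * p) f := by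
    rw [← deriv_mul_radOp (distInvR_mul_distRad hU) (distInvR_mul_distR hU)]; rfl
  have h2 : distInvR hU (merOp hU j p f) = merOp hU (j + 1) p f := by
    rw [← mul_radOp]; rfl
  have h3 : (X - C ((j : ℂ) + s * n)) * p = (X - C (j : ℂ)) * p - ((s * n : ℤ) : ℂ) • p := by
    rw [smul_eq_C_mul]
    push_cast
    rw [map_add]
    ring
  rw [h1, h2, h3, map_sub, map_smul]
  rfl

/-- Cartesian derivatives of a lifted distribution. -/
theorem complexDeriv_pow_lift (hU : IsOpen U) (hr : IsAxisymmetric U) (k : ℤ) (a b : ℕ)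
    (f : Dist (meridian U)) :
    (complexDeriv U 1 ^ a * complexDeriv U (-1) ^ b) (lift hr k f) =
      lift hr (k + a - b) (merOp hU (a + b) (cartPoly k a b) f) := by
  induction a with
  | zero =>
    -- The factors of `cartPoly` arise as order plus or minus current mode: `b - (k - b) = 2b - k`
    -- for the second operator, then `(a + b) + (k + a - b) = k + 2a` for the first.
    rw [pow_zero, one_mul]
    induction b with
    | zero => simp [merOp, radOp_apply, cartPoly]
    | succ b ih =>
      rw [pow_succ', Module.End.mul_apply, ih, complexDeriv_lift_merOp hU hr _ _ (by norm_num),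
        cartPoly_succ_right, show 0 + b + 1 = 0 + (b + 1) by ring]
      congr 2
      · push_cast; ring
      · congr 5
        push_cast
        ring
  | succ a ih =>
    rw [pow_succ', mul_assoc, Module.End.mul_apply, ih,
      complexDeriv_lift_merOp hU hr _ _ (by norm_num), cartPoly_succ_left,
      show a + b + 1 = a + 1 + b by ring]
    congr 2
    · push_cast; ring
    · congr 4
      push_cast
      ring

end Meridian

end AxiSobolev

namespace AxiSobolev

set_option linter.unusedSectionVars false

/-! ### Norm estimates off the axis -/

section Generic

variable {F : Type} [NormedAddCommGroup F] [NormedSpace ℝ F] [FiniteDimensional ℝ F]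
  [MeasureSpace F] [BorelSpace F] [SecondCountableTopology F]
  [SigmaFinite (volume : Measure F)] [IsLocallyFiniteMeasure (volume : Measure F)]
  {U : Set ((ℝ × ℝ) × F)}

/-- Squared norm on the meridian domain. -/
noncomputable abbrev merNorm (U : Set ((ℝ × ℝ) × F)) (τ : Dist (meridian U)) : ℝ≥0∞ :=
  distNormSq (meridianMeasure (meridian U)) τ

/-- Squared norm off the axis. -/
noncomputable abbrev offNorm (U : Set ((ℝ × ℝ) × F)) (τ : Dist (offAxis U)) : ℝ≥0∞ :=
  distNormSq (volume.restrict (offAxis U)) τ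

/-- Squared norm on the full domain. -/
noncomputable abbrev fullNorm (U : Set ((ℝ × ℝ) × F)) (τ : Dist U) : ℝ≥0∞ :=
  distNormSq (volume.restrict U) τ

theorem isQuadGauge_merNorm (U : Set ((ℝ × ℝ) × F)) : IsQuadGauge (merNorm U) :=
  isQuadGauge_distNormSq (meridianMeasure_absolutelyContinuous _)

theorem isQuadGauge_offNorm (U : Set ((ℝ × ℝ) × F)) : IsQuadGauge (offNorm U) :=
  isQuadGauge_distNormSq Measure.AbsolutelyContinuous.rfl

/-- The planar derivatives on the full domain. -/
noncomputable abbrev planeDeriv (W : Set ((ℝ × ℝ) × F)) (i l : ℕ) : Module.End ℂ (Dist W) :=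
  distDeriv W ((1, 0), 0) ^ i * distDeriv W ((0, 1), 0) ^ l

/-- The operator `∂_r^a (κ/r)^ℓ`. -/
noncomputable abbrev radTerm (hU : IsOpen U) (κ ℓ a : ℕ) : Module.End ℂ (Dist (meridian U)) :=
  distRad U ^ a * ((κ : ℂ) ^ ℓ • distInvR hU ^ ℓ)

/-- The operator `∂_r^a ((1/r)∂_r)^ℓ (1/r)^κ`. -/
noncomputable abbrev axisTerm (hU : IsOpen U) (κ ℓ a : ℕ) : Module.End ℂ (Dist (meridian U)) :=
  distRad U ^ a * ((distInvR hU * distRad U) ^ ℓ * distInvR hU ^ κ)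

theorem merOp_radPoly (hU : IsOpen U) {κ ℓ n : ℕ} (h : ℓ ≤ n) :
    merOp hU n (radPoly κ ℓ n) = radTerm hU κ ℓ (n - ℓ) := by
  obtain ⟨a, rfl⟩ := Nat.exists_eq_add_of_le h
  rw [Nat.add_sub_cancel_left]
  exact radOp_radPoly (distInvR_mul_distRad hU) (distInvR_mul_distR hU) κ ℓ a

theorem merOp_axisPoly (hU : IsOpen U) {κ ℓ n : ℕ} (h : κ + 2 * ℓ ≤ n) :
    merOp hU n (axisPoly κ ℓ n) = axisTerm hU κ ℓ (n - κ - 2 * ℓ) := by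
  obtain ⟨a, rfl⟩ := Nat.exists_eq_add_of_le h
  rw [show κ + 2 * ℓ + a - κ - 2 * ℓ = a by omega]
  exact radOp_axisPoly (distInvR_mul_distRad hU) (distInvR_mul_distR hU) κ ℓ a

theorem isQuadGauge_merOp (hU : IsOpen U) (n : ℕ) (f : Dist (meridian U)) :
    IsQuadGauge (fun p => merNorm U (merOp hU n p f)) :=
  (isQuadGauge_merNorm U).comp ((LinearMap.applyₗ f).comp (merOp hU n))

theorem merNorm_cartPoly (hU : IsOpen U) (hr : IsAxisymmetric U) (k : ℤ) {a b n : ℕ}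
    (h : a + b = n) (f : Dist (meridian U)) :
    merNorm U (merOp hU n (cartPoly k a b) f) =
      offNorm U ((complexDeriv U 1 ^ a * complexDeriv U (-1) ^ b) (lift hr k f)) := by
  rw [complexDeriv_pow_lift hU hr, offNorm, distNormSq_lift hU hr, h]

theorem commute_planar (W : Set ((ℝ × ℝ) × F)) :
    Commute (distDeriv W ((1, 0), 0)) (distDeriv W ((0, 1), 0)) := distDeriv_comm W _ _

theorem complexDeriv_eq (U : Set ((ℝ × ℝ) × F)) (s : ℤ) : complexDeriv U s =
    (1 : ℂ) • distDeriv (offAxis U) ((1, 0), 0) +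
      ((s : ℂ) * Complex.I) • distDeriv (offAxis U) ((0, 1), 0) := by
  rw [one_smul]; rfl

theorem commute_complexDeriv (U : Set ((ℝ × ℝ) × F)) (s t : ℤ) :
    Commute (complexDeriv U s) (complexDeriv U t) := by
  have h := commute_planar (offAxis U)
  unfold complexDeriv
  exact ((Commute.refl _).add_right (h.smul_right _)).add_left
    ((h.symm.smul_left _).add_right (((Commute.refl _).smul_right _).smul_left _))

theorem derivX_eq (U : Set ((ℝ × ℝ) × F)) : distDeriv (offAxis U) ((1, 0), 0) =
    (1 / 2 : ℂ) • complexDeriv U 1 + (1 / 2 : ℂ) • complexDeriv U (-1) := by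
  unfold complexDeriv
  push_cast
  module

theorem derivY_eq (U : Set ((ℝ × ℝ) × F)) : distDeriv (offAxis U) ((0, 1), 0) =
    (-(Complex.I / 2)) • complexDeriv U 1 + (Complex.I / 2) • complexDeriv U (-1) := by
  unfold complexDeriv
  push_cast
  simp only [smul_add, smul_smul]
  rw [show -(Complex.I / 2) * (1 * Complex.I) = 1 / 2 by
      linear_combination (-1 / 2 : ℂ) * Complex.I_mul_I,
    show Complex.I / 2 * (-1 * Complex.I) = 1 / 2 by
      linear_combination (-1 / 2 : ℂ) * Complex.I_mul_I]
  module

/-- Weighted terms are controlled by Cartesian derivatives off the axis. -/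
theorem exists_weighted_le (F : Type) [NormedAddCommGroup F] [NormedSpace ℝ F]
    [FiniteDimensional ℝ F] [MeasureSpace F] [BorelSpace F] [SecondCountableTopology F]
    [SigmaFinite (volume : Measure F)] [IsLocallyFiniteMeasure (volume : Measure F)] (n : ℕ) :
    ∃ K : ℝ≥0, ∀ (k : ℤ) (U : Set ((ℝ × ℝ) × F)) (hU : IsOpen U) (hr : IsAxisymmetric U)
      (f : Dist (meridian U)),
      (∀ ℓ ≤ k.natAbs, ℓ ≤ n → merNorm U (radTerm hU k.natAbs ℓ (n - ℓ) f) ≤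
        K * ∑ i ∈ Finset.range (n + 1), offNorm U (planeDeriv _ i (n - i) (lift hr k f))) ∧
      (∀ ℓ, k.natAbs + 2 * ℓ ≤ n →
        merNorm U (axisTerm hU k.natAbs ℓ (n - k.natAbs - 2 * ℓ) f) ≤
        K * ∑ i ∈ Finset.range (n + 1), offNorm U (planeDeriv _ i (n - i) (lift hr k f))) := by
  obtain ⟨K, hK⟩ := exists_wt_le_cartSum n
  have h2 := fun a => exists_homog_le 1 (((1 : ℤ) : ℂ) * Complex.I) 1
    (((-1 : ℤ) : ℂ) * Complex.I) a (n - a)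
  choose K' hK' using h2
  refine ⟨K * ∑ a ∈ Finset.range (n + 1), K' a, fun k U hU hr f => ?_⟩
  obtain ⟨hA, hB⟩ := hK k _ (isQuadGauge_merOp hU n f)
  -- By the isometry each Cartesian symbol is a derivative in `∂_x ± i∂_y`, which is then expanded
  -- in `∂_x` and `∂_y`.
  have hcart : cartSum k n (fun p => merNorm U (merOp hU n p f)) ≤
      (∑ a ∈ Finset.range (n + 1), (K' a : ℝ≥0∞)) *
        ∑ i ∈ Finset.range (n + 1), offNorm U (planeDeriv _ i (n - i) (lift hr k f)) := by
    rw [cartSum, Finset.sum_mul]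
    refine Finset.sum_le_sum fun a ha => ?_
    have han : a + (n - a) = n := by rw [Finset.mem_range] at ha; omega
    rw [merNorm_cartPoly hU hr k han, complexDeriv_eq, complexDeriv_eq]
    have h3 := hK' a _ _ (offNorm U) (commute_planar (offAxis U)) (isQuadGauge_offNorm U)
      (lift hr k f)
    rwa [han] at h3
  rw [ENNReal.coe_mul, mul_assoc, ENNReal.ofNNReal_finsetSum]
  refine ⟨fun ℓ h h' => ?_, fun ℓ h => ?_⟩
  · rw [← merOp_radPoly hU h']
    refine (hA ℓ h h').trans ?_
    gcongr
  · rw [← merOp_axisPoly hU h]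
    refine (hB ℓ h).trans ?_
    gcongr

/-- Cartesian derivatives off the axis are controlled by weighted terms. -/
theorem exists_cartesian_le (F : Type) [NormedAddCommGroup F] [NormedSpace ℝ F]
    [FiniteDimensional ℝ F] [MeasureSpace F] [BorelSpace F] [SecondCountableTopology F]
    [SigmaFinite (volume : Measure F)] [IsLocallyFiniteMeasure (volume : Measure F)] (n : ℕ) :
    ∃ K : ℝ≥0, ∀ (k : ℤ) (U : Set ((ℝ × ℝ) × F)) (hU : IsOpen U) (hr : IsAxisymmetric U)
      (f : Dist (meridian U)) (B : ℝ≥0∞),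
      (∀ ℓ ≤ k.natAbs, ℓ ≤ n → merNorm U (radTerm hU k.natAbs ℓ (n - ℓ) f) ≤ B) →
      (∀ ℓ, 1 ≤ ℓ → k.natAbs + 2 * ℓ ≤ n →
        merNorm U (axisTerm hU k.natAbs ℓ (n - k.natAbs - 2 * ℓ) f) ≤ B) →
      ∀ i l, i + l = n → offNorm U (planeDeriv _ i l (lift hr k f)) ≤ K * B := by
  obtain ⟨K, hK⟩ := exists_cart_le_wtSum n
  have h2 := fun i => exists_homog_le (1 / 2) (1 / 2) (-(Complex.I / 2)) (Complex.I / 2) i (n - i)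
  choose K' hK' using h2
  refine ⟨(∑ i ∈ Finset.range (n + 1), K' i) * ((n + 1) * (K * (2 * n + 1))),
    fun k U hU hr f B h1 h2 i l hil => ?_⟩
  have hwt : wtSum k.natAbs n (fun p => merNorm U (merOp hU n p f)) ≤ (2 * n + 1) * B :=
    wtSum_le (fun ℓ h h' => by simpa only [merOp_radPoly hU h'] using h1 ℓ h h')
      (fun ℓ h h' => by simpa only [merOp_axisPoly hU h'] using h2 ℓ h h')
  obtain rfl : l = n - i := by omega
  have hin : i + (n - i) = n := by omega
  have h3 := hK' i _ _ (offNorm U) (commute_complexDeriv U 1 (-1)) (isQuadGauge_offNorm U)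
      (lift hr k f)
  rw [hin] at h3
  -- The reverse expansion, of `∂_x` and `∂_y` in `∂_x ± i∂_y`, whose powers act on lifts through
  -- the Cartesian symbols.
  rw [planeDeriv, derivX_eq, derivY_eq]
  refine h3.trans ?_
  calc (K' i : ℝ≥0∞) * ∑ a ∈ Finset.range (n + 1),
        offNorm U ((complexDeriv U 1 ^ a * complexDeriv U (-1) ^ (n - a)) (lift hr k f))
      ≤ (K' i : ℝ≥0∞) * ∑ a ∈ Finset.range (n + 1), (K : ℝ≥0∞) * ((2 * n + 1) * B) := by
        gcongr with a ha
        rw [← merNorm_cartPoly hU hr k (by rw [Finset.mem_range] at ha; omega : a + (n - a) = n)]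
        refine (hK k _ (isQuadGauge_merOp hU n f) a (n - a)
          (by rw [Finset.mem_range] at ha; omega)).trans ?_
        gcongr
    _ = (K' i : ℝ≥0∞) * ((n + 1) * (K * (2 * n + 1))) * B := by
        rw [Finset.sum_const, Finset.card_range, nsmul_eq_mul]
        push_cast
        ring
    _ ≤ _ := by
        push_cast
        gcongr
        rw [← ENNReal.ofNNReal_finsetSum, ENNReal.coe_le_coe]
        exact Finset.single_le_sum (f := K') (fun _ _ => zero_le)
          (Finset.mem_range.2 (by omega))

/-! ### Passing to the full domain -/

theorem resOffAxis_pow (e : (ℝ × ℝ) × F) (c : ℕ) (τ : Dist U) :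
    resOffAxis U ((distDeriv U e ^ c) τ) = (distDeriv (offAxis U) e ^ c) (resOffAxis U τ) := by
  induction c with
  | zero => rfl
  | succ c ih => rw [pow_succ', pow_succ', Module.End.mul_apply, resOffAxis_distDeriv, ih]; rfl

theorem resOffAxis_planeDeriv (i l : ℕ) (τ : Dist U) :
    resOffAxis U (planeDeriv U i l τ) = planeDeriv (offAxis U) i l (resOffAxis U τ) := by
  rw [planeDeriv, Module.End.mul_apply, resOffAxis_pow, resOffAxis_pow]; rfl

theorem lift_distAx_pow (hr : IsAxisymmetric U) (k : ℤ) (v : F) (c : ℕ) (f : Dist (meridian U)) :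
    lift hr k ((distAx U v ^ c) f) = (distDeriv (offAxis U) ((0, 0), v) ^ c) (lift hr k f) := by
  induction c with
  | zero => rfl
  | succ c ih =>
    rw [pow_succ', pow_succ', Module.End.mul_apply, Module.End.mul_apply, ← ih,
      distDeriv_axial_lift]

/-- A distribution that is a function on the full domain has the same norm off the axis. -/
theorem DistRep.fullNorm_le (hU : IsOpen U) {τ : Dist U} {g : (ℝ × ℝ) × F → ℂ}
    (h : DistRep τ g) : fullNorm U τ ≤ offNorm U (AxiSobolev.resOffAxis U τ) := by
  refine le_distNormSq fun G hG hG2 => ?_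
  rw [restrict_offAxis] at hG2 ⊢
  have hl := locallyIntegrableOn_of_offAxis hU hG.1 hG2
  refine DistRep.distNormSq_le (τ := τ) (g := G) ⟨hl, fun φ => ?_⟩ _
  rw [h.2]
  -- Both functions are locally integrable up to the axis and no derivative falls on the cutoff, so
  -- dominated convergence suffices.
  refine tendsto_nhds_unique ((tendsto_integral_cutoff (integrableOn_mul_test h.1 φ.2)).congr
    fun n => ?_) (tendsto_integral_cutoff (integrableOn_mul_test hl φ.2))
  have h1 := hG.2 ⟨_, φ.2.axisCutoff_mul n⟩
  rw [resOffAxis_apply, h.2, restrict_offAxis] at h1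
  simp only [mul_left_comm (axisCutoff n _)]
  exact h1

/-- Crossing the axis with one derivative requires the previous one to be square integrable on the
full domain. The induction supplies this from finiteness off the axis at each lower order. -/
theorem fullNorm_pow_le (hU : IsOpen U) {τ : Dist U} (e : (ℝ × ℝ) × F)
    (hτ : fullNorm U τ ≤ offNorm U (resOffAxis U τ)) (c : ℕ)
    (hfin : ∀ c' ≤ c, offNorm U (resOffAxis U ((distDeriv U e ^ c') τ)) ≠ ⊤) :
    fullNorm U ((distDeriv U e ^ c) τ) ≤ offNorm U (resOffAxis U ((distDeriv U e ^ c) τ)) := by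
  induction c with
  | zero => exact hτ
  | succ c ih =>
    have h1 := ih fun c' hc' => hfin c' (by omega)
    rw [pow_succ', Module.End.mul_apply]
    exact distNormSq_distDeriv_le hU (ne_top_of_le_ne_top (hfin c (by omega)) h1) e

/-- If all derivatives of lower order are square integrable off the axis, then the norm of a
derivative on the full domain is the norm off the axis. -/
theorem fullNorm_deriv_le (hU : IsOpen U) {τ : Dist U} (v : F)
    (hτ : fullNorm U τ ≤ offNorm U (resOffAxis U τ)) (i l c : ℕ)
    (hfin : ∀ i' ≤ i, ∀ l' ≤ l, ∀ c' ≤ c, offNorm U (resOffAxis U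
      (planeDeriv U i' l' ((distDeriv U ((0, 0), v) ^ c') τ))) ≠ ⊤) :
    fullNorm U (planeDeriv U i l ((distDeriv U ((0, 0), v) ^ c) τ)) ≤
      offNorm U (resOffAxis U (planeDeriv U i l ((distDeriv U ((0, 0), v) ^ c) τ))) := by
  -- The derivatives are restored from the innermost outwards: axial, then `y`, then `x`.
  have h1 := fullNorm_pow_le hU ((0, 0), v) hτ c fun c' hc' => by
    simpa [planeDeriv] using hfin 0 (by omega) 0 (by omega) c' hc'
  have h2 := fullNorm_pow_le hU ((0, 1), 0) h1 l fun l' hl' => by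
    simpa [planeDeriv] using hfin 0 (by omega) l' hl' c le_rfl
  exact fullNorm_pow_le hU ((1, 0), 0) h2 i fun i' hi' => by
    simpa [planeDeriv] using hfin i' hi' l le_rfl c le_rfl

end Generic

end AxiSobolev

/-! ### The norms of the individual terms -/

namespace AxiSobolev

set_option linter.unusedSectionVars false

section Terms

variable {F : Type} [NormedAddCommGroup F] [NormedSpace ℝ F] [FiniteDimensional ℝ F]
  [MeasureSpace F] [BorelSpace F] [SecondCountableTopology F]
  [SigmaFinite (volume : Measure F)] [IsLocallyFiniteMeasure (volume : Measure F)]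
  {U : Set ((ℝ × ℝ) × F)}

/-- Squared norm of a Cartesian derivative of the lift of `w`. -/
noncomputable def cartNormSq (k : ℤ) (U : Set ((ℝ × ℝ) × F)) (w : ℝ × F → ℂ) (v : F)
    (i l c : ℕ) : ℝ≥0∞ :=
  normSqL2 (volume.restrict U) U ((pderiv ((1, 0), 0))^[i] ((pderiv ((0, 1), 0))^[l]
    ((pderiv ((0, 0), v))^[c] (ofFun U (liftFun k w)))))

/-- Squared norm of a derivative of `(|k|/r)^ℓ w`. -/
noncomputable def radNormSq (k : ℤ) (Ω : Set (ℝ × F)) (w : ℝ × F → ℂ) (v : F)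
    (ℓ a c : ℕ) : ℝ≥0∞ :=
  normSqL2 (meridianMeasure Ω) Ω ((pderiv (1, 0))^[a] ((pderiv (0, v))^[c]
    (mulBy (fun p => ((k.natAbs : ℝ) / p.1) ^ ℓ) (ofFun Ω w))))

/-- Squared norm of a derivative of `((1/r)∂_r)^ℓ (1/r)^|k| w`. -/
noncomputable def axisNormSq (k : ℤ) (Ω : Set (ℝ × F)) (w : ℝ × F → ℂ) (v : F)
    (ℓ a c : ℕ) : ℝ≥0∞ :=
  normSqL2 (meridianMeasure Ω) Ω ((pderiv (1, 0))^[a] ((pderiv (0, v))^[c]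
    ((fun S => mulBy (fun p => 1 / p.1) (pderiv (1, 0) S))^[ℓ]
      (mulBy (fun p => (1 / p.1) ^ k.natAbs) (ofFun Ω w)))))

theorem Agrees.mulBy_div_pow (hU : IsOpen U) {T : Functional (ℝ × F)} {τ : Dist (meridian U)}
    (h : Agrees T τ) (c : ℝ) (ℓ : ℕ) :
    Agrees (AxiSobolev.mulBy (fun p => (c / p.1) ^ ℓ) T) (((c : ℂ) ^ ℓ • distInvR hU ^ ℓ) τ) := by
  induction ℓ with
  | zero =>
    intro φ
    simpa [AxiSobolev.mulBy] using h φ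
  | succ ℓ ih =>
    have e : AxiSobolev.mulBy (fun p : ℝ × F => (c / p.1) ^ (ℓ + 1)) T =
        AxiSobolev.mulBy (fun p => c / p.1) (AxiSobolev.mulBy (fun p => (c / p.1) ^ ℓ) T) := by
      funext φ
      simp only [AxiSobolev.mulBy]
      congr 1
      funext p
      push_cast
      ring
    have h1 := ih.mulBy (a := fun p => c / p.1) (isOpen_meridian hU) contDiffOn_inv_fst (c : ℂ)
      (fun p _ => by push_cast; rw [div_eq_mul_inv])
    rw [e]
    convert h1 using 1
    rw [pow_succ', pow_succ' (distInvR hU), LinearMap.smul_apply, LinearMap.smul_apply, map_smul,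
      smul_smul]
    rfl

theorem Agrees.iterate_inv_deriv (hU : IsOpen U) {T : Functional (ℝ × F)} {τ : Dist (meridian U)}
    (h : Agrees T τ) (ℓ : ℕ) :
    Agrees ((fun S => AxiSobolev.mulBy (fun p : ℝ × F => 1 / p.1)
      (AxiSobolev.pderiv (1, 0) S))^[ℓ] T) (((distInvR hU * distRad U) ^ ℓ) τ) := by
  induction ℓ with
  | zero => exact h
  | succ ℓ ih =>
    rw [Function.iterate_succ_apply', pow_succ']
    have h1 := (ih.pderiv (1, 0)).mulBy (a := fun p => 1 / p.1) (isOpen_meridian hU)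
      contDiffOn_inv_fst 1 (fun p _ => by push_cast; rw [one_div, one_mul])
    rwa [one_smul] at h1

/-- Axial derivatives commute with `1/r`, so they can be moved onto `w`, and the planar estimates
apply to the differentiated distribution. -/
theorem radNormSq_eq (hU : IsOpen U) {w : ℝ × F → ℂ} {σ : Dist (meridian U)}
    (hσ : Agrees (ofFun (meridian U) w) σ) (k : ℤ) (v : F) (ℓ a c : ℕ) :
    radNormSq k (meridian U) w v ℓ a c =
      merNorm U (radTerm hU k.natAbs ℓ a ((distAx U v ^ c) σ)) := by
  rw [radNormSq, (((hσ.mulBy_div_pow hU (k.natAbs : ℝ) ℓ).iterate_pderiv (0, v)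
    c).iterate_pderiv (1, 0) a).normSqL2_eq]
  have h := ((commute_distAx_distInvR hU v).pow_pow c ℓ).smul_right ((k.natAbs : ℂ) ^ ℓ)
  have h1 : (distAx U v ^ c) (((k.natAbs : ℂ) ^ ℓ • distInvR hU ^ ℓ) σ) =
      ((k.natAbs : ℂ) ^ ℓ • distInvR hU ^ ℓ) ((distAx U v ^ c) σ) :=
    LinearMap.congr_fun h.eq σ
  rw [Complex.ofReal_natCast, h1]
  rfl

theorem axisNormSq_eq (hU : IsOpen U) {w : ℝ × F → ℂ} {σ : Dist (meridian U)}
    (hσ : Agrees (ofFun (meridian U) w) σ) (k : ℤ) (v : F) (ℓ a c : ℕ) :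
    axisNormSq k (meridian U) w v ℓ a c =
      merNorm U (axisTerm hU k.natAbs ℓ a ((distAx U v ^ c) σ)) := by
  have h0 := hσ.mulBy_div_pow hU 1 k.natAbs
  simp only [Complex.ofReal_one, one_pow, one_smul] at h0
  rw [axisNormSq, (((h0.iterate_inv_deriv hU ℓ).iterate_pderiv (0, v) c).iterate_pderiv
    (1, 0) a).normSqL2_eq]
  have h1 := commute_distAx_distInvR hU v
  have h2 : Commute (distAx U v) (distRad U) := distDeriv_comm _ _ _
  have h := (((h1.mul_right h2).pow_right ℓ).mul_right (h1.pow_right k.natAbs)).pow_left c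
  have h3 : (distAx U v ^ c) (((distInvR hU * distRad U) ^ ℓ) ((distInvR hU ^ k.natAbs) σ)) =
      ((distInvR hU * distRad U) ^ ℓ * distInvR hU ^ k.natAbs) ((distAx U v ^ c) σ) :=
    LinearMap.congr_fun h.eq σ
  rw [h3]
  rfl

theorem cartNormSq_eq {w : ℝ × F → ℂ} {k : ℤ} {τ : Dist U}
    (hτ : Agrees (ofFun U (liftFun k w)) τ) (v : F) (i l c : ℕ) :
    cartNormSq k U w v i l c =
      fullNorm U (planeDeriv U i l ((distDeriv U ((0, 0), v) ^ c) τ)) := by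
  rw [cartNormSq, (((hτ.iterate_pderiv ((0, 0), v) c).iterate_pderiv ((0, 1), 0) l).iterate_pderiv
    ((1, 0), 0) i).normSqL2_eq]
  rfl

theorem locallyIntegrableOn_liftFun_of_memLp (hU : IsOpen U) (hr : IsAxisymmetric U)
    {w : ℝ × F → ℂ} (hw : MemLp w 2 (meridianMeasure (meridian U))) (k : ℤ) :
    LocallyIntegrableOn (liftFun k w) U := by
  have hl := locallyIntegrableOn_of_memLp hU hw
  refine locallyIntegrableOn_of_offAxis hU (locallyIntegrableOn_liftFun hU hr k hl) ?_
  rw [← restrict_offAxis, eLpNorm_liftFun hU hr k hl.aestronglyMeasurable]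
  exact hw.2.ne

/-- Square integrability makes both `w` and its lift distributions; they are related only off the
axis, and the last clause records that the undifferentiated lift gains nothing there. -/
theorem exists_dist_of_memLp (hU : IsOpen U) (hr : IsAxisymmetric U)
    {w : ℝ × F → ℂ} (hw : MemLp w 2 (meridianMeasure (meridian U))) (k : ℤ) :
    ∃ (σ : Dist (meridian U)) (τ : Dist U), Agrees (ofFun (meridian U) w) σ ∧
      Agrees (ofFun U (liftFun k w)) τ ∧ resOffAxis U τ = lift hr k σ ∧
      fullNorm U τ ≤ offNorm U (resOffAxis U τ) := by
  obtain ⟨σ, hσ, hσw⟩ := exists_agrees_ofFun (locallyIntegrableOn_of_memLp hU hw)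
  obtain ⟨τ, hτ, hτw⟩ := exists_agrees_ofFun (locallyIntegrableOn_liftFun_of_memLp hU hr hw k)
  refine ⟨σ, τ, hσ, hτ, ?_, hτw.fullNorm_le hU⟩
  ext φ
  rw [hτw.resOffAxis.2, (hσw.lift hU hr k).2]

theorem resOffAxis_deriv_eq (hr : IsAxisymmetric U) {k : ℤ} {τ : Dist U} {σ : Dist (meridian U)}
    (h : resOffAxis U τ = lift hr k σ) (v : F) (i l c : ℕ) :
    resOffAxis U (planeDeriv U i l ((distDeriv U ((0, 0), v) ^ c) τ)) =
      planeDeriv (offAxis U) i l (lift hr k ((distAx U v ^ c) σ)) := by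
  rw [resOffAxis_planeDeriv, resOffAxis_pow, h, lift_distAx_pow]

/-- The weighted terms are controlled by the Cartesian derivatives. -/
theorem exists_weighted_le_cartNormSq (v : F) (n : ℕ) :
    ∃ K : ℝ≥0, ∀ (k : ℤ) (U : Set ((ℝ × ℝ) × F)), IsOpen U → IsAxisymmetric U →
      ∀ w : ℝ × F → ℂ, MemLp w 2 (meridianMeasure (meridian U)) → ∀ c : ℕ,
      (∀ ℓ ≤ k.natAbs, ℓ ≤ n → radNormSq k (meridian U) w v ℓ (n - ℓ) c ≤
        K * ∑ i ∈ Finset.range (n + 1), cartNormSq k U w v i (n - i) c) ∧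
      (∀ ℓ, k.natAbs + 2 * ℓ ≤ n →
        axisNormSq k (meridian U) w v ℓ (n - k.natAbs - 2 * ℓ) c ≤
        K * ∑ i ∈ Finset.range (n + 1), cartNormSq k U w v i (n - i) c) := by
  obtain ⟨K, hK⟩ := exists_weighted_le F n
  refine ⟨K, fun k U hU hr w hw c => ?_⟩
  obtain ⟨σ, τ, hσ, hτ, hres, -⟩ := exists_dist_of_memLp hU hr hw k
  have h := hK k U hU hr ((distAx U v ^ c) σ)
  have hsum : ∑ i ∈ Finset.range (n + 1),
      offNorm U (planeDeriv _ i (n - i) (lift hr k ((distAx U v ^ c) σ))) ≤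
      ∑ i ∈ Finset.range (n + 1), cartNormSq k U w v i (n - i) c :=
    Finset.sum_le_sum fun i _ => by
      rw [cartNormSq_eq hτ, ← resOffAxis_deriv_eq hr hres]
      exact distNormSq_resOffAxis_le _
  refine ⟨fun ℓ h1 h2 => ?_, fun ℓ h1 => ?_⟩
  · rw [radNormSq_eq hU hσ]
    exact (h.1 ℓ h1 h2).trans (by gcongr)
  · rw [axisNormSq_eq hU hσ]
    exact (h.2 ℓ h1).trans (by gcongr)

/-- The Cartesian derivatives are controlled by the weighted terms. -/
theorem exists_cartNormSq_le_weighted (v : F) (m : ℕ) :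
    ∃ K : ℝ≥0, ∀ (k : ℤ) (U : Set ((ℝ × ℝ) × F)), IsOpen U → IsAxisymmetric U →
      ∀ w : ℝ × F → ℂ, MemLp w 2 (meridianMeasure (meridian U)) → ∀ (cmax : ℕ) (B : ℝ≥0∞), B ≠ ⊤ →
      (∀ n c, c ≤ cmax → n + c ≤ m → ∀ ℓ ≤ k.natAbs, ℓ ≤ n →
        radNormSq k (meridian U) w v ℓ (n - ℓ) c ≤ B) →
      (∀ n c, c ≤ cmax → n + c ≤ m → ∀ ℓ, 1 ≤ ℓ → k.natAbs + 2 * ℓ ≤ n →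
        axisNormSq k (meridian U) w v ℓ (n - k.natAbs - 2 * ℓ) c ≤ B) →
      ∀ i l c, c ≤ cmax → i + l + c ≤ m → cartNormSq k U w v i l c ≤ K * B := by
  choose K hK using exists_cartesian_le F
  refine ⟨∑ n ∈ Finset.range (m + 1), K n, fun k U hU hr w hw cmax B hB h1 h2 => ?_⟩
  obtain ⟨σ, τ, hσ, hτ, hres, hfull⟩ := exists_dist_of_memLp hU hr hw k
  -- The estimate off the axis covers all lower orders too. With `B` finite, this is exactly what
  -- passing to the full domain requires.
  have hoff : ∀ i l c, c ≤ cmax → i + l + c ≤ m →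
      offNorm U (resOffAxis U (planeDeriv U i l ((distDeriv U ((0, 0), v) ^ c) τ))) ≤
        ((∑ n ∈ Finset.range (m + 1), K n : ℝ≥0) : ℝ≥0∞) * B := by
    intro i l c hc him
    rw [resOffAxis_deriv_eq hr hres]
    refine (hK (i + l) k U hU hr ((distAx U v ^ c) σ) B (fun ℓ hℓ hℓ' => ?_)
      (fun ℓ hℓ hℓ' => ?_) i l rfl).trans ?_
    · rw [← radNormSq_eq hU hσ]
      exact h1 (i + l) c hc him ℓ hℓ hℓ'
    · rw [← axisNormSq_eq hU hσ]
      exact h2 (i + l) c hc him ℓ hℓ hℓ'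
    · gcongr
      exact Finset.single_le_sum (f := K) (fun _ _ => zero_le)
        (Finset.mem_range.2 (by omega))
  intro i l c hc him
  rw [cartNormSq_eq hτ]
  refine (fullNorm_deriv_le hU v hfull i l c fun i' hi l' hl c' hc' => ?_).trans (hoff i l c hc him)
  exact ne_top_of_le_ne_top (ENNReal.mul_ne_top ENNReal.coe_ne_top hB)
    (hoff i' l' c' (by omega) (by omega))

end Terms

end AxiSobolev

/-! ### Sobolev norms and their terms -/

namespace AxiSobolev

section Count

variable {E : Type} [NormedAddCommGroup E] [NormedSpace ℝ E] [MeasureSpace E]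

/-- The number of multi-indices of length `d` and order at most `m`. -/
def multiIndexCount (d m : ℕ) : ℕ :=
  ∑ j ∈ Finset.range (m + 1), (Finset.piAntidiag (Finset.univ : Finset (Fin d)) j).card

theorem multiIndexCount_mono (d : ℕ) : Monotone (multiIndexCount d) := fun _ _ h =>
  Finset.sum_le_sum_of_subset (Finset.range_mono (by omega))

variable {d : ℕ} {μ : Measure E} {Ω : Set E} {e : Fin d → E} {m : ℕ} {T : Functional E}

theorem normSqL2_multiDeriv_le {α : Fin d → ℕ} (h : ∑ i, α i ≤ m) :
    normSqL2 μ Ω (multiDeriv e α T) ≤ normSqSobolev μ Ω e m T := by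
  have hα : α ∈ Finset.piAntidiag (Finset.univ : Finset (Fin d)) (∑ i, α i) := by simp
  exact (Finset.single_le_sum (f := fun α => normSqL2 μ Ω (multiDeriv e α T))
    (fun _ _ => zero_le) hα).trans
    (Finset.single_le_sum (f := fun j => ∑ α ∈ Finset.piAntidiag (Finset.univ : Finset (Fin d)) j,
      normSqL2 μ Ω (multiDeriv e α T)) (fun _ _ => zero_le) (Finset.mem_range.2 (by omega)))

theorem normSqSobolev_le {B : ℝ≥0∞}
    (h : ∀ α : Fin d → ℕ, ∑ i, α i ≤ m → normSqL2 μ Ω (multiDeriv e α T) ≤ B) :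
    normSqSobolev μ Ω e m T ≤ multiIndexCount d m * B := by
  rw [normSqSobolev, multiIndexCount, Nat.cast_sum, Finset.sum_mul]
  refine Finset.sum_le_sum fun j hj => ?_
  rw [← nsmul_eq_mul]
  refine Finset.sum_le_card_nsmul _ _ _ fun α hα => h α ?_
  simp only [Finset.mem_piAntidiag, Finset.mem_range] at hα hj
  exact hα.1.trans_le (by omega)

variable {r : E → ℝ} {er : E} {k : ℤ} {w : E → ℂ}

theorem radial_term_le_normSqC {ℓ : ℕ} {α : Fin d → ℕ} (hk : ℓ ≤ k.natAbs)
    (h : ℓ + ∑ i, α i ≤ m) :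
    normSqL2 μ Ω (multiDeriv e α (mulBy (fun p => ((k.natAbs : ℝ) / r p) ^ ℓ) (ofFun Ω w))) ≤
      normSqC μ Ω e r er m k w := by
  refine (normSqL2_multiDeriv_le (m := m - ℓ) (by omega)).trans (le_trans ?_ le_self_add)
  exact Finset.single_le_sum (f := fun ℓ => normSqSobolev μ Ω e (m - ℓ)
    (mulBy (fun p => ((k.natAbs : ℝ) / r p) ^ ℓ) (ofFun Ω w))) (fun _ _ => zero_le)
    (Finset.mem_range.2 (by omega))

theorem axis_term_le_normSqC {ℓ : ℕ} {α : Fin d → ℕ} (hℓ : 1 ≤ ℓ)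
    (h : k.natAbs + 2 * ℓ + ∑ i, α i ≤ m) :
    normSqL2 μ Ω (multiDeriv e α ((fun S => mulBy (fun p => 1 / r p) (pderiv er S))^[ℓ]
      (mulBy (fun p => (1 / r p) ^ k.natAbs) (ofFun Ω w)))) ≤ normSqC μ Ω e r er m k w := by
  refine (normSqL2_multiDeriv_le (m := m - k.natAbs - 2 * ℓ) (by omega)).trans
    (le_trans ?_ le_add_self)
  exact Finset.single_le_sum (f := fun ℓ => normSqSobolev μ Ω e (m - k.natAbs - 2 * ℓ)
    ((fun S => mulBy (fun p => 1 / r p) (pderiv er S))^[ℓ]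
      (mulBy (fun p => (1 / r p) ^ k.natAbs) (ofFun Ω w)))) (fun _ _ => zero_le)
    (Finset.mem_Icc.2 ⟨hℓ, by omega⟩)

/-- At most `m + 1` values of `ℓ` occur in the first sum and at most `m` in the second. -/
theorem normSqC_le {B : ℝ≥0∞}
    (h1 : ∀ (ℓ : ℕ) (α : Fin d → ℕ), ℓ ≤ k.natAbs → ℓ + ∑ i, α i ≤ m →
      normSqL2 μ Ω (multiDeriv e α
        (mulBy (fun p => ((k.natAbs : ℝ) / r p) ^ ℓ) (ofFun Ω w))) ≤ B)
    (h2 : ∀ (ℓ : ℕ) (α : Fin d → ℕ), 1 ≤ ℓ → k.natAbs + 2 * ℓ + ∑ i, α i ≤ m →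
      normSqL2 μ Ω (multiDeriv e α ((fun S => mulBy (fun p => 1 / r p) (pderiv er S))^[ℓ]
        (mulBy (fun p => (1 / r p) ^ k.natAbs) (ofFun Ω w)))) ≤ B) :
    normSqC μ Ω e r er m k w ≤ ((2 * m + 1) * multiIndexCount d m : ℕ) * B := by
  have key : ∀ n ≤ m, (multiIndexCount d n : ℝ≥0∞) * B ≤ multiIndexCount d m * B := fun n hn => by
    gcongr
    exact multiIndexCount_mono d hn
  have e : (((2 * m + 1) * multiIndexCount d m : ℕ) : ℝ≥0∞) * B =
      ((m + 1 : ℕ) : ℝ≥0∞) * (multiIndexCount d m * B) + (m : ℝ≥0∞) * (multiIndexCount d m * B) := by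
    push_cast
    ring
  rw [e, normSqC]
  refine add_le_add ?_ ?_
  · refine (Finset.sum_le_card_nsmul _ _ (multiIndexCount d m * B) fun ℓ hℓ => ?_).trans ?_
    · rw [Finset.mem_range] at hℓ
      exact (normSqSobolev_le fun α hα => h1 ℓ α (by omega) (by omega)).trans (key _ (by omega))
    · rw [nsmul_eq_mul, Finset.card_range]
      gcongr
      omega
  · refine (Finset.sum_le_card_nsmul _ _ (multiIndexCount d m * B) fun ℓ hℓ => ?_).trans ?_
    · rw [Finset.mem_Icc] at hℓ
      exact (normSqSobolev_le fun α hα => h2 ℓ α hℓ.1 (by omega)).trans (key _ (by omega))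
    · rw [nsmul_eq_mul, Nat.card_Icc]
      gcongr
      omega

end Count

end AxiSobolev

/-! ### Change of coordinates by a measure preserving linear equivalence -/

namespace AxiSobolev

section Transport

variable {E E' : Type} [NormedAddCommGroup E] [NormedSpace ℝ E]
  [NormedAddCommGroup E'] [NormedSpace ℝ E']

/-- The functionals `T` and `T'` correspond under `L`. -/
def Corresponds (L : E ≃L[ℝ] E') (T : Functional E) (T' : Functional E') : Prop :=
  ∀ φ : E' → ℂ, T (φ ∘ L) = T' φ

variable {L : E ≃L[ℝ] E'} {T : Functional E} {T' : Functional E'}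

theorem Corresponds.symm (h : Corresponds L T T') : Corresponds L.symm T' T := fun φ => by
  rw [← h]
  congr 1
  ext x
  simp

theorem Corresponds.pderiv (h : Corresponds L T T') (e : E) :
    Corresponds L (AxiSobolev.pderiv e T) (AxiSobolev.pderiv (L e) T') := fun φ => by
  simp only [AxiSobolev.pderiv]
  rw [← h]
  congr 2
  ext x
  rw [L.comp_right_fderiv]
  rfl

theorem Corresponds.mulBy (h : Corresponds L T T') (a : E' → ℝ) :
    Corresponds L (AxiSobolev.mulBy (a ∘ L) T) (AxiSobolev.mulBy a T') := fun φ => by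
  simp only [AxiSobolev.mulBy]
  rw [← h]
  rfl

theorem Corresponds.iterate {A : Functional E → Functional E} {A' : Functional E' → Functional E'}
    (hA : ∀ S S', Corresponds L S S' → Corresponds L (A S) (A' S')) (h : Corresponds L T T')
    (n : ℕ) : Corresponds L (A^[n] T) (A'^[n] T') := by
  induction n with
  | zero => exact h
  | succ n ih =>
    rw [Function.iterate_succ_apply', Function.iterate_succ_apply']
    exact hA _ _ ih

theorem Corresponds.iterate_pderiv (h : Corresponds L T T') (e : E) (n : ℕ) :
    Corresponds L ((AxiSobolev.pderiv e)^[n] T) ((AxiSobolev.pderiv (L e))^[n] T') :=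
  Corresponds.iterate (fun _ _ h => h.pderiv e) h n

theorem IsTestFunction.comp_equiv {Ω : Set E} {φ : E → ℂ} (hφ : IsTestFunction Ω φ)
    (M : E' ≃L[ℝ] E) : IsTestFunction (M ⁻¹' Ω) (φ ∘ M) where
  contDiff := hφ.contDiff.comp M.contDiff
  hasCompactSupport := hφ.hasCompactSupport.comp_homeomorph M.toHomeomorph
  tsupport_subset := by
    have h := tsupport_comp_eq_preimage φ M.toHomeomorph
    exact h.subset.trans (Set.preimage_mono hφ.tsupport_subset)

variable [MeasureSpace E] [BorelSpace E] [MeasureSpace E'] [BorelSpace E']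

theorem measurableEmbedding_equiv (L : E ≃L[ℝ] E') : MeasurableEmbedding L :=
  L.toHomeomorph.measurableEmbedding

theorem corresponds_ofFun (hL : MeasurePreserving L (volume : Measure E) volume) (Ω : Set E')
    (f : E' → ℂ) : Corresponds L (ofFun (L ⁻¹' Ω) (f ∘ L)) (ofFun Ω f) := fun φ =>
  hL.setIntegral_preimage_emb (measurableEmbedding_equiv L) (fun x => f x * φ x) Ω

theorem Represents.comp_equiv (hL : MeasurePreserving L (volume : Measure E) volume)
    {Ω : Set E'} {g : E' → ℂ} (h : Corresponds L T T') (hg : Represents Ω T' g) :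
    Represents (L ⁻¹' Ω) T (g ∘ L) := by
  have hemb := measurableEmbedding_equiv L
  refine ⟨fun x hx => ?_, fun φ hφ => ?_⟩
  · obtain ⟨s, hs, hgs⟩ := hg.1 (L x) hx
    refine ⟨L ⁻¹' s, ?_, (hL.integrableOn_comp_preimage hemb).2 hgs⟩
    exact (L.continuous.continuousWithinAt.tendsto_nhdsWithin
      (Set.mapsTo_preimage L Ω)).eventually_mem hs
  · have e : (φ ∘ L.symm) ∘ L = φ := by
      ext x
      simp
    have hφ' : IsTestFunction Ω (φ ∘ L.symm) := by
      have h1 := hφ.comp_equiv L.symm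
      rwa [← Set.preimage_comp, show L ∘ L.symm = id from funext L.apply_symm_apply,
        Set.preimage_id] at h1
    rw [← congrArg T e, h, hg.2 _ hφ', ← hL.setIntegral_preimage_emb hemb]
    simp

/-- Representatives of `T'` are pulled back along `L`; equality then follows by applying the same
bound to the inverse. -/
theorem Corresponds.normSqL2_le (hL : MeasurePreserving L (volume : Measure E) volume)
    {μ : Measure E} {μ' : Measure E'} (hμ : MeasurePreserving L μ μ') {Ω : Set E'}
    (h : Corresponds L T T') : normSqL2 μ (L ⁻¹' Ω) T ≤ normSqL2 μ' Ω T' := by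
  refine le_iInf₂ fun g hg => (iInf₂_le (g ∘ L) (hg.comp_equiv hL h)).trans (le_of_eq ?_)
  rw [← (measurableEmbedding_equiv L).eLpNorm_map_measure, hμ.map_eq]

theorem measurePreserving_symm {μ : Measure E} {μ' : Measure E'} (hμ : MeasurePreserving L μ μ') :
    MeasurePreserving L.symm μ' μ :=
  MeasurePreserving.symm L.toHomeomorph.toMeasurableEquiv hμ

theorem Corresponds.normSqL2_eq (hL : MeasurePreserving L (volume : Measure E) volume)
    {μ : Measure E} {μ' : Measure E'} (hμ : MeasurePreserving L μ μ') {Ω : Set E'}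
    (h : Corresponds L T T') : normSqL2 μ (L ⁻¹' Ω) T = normSqL2 μ' Ω T' := by
  refine le_antisymm (h.normSqL2_le hL hμ) ?_
  have h1 := h.symm.normSqL2_le (measurePreserving_symm hL) (measurePreserving_symm hμ)
    (Ω := L ⁻¹' Ω)
  rwa [← Set.preimage_comp, show L ∘ L.symm = id from funext L.apply_symm_apply,
    Set.preimage_id] at h1

theorem measurePreserving_withDensity (hL : MeasurePreserving L (volume : Measure E) volume)
    (Ω : Set E') {f : E' → ℝ≥0∞} (hf : Measurable f) :
    MeasurePreserving L ((volume.restrict (L ⁻¹' Ω)).withDensity (f ∘ L))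
      ((volume.restrict Ω).withDensity f) := by
  have hr := hL.restrict_preimage_emb (measurableEmbedding_equiv L) Ω
  refine ⟨hL.measurable, ?_⟩
  ext s hs
  rw [Measure.map_apply hL.measurable hs, withDensity_apply _ (hL.measurable hs),
    withDensity_apply _ hs, ← hr.map_eq, Measure.restrict_map hL.measurable hs,
    lintegral_map hf hL.measurable]
  rfl

end Transport

/-! ### The plane as a product with a point -/

section PUnit

instance : IsFiniteMeasure (volume : Measure PUnit.{1}) :=
  inferInstanceAs (IsFiniteMeasure (Measure.dirac PUnit.unit))

theorem measurePreserving_prodUnique (E : Type) [NormedAddCommGroup E] [NormedSpace ℝ E]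
    [MeasureSpace E] [SigmaFinite (volume : Measure E)] :
    MeasurePreserving (ContinuousLinearEquiv.prodUnique ℝ E PUnit.{1}) volume volume := by
  refine ⟨measurable_fst, ?_⟩
  have h : (volume : Measure (E × PUnit.{1})) = (volume : Measure E).prod (Measure.dirac PUnit.unit) :=
    rfl
  rw [h]
  exact Measure.map_fst_prod.trans (by simp)

end PUnit

end AxiSobolev

/-! ### Equivalence of the norms -/

namespace AxiSobolev

/-- Adding `1` keeps both constants positive and finite after inversion. For `S = ∞` the lower bound
is trivial, so the second estimate is needed only for finite `S`, as the removal of the axis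
requires. -/
theorem exists_equivalence_constants (K₁ K₂ : ℝ≥0) (N M : ℕ) :
    ∃ c C : ℝ≥0, 0 < c ∧ 0 < C ∧ ∀ H S : ℝ≥0∞, S ≤ N * (K₁ * H) →
      (S ≠ ⊤ → H ≤ M * (K₂ * S)) → c * H ≤ S ∧ S ≤ C * H := by
  refine ⟨(M * K₂ + 1)⁻¹, N * K₁ + 1, by positivity, by positivity, fun H S h1 h2 => ⟨?_, ?_⟩⟩
  · by_cases hS : S = ⊤
    · simp [hS]
    rw [ENNReal.coe_inv (by positivity), mul_comm, ← div_eq_mul_inv]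
    refine ENNReal.div_le_of_le_mul ((h2 hS).trans ?_)
    rw [mul_comm S, ← mul_assoc]
    gcongr
    push_cast
    exact le_self_add
  · refine h1.trans ?_
    rw [← mul_assoc]
    gcongr
    push_cast
    exact le_self_add

section Terms

variable {F : Type} [NormedAddCommGroup F] [NormedSpace ℝ F] [FiniteDimensional ℝ F]
  [MeasureSpace F] [BorelSpace F] [SecondCountableTopology F]
  [SigmaFinite (volume : Measure F)] [IsLocallyFiniteMeasure (volume : Measure F)]

/-- The planar order is `ℓ + a` or `|k| + 2ℓ + a`, and order `n` involves `n + 1` Cartesian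
derivatives. The bound `cmax` on axial orders lets the same statement serve the plane, where no
axial derivative is available. -/
theorem exists_weighted_le_of_cartNormSq_le (v : F) (m : ℕ) :
    ∃ K : ℝ≥0, ∀ (k : ℤ) (U : Set ((ℝ × ℝ) × F)), IsOpen U → IsAxisymmetric U →
      ∀ w : ℝ × F → ℂ, MemLp w 2 (meridianMeasure (meridian U)) → ∀ (cmax : ℕ) (H : ℝ≥0∞),
      (∀ i l c, c ≤ cmax → i + l + c ≤ m → cartNormSq k U w v i l c ≤ H) →
      (∀ ℓ a c, c ≤ cmax → ℓ ≤ k.natAbs → ℓ + (a + c) ≤ m →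
        radNormSq k (meridian U) w v ℓ a c ≤ K * H) ∧
      (∀ ℓ a c, c ≤ cmax → k.natAbs + 2 * ℓ + (a + c) ≤ m →
        axisNormSq k (meridian U) w v ℓ a c ≤ K * H) := by
  choose K hK using exists_weighted_le_cartNormSq v
  refine ⟨∑ n ∈ Finset.range (m + 1), K n * (n + 1), fun k U hU hr w hw cmax H h => ?_⟩
  have key : ∀ n c, c ≤ cmax → n + c ≤ m →
      (K n : ℝ≥0∞) * ∑ i ∈ Finset.range (n + 1), cartNormSq k U w v i (n - i) c ≤
        ((∑ n ∈ Finset.range (m + 1), K n * (n + 1) : ℝ≥0) : ℝ≥0∞) * H := by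
    intro n c hc hn
    have h1 : ∑ i ∈ Finset.range (n + 1), cartNormSq k U w v i (n - i) c ≤ (n + 1 : ℕ) * H := by
      refine (Finset.sum_le_card_nsmul _ _ H fun i hi => ?_).trans (by
        rw [nsmul_eq_mul, Finset.card_range])
      rw [Finset.mem_range] at hi
      exact h i (n - i) c hc (by omega)
    have h2 : K n * (n + 1) ≤ ∑ n ∈ Finset.range (m + 1), K n * (n + 1) :=
      Finset.single_le_sum (f := fun n : ℕ => K n * (n + 1)) (fun _ _ => zero_le)
        (Finset.mem_range.2 (by omega))
    calc (K n : ℝ≥0∞) * ∑ i ∈ Finset.range (n + 1), cartNormSq k U w v i (n - i) c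
        ≤ K n * ((n + 1 : ℕ) * H) := by gcongr
      _ = ((K n * (n + 1) : ℝ≥0) : ℝ≥0∞) * H := by
        push_cast
        ring
      _ ≤ _ := by gcongr
  refine ⟨fun ℓ a c hc hℓ h1 => ?_, fun ℓ a c hc h1 => ?_⟩
  · have h2 := (hK (ℓ + a) k U hU hr w hw c).1 ℓ hℓ (by omega)
    rw [Nat.add_sub_cancel_left] at h2
    exact h2.trans (key _ c hc (by omega))
  · have h2 := (hK (k.natAbs + 2 * ℓ + a) k U hU hr w hw c).2 ℓ (by omega)
    rw [show k.natAbs + 2 * ℓ + a - k.natAbs - 2 * ℓ = a by omega] at h2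
    exact h2.trans (key _ c hc (by omega))

end Terms

/-! ### The three-dimensional case -/

theorem exists_normSq_equiv_three (m : ℕ) : ∃ c C : ℝ≥0, 0 < c ∧ 0 < C ∧
    ∀ (k : ℤ) (U : Set ((ℝ × ℝ) × ℝ)), IsOpen U → IsAxisymmetric3 U →
    ∀ w : ℝ × ℝ → ℂ, MemLp w 2 (meridianMeasure3 (meridian3 U)) →
      c * normSqHk3 m k U w ≤ normSqC3 m k (meridian3 U) w ∧
      normSqC3 m k (meridian3 U) w ≤ C * normSqHk3 m k U w := by
  obtain ⟨K₁, hK₁⟩ := exists_weighted_le_of_cartNormSq_le (1 : ℝ) m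
  obtain ⟨K₂, hK₂⟩ := exists_cartNormSq_le_weighted (1 : ℝ) m
  obtain ⟨c, C, hc, hC, h⟩ := exists_equivalence_constants K₁ K₂
    ((2 * m + 1) * multiIndexCount 2 m) (multiIndexCount 3 m)
  refine ⟨c, C, hc, hC, fun k U hU hr w hw => h _ _ ?_ fun hS => ?_⟩
  · have h1 := hK₁ k U hU hr w hw m (normSqHk3 m k U w) fun i l c _ hm =>
      normSqL2_multiDeriv_le (μ := volume.restrict U) (Ω := U)
        (e := ![((1, 0), 0), ((0, 1), 0), ((0, 0), 1)]) (T := ofFun U (lift3 k w))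
        (α := ![i, l, c]) (by simpa [Fin.sum_univ_three] using hm)
    refine normSqC_le (fun ℓ α hℓ hα => ?_) (fun ℓ α _ hα => ?_)
    · rw [Fin.sum_univ_two] at hα
      exact h1.1 ℓ (α 0) (α 1) (by omega) hℓ hα
    · rw [Fin.sum_univ_two] at hα
      exact h1.2 ℓ (α 0) (α 1) (by omega) hα
  · refine normSqSobolev_le fun α hα => ?_
    rw [Fin.sum_univ_three] at hα
    refine hK₂ k U hU hr w hw m _ hS (fun n c _ hn ℓ hℓ hℓn => ?_) (fun n c _ hn ℓ hℓ hℓn => ?_)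
      (α 0) (α 1) (α 2) (by omega) hα
    · exact radial_term_le_normSqC (e := ![(1, 0), (0, 1)]) (α := ![n - ℓ, c]) (er := (1, 0)) hℓ
        (by simp only [Fin.sum_univ_two, Matrix.cons_val_zero, Matrix.cons_val_one]; omega)
    · exact axis_term_le_normSqC (e := ![(1, 0), (0, 1)]) (α := ![n - k.natAbs - 2 * ℓ, c])
        (er := (1, 0)) hℓ
        (by simp only [Fin.sum_univ_two, Matrix.cons_val_zero, Matrix.cons_val_one]; omega)

/-! ### The two-dimensional case -/

section Plane

variable {U : Set (ℝ × ℝ)}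

theorem meridian_preimage_fst (U : Set (ℝ × ℝ)) :
    meridian (Prod.fst ⁻¹' U : Set ((ℝ × ℝ) × PUnit.{1})) = Prod.fst ⁻¹' meridian2 U := rfl

theorem measurePreserving_meridianMeasure (Ω : Set ℝ) :
    MeasurePreserving (ContinuousLinearEquiv.prodUnique ℝ ℝ PUnit.{1})
      (meridianMeasure (Prod.fst ⁻¹' Ω)) (meridianMeasure2 Ω) :=
  measurePreserving_withDensity (f := fun r => ENNReal.ofReal (2 * Real.pi * r))
    (measurePreserving_prodUnique ℝ) Ω
    (ENNReal.measurable_ofReal.comp (measurable_const_mul (2 * Real.pi)))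

theorem cartNormSq_comp_fst (k : ℤ) (U : Set (ℝ × ℝ)) (w : ℝ → ℂ) (i l : ℕ) :
    cartNormSq k (Prod.fst ⁻¹' U : Set ((ℝ × ℝ) × PUnit.{1})) (w ∘ Prod.fst) 0 i l 0 =
      normSqL2 (volume.restrict U) U
        ((pderiv (1, 0))^[i] ((pderiv (0, 1))^[l] (ofFun U (lift2 k w)))) := by
  have hL := measurePreserving_prodUnique (ℝ × ℝ)
  exact (((corresponds_ofFun hL U (lift2 k w)).iterate_pderiv ((0, 1), 0) l).iterate_pderiv
    ((1, 0), 0) i).normSqL2_eq hL (hL.restrict_preimage_emb (measurableEmbedding_equiv _) U)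

theorem radNormSq_comp_fst (k : ℤ) (Ω : Set ℝ) (w : ℝ → ℂ) (ℓ a : ℕ) :
    radNormSq k (Prod.fst ⁻¹' Ω : Set (ℝ × PUnit.{1})) (w ∘ Prod.fst) 0 ℓ a 0 =
      normSqL2 (meridianMeasure2 Ω) Ω
        ((pderiv 1)^[a] (mulBy (fun r => ((k.natAbs : ℝ) / r) ^ ℓ) (ofFun Ω w))) := by
  have hL := measurePreserving_prodUnique ℝ
  exact (((corresponds_ofFun hL Ω w).mulBy fun r => ((k.natAbs : ℝ) / r) ^ ℓ).iterate_pderiv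
    (1, 0) a).normSqL2_eq hL (measurePreserving_meridianMeasure Ω)

theorem axisNormSq_comp_fst (k : ℤ) (Ω : Set ℝ) (w : ℝ → ℂ) (ℓ a : ℕ) :
    axisNormSq k (Prod.fst ⁻¹' Ω : Set (ℝ × PUnit.{1})) (w ∘ Prod.fst) 0 ℓ a 0 =
      normSqL2 (meridianMeasure2 Ω) Ω
        ((pderiv 1)^[a] ((fun S => mulBy (fun r => 1 / r) (pderiv 1 S))^[ℓ]
          (mulBy (fun r => (1 / r) ^ k.natAbs) (ofFun Ω w)))) := by
  have hL := measurePreserving_prodUnique ℝ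
  have h : ∀ (S : Functional (ℝ × PUnit.{1})) (S' : Functional ℝ),
      Corresponds (ContinuousLinearEquiv.prodUnique ℝ ℝ PUnit.{1}) S S' →
      Corresponds (ContinuousLinearEquiv.prodUnique ℝ ℝ PUnit.{1})
        (mulBy (fun p => 1 / p.1) (pderiv (1, 0) S)) (mulBy (fun r => 1 / r) (pderiv 1 S')) :=
    fun S S' hS => (hS.pderiv (1, 0)).mulBy fun r => 1 / r
  exact ((((corresponds_ofFun hL Ω w).mulBy fun r => (1 / r) ^ k.natAbs).iterate h
    ℓ).iterate_pderiv (1, 0) a).normSqL2_eq hL (measurePreserving_meridianMeasure Ω)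

theorem exists_normSq_equiv_two (m : ℕ) : ∃ c C : ℝ≥0, 0 < c ∧ 0 < C ∧
    ∀ (k : ℤ) (U : Set (ℝ × ℝ)), IsOpen U → IsAxisymmetric2 U →
    ∀ w : ℝ → ℂ, MemLp w 2 (meridianMeasure2 (meridian2 U)) →
      c * normSqHk2 m k U w ≤ normSqC2 m k (meridian2 U) w ∧
      normSqC2 m k (meridian2 U) w ≤ C * normSqHk2 m k U w := by
  obtain ⟨K₁, hK₁⟩ := exists_weighted_le_of_cartNormSq_le (0 : PUnit.{1}) m
  obtain ⟨K₂, hK₂⟩ := exists_cartNormSq_le_weighted (0 : PUnit.{1}) m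
  obtain ⟨c, C, hc, hC, h⟩ := exists_equivalence_constants K₁ K₂
    ((2 * m + 1) * multiIndexCount 1 m) (multiIndexCount 2 m)
  refine ⟨c, C, hc, hC, fun k U hU hr w hw => ?_⟩
  have hU' : IsOpen (Prod.fst ⁻¹' U : Set ((ℝ × ℝ) × PUnit.{1})) := hU.preimage continuous_fst
  have hr' : IsAxisymmetric (Prod.fst ⁻¹' U : Set ((ℝ × ℝ) × PUnit.{1})) :=
    fun θ x hx => hr θ x.1 hx
  have hw' : MemLp (w ∘ Prod.fst) 2
      (meridianMeasure (meridian (Prod.fst ⁻¹' U : Set ((ℝ × ℝ) × PUnit.{1})))) :=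
    hw.comp_measurePreserving (measurePreserving_meridianMeasure (meridian2 U))
  -- The axial order is limited to `0`: the planar norms contain no axial derivatives.
  have hK₁ := hK₁ k _ hU' hr' _ hw' 0
  have hK₂ := hK₂ k _ hU' hr' _ hw' 0
  rw [meridian_preimage_fst] at hK₁ hK₂
  refine h _ _ ?_ fun hS => ?_
  · have h1 := hK₁ (normSqHk2 m k U w) fun i l c hc hm => by
      obtain rfl : c = 0 := by omega
      rw [cartNormSq_comp_fst]
      exact normSqL2_multiDeriv_le (e := ![(1, 0), (0, 1)]) (α := ![i, l])
        (by simpa [Fin.sum_univ_two] using hm)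
    refine normSqC_le (fun ℓ α hℓ hα => ?_) (fun ℓ α _ hα => ?_)
    · rw [Fin.sum_univ_one] at hα
      have h2 := h1.1 ℓ (α 0) 0 le_rfl hℓ hα
      rw [radNormSq_comp_fst] at h2
      exact h2
    · rw [Fin.sum_univ_one] at hα
      have h2 := h1.2 ℓ (α 0) 0 le_rfl hα
      rw [axisNormSq_comp_fst] at h2
      exact h2
  · refine normSqSobolev_le fun α hα => ?_
    rw [Fin.sum_univ_two] at hα
    have h2 := hK₂ _ hS (fun n c hc hn ℓ hℓ hℓn => ?_) (fun n c hc hn ℓ hℓ hℓn => ?_)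
      (α 0) (α 1) 0 le_rfl hα
    · rw [cartNormSq_comp_fst] at h2
      exact h2
    · obtain rfl : c = 0 := by omega
      rw [radNormSq_comp_fst]
      exact radial_term_le_normSqC (e := ![1]) (α := ![n - ℓ]) (er := 1) hℓ
        (by simp only [Fin.sum_univ_one, Matrix.cons_val_zero]; omega)
    · obtain rfl : c = 0 := by omega
      rw [axisNormSq_comp_fst]
      exact axis_term_le_normSqC (e := ![1]) (α := ![n - k.natAbs - 2 * ℓ]) (er := 1) hℓ
        (by simp only [Fin.sum_univ_one, Matrix.cons_val_zero]; omega)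

end Plane

end AxiSobolev

theorem theorem1p1 :
    (∀ m : ℕ, ∃ c C : ℝ≥0, 0 < c ∧ 0 < C ∧
      ∀ (k : ℤ) (U : Set ((ℝ × ℝ) × ℝ)), IsOpen U → AxiSobolev.IsAxisymmetric3 U →
      ∀ w : ℝ × ℝ → ℂ,
        MemLp w 2 (AxiSobolev.meridianMeasure3 (AxiSobolev.meridian3 U)) →
        (c : ℝ≥0∞) * AxiSobolev.normSqHk3 m k U w
            ≤ AxiSobolev.normSqC3 m k (AxiSobolev.meridian3 U) w ∧
        AxiSobolev.normSqC3 m k (AxiSobolev.meridian3 U) w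
            ≤ (C : ℝ≥0∞) * AxiSobolev.normSqHk3 m k U w) ∧
    (∀ m : ℕ, ∃ c C : ℝ≥0, 0 < c ∧ 0 < C ∧
      ∀ (k : ℤ) (U : Set (ℝ × ℝ)), IsOpen U → AxiSobolev.IsAxisymmetric2 U →
      ∀ w : ℝ → ℂ,
        MemLp w 2 (AxiSobolev.meridianMeasure2 (AxiSobolev.meridian2 U)) →
        (c : ℝ≥0∞) * AxiSobolev.normSqHk2 m k U w
            ≤ AxiSobolev.normSqC2 m k (AxiSobolev.meridian2 U) w ∧
        AxiSobolev.normSqC2 m k (AxiSobolev.meridian2 U) w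
            ≤ (C : ℝ≥0∞) * AxiSobolev.normSqHk2 m k U w) :=
  ⟨AxiSobolev.exists_normSq_equiv_three, AxiSobolev.exists_normSq_equiv_two⟩
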